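/- A (finite, normal play) game $X$ is given by a finite set of Left options and a finite set of Right options, each of them a game; Left and Right move alternately, and a player who cannot move on their turn loses. Two games $X,Y$ are equal, $X=Y$, if $X+Z$ and $Y+Z$ have the same outcome for every game $Z$, where $+$ is the disjunctive sum; the equivalence classes are called values. The birthday of $X$ is the least non-negative integer strictly greater than the birthdays of all options of $X$, and $X$ is born by day $b$ if its birthday is at most $b$. A digraph placement game is played on a finite digraph (no loops, no multiple arcs) whose vertices are coloured blue and red, not necessarily properly: Left chooses a blue vertex, Right chooses a red vertex, and the chosen vertex is deleted together with all its out-neighbours. For a game $X$ let $f(X)$ be the least number of vertices of a digraph placement game equal to $X$, and let $F(b)$ be the maximum of $f(X)$ over all games $X$ born by day $b$. Theorem. For every game $X$ born by day $3$ there is a digraph placement game $G$ with at most $8$ vertices such that $G=X$. Furthermore, there is a game $X$ with birthday $3$ such that $H\neq X$ for all digraph placement games $H$ with at most $7$ vertices. Consequently $F(3)=8$. The number of values of games born by day $3$ is $1474$. -/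

import Mathlib

/-- The two players: Left (blue) and Right (red). -/
inductive Player : Type
  | left : Player
  | right : Player

/-- A (short) normal play combinatorial game `{L | R}`: a finite family `L` of Left options and a
finite family `R` of Right options, each of them a game. The order and the multiplicity in which
options are listed are irrelevant for all the notions below. -/
inductive CGame : Type
  | mk {m n : ℕ} (L : Fin m → CGame) (R : Fin n → CGame) : CGame

namespace CGame

/-- `Wins X p q`: player `p` has a winning strategy in `X` under the normal play convention when
player `q` is the next to move (a player who has to move and cannot loses). -/
def Wins : CGame → Player → Player → Prop
  | mk L _, Player.left, Player.left => ∃ i, Wins (L i) Player.left Player.right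
  | mk L _, Player.right, Player.left => ∀ i, Wins (L i) Player.right Player.right
  | mk _ R, Player.left, Player.right => ∀ j, Wins (R j) Player.left Player.left
  | mk _ R, Player.right, Player.right => ∃ j, Wins (R j) Player.right Player.left

/-- Two games have the same outcome: for each choice of the starting player, the same player has
a winning strategy in both. -/
def SameOutcome (X Y : CGame) : Prop :=
  ∀ p q : Player, Wins X p q ↔ Wins Y p q

/-- Auxiliary to `add`: the sum of a fixed game `{L | R}` with a variable game, given the
functions `fL i = (L i + ·)` and `fR j = (R j + ·)`. -/
def addAux {m n : ℕ} (fL : Fin m → CGame → CGame) (fR : Fin n → CGame → CGame) : CGame → CGame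
  | mk L' R' =>
      mk (Fin.addCases (fun i => fL i (mk L' R')) (fun i => addAux fL fR (L' i)))
        (Fin.addCases (fun j => fR j (mk L' R')) (fun j => addAux fL fR (R' j)))

/-- The disjunctive sum of two games: a player moves in exactly one of the two components. -/
def add : CGame → CGame → CGame
  | mk L R => addAux (fun i => add (L i)) (fun j => add (R j))

instance : Add CGame := ⟨add⟩

/-- The usual recursion for the disjunctive sum. -/
theorem mk_add_mk {m n m' n' : ℕ} (L : Fin m → CGame) (R : Fin n → CGame)
    (L' : Fin m' → CGame) (R' : Fin n' → CGame) :
    mk L R + mk L' R' =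
      mk (Fin.addCases (fun i => L i + mk L' R') (fun i => mk L R + L' i))
        (Fin.addCases (fun j => R j + mk L' R') (fun j => mk L R + R' j)) := rfl

/-- Equality of games `X = Y`: `X + Z` and `Y + Z` have the same outcome for all games `Z`. -/
def Equal (X Y : CGame) : Prop :=
  ∀ Z : CGame, SameOutcome (X + Z) (Y + Z)

/-- The (formal) birthday of a game: the least natural number strictly greater than the birthday
of every option. -/
def birthday : CGame → ℕ
  | mk L R =>
      max (Finset.univ.sup fun i => birthday (L i) + 1)
        (Finset.univ.sup fun j => birthday (R j) + 1)

/-- Equality of games is an equivalence relation. -/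
theorem equal_equivalence : Equivalence Equal where
  refl _ := fun _ _ _ => Iff.rfl
  symm h := fun Z p q => (h Z p q).symm
  trans h h' := fun Z p q => (h Z p q).trans (h' Z p q)

/-- Games up to equality. -/
def valueSetoid : Setoid CGame := ⟨Equal, equal_equivalence⟩

/-- Game values: the equivalence classes of games under equality. -/
def Value : Type := Quotient valueSetoid

/-- The value of a game. -/
def value (X : CGame) : Value := Quotient.mk valueSetoid X

/-- The set of values born by day `b`. -/
def valuesBornBy (b : ℕ) : Set Value :=
  {v | ∃ X : CGame, X.birthday ≤ b ∧ X.value = v}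

end CGame

/-- A digraph without loops (and without multiple arcs) on the vertex set `V`, with a (not
necessarily proper) colouring of the vertices by blue (`Player.left`) and red (`Player.right`). -/
structure ColouredDigraph (V : Type) extends Digraph V where
  /-- There are no loops. -/
  loopless : ∀ v, ¬ Adj v v
  /-- The colour of a vertex, given as the player who may choose it. -/
  colour : V → Player

namespace ColouredDigraph

variable {V : Type} (G : ColouredDigraph V)

open Classical in
/-- The vertices of the given player's colour among the remaining vertices `S`. -/
noncomputable def moves (S : Finset V) (p : Player) : Finset V :=
  S.filter fun v => G.colour v = p

open Classical in
/-- The vertices that remain when the closed out-neighbourhood of `v` is deleted from `S`. -/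
noncomputable def delete (S : Finset V) (v : V) : Finset V :=
  S.filter fun u => ¬ (u = v ∨ G.Adj v u)

theorem card_delete_lt {S : Finset V} {p : Player} (v : G.moves S p) :
    (G.delete S v).card < S.card := by
  classical
  have hv : v.1 ∈ S := (Finset.mem_filter.1 v.2).1
  refine Finset.card_lt_card (Finset.filter_ssubset.2 ⟨v.1, hv, ?_⟩)
  simp

/-- The digraph placement game played on the subdigraph of `G` induced by the vertex set `S`: a
player chooses a vertex `v` of `S` of that player's colour, and the closed out-neighbourhood of
`v` is deleted. -/
noncomputable def gameOn (S : Finset V) : CGame :=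
  CGame.mk
    (fun i : Fin (G.moves S Player.left).card =>
      gameOn (G.delete S ((G.moves S Player.left).equivFin.symm i)))
    (fun j : Fin (G.moves S Player.right).card =>
      gameOn (G.delete S ((G.moves S Player.right).equivFin.symm j)))
termination_by S.card
decreasing_by all_goals exact G.card_delete_lt _

/-- The digraph placement game played on the whole of `G`. -/
noncomputable def game [Fintype V] : CGame := G.gameOn Finset.univ

end ColouredDigraph

namespace CGame

/-- Some digraph placement game on exactly `n` vertices is equal to `X`. -/
def RealizableOn (X : CGame) (n : ℕ) : Prop :=
  ∃ (V : Type) (_ : Fintype V) (G : ColouredDigraph V), Fintype.card V = n ∧ Equal G.game X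

/-- `f(X) = k`: the least number of vertices of a digraph placement game equal to `X` exists and
is `k`. -/
def MinVertices (X : CGame) (k : ℕ) : Prop :=
  IsLeast {n : ℕ | X.RealizableOn n} k

/-- `F(b) = k`: `f(X)` exists for all games `X` born by day `b`, and the maximum of `f(X)` over
these games is `k`. -/
def MaxMinVertices (b k : ℕ) : Prop :=
  (∀ X : CGame, X.birthday ≤ b → ∃ n, X.MinVertices n) ∧
    IsGreatest {n : ℕ | ∃ X : CGame, X.birthday ≤ b ∧ X.MinVertices n} k

end CGame

/-! Equality of games amounts to `X ≤ Y` and `Y ≤ X` in the usual recursive order (`equal_iff`), so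
everything is a matter of comparisons.

Upper bound and count. Every game born by day two is equal to one of 22 games `dayTwo k`. A game all
of whose options are equal to such games is determined, up to equality, by its profile: 44 bits
telling which `dayTwo k` lie above it and which below (`le_of_isProfile`). The profile can be
computed from two sets: the `k` with `dayTwo k` below some Left option, and those with `dayTwo k`
above some Right option (`IsOptionMask.isProfile`). These are unions of principal down-sets and
up-sets of the day-two order, so they run through two short lists, and an exhaustive check shows
that the resulting profiles lie in a list of 1474 distinct keys (`profile_mem_keys`). For each key a
digraph on eight vertices is given that has this profile and whose options are equal to day-two
games; the kernel evaluates the profile recursively. Hence the listed digraphs represent each value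
born by day three exactly once.

Lower bound. The game `extremal` is {2 | ↑, ↑*, ±1}. A digraph game equal to it has at least three
blue vertices, since Left needs a move to a position `≥ 2`. With at most seven vertices, counting
shows that the relevant Right moves are not reversible (`not_extremal_le_delete_delete`), so there
are red vertices whose choice leaves exactly ↑, ↑* and ±1. If these are the only red vertices,
comparing what survives different pairs of deletions gives a contradiction (`false_of_three_red`).
Otherwise there are exactly three blue and four red vertices, and Left's move to `≥ 2` deletes all
red vertices and no other blue one. Then ↑ and ↑* must live on the other two blue vertices; the
structure this forces (`exists_of_upStar`, `exists_of_up`) pins down all seven vertices and is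
contradictory (`false_of_three_blue`). -/

namespace CGame

/-! ### The order on games, and equality as mutual comparison. -/

/-- The set of Left options. -/
def leftOptions : CGame → Set CGame
  | mk L _ => Set.range L

/-- The set of Right options. -/
def rightOptions : CGame → Set CGame
  | mk _ R => Set.range R

theorem birthday_lt_of_mem_left {X x : CGame} (h : x ∈ X.leftOptions) :
    x.birthday < X.birthday := by
  cases X with
  | mk L R =>
    obtain ⟨i, rfl⟩ := h
    rw [birthday]
    exact lt_of_lt_of_le (Nat.lt_succ_self _)
      (le_max_of_le_left (Finset.le_sup (f := fun i => birthday (L i) + 1) (Finset.mem_univ i)))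

theorem birthday_lt_of_mem_right {X x : CGame} (h : x ∈ X.rightOptions) :
    x.birthday < X.birthday := by
  cases X with
  | mk L R =>
    obtain ⟨j, rfl⟩ := h
    rw [birthday]
    exact lt_of_lt_of_le (Nat.lt_succ_self _)
      (le_max_of_le_right (Finset.le_sup (f := fun j => birthday (R j) + 1) (Finset.mem_univ j)))

theorem birthday_le_of_options {X : CGame} {b : ℕ} (hl : ∀ x ∈ X.leftOptions, x.birthday < b)
    (hr : ∀ x ∈ X.rightOptions, x.birthday < b) : X.birthday ≤ b := by
  cases X with
  | mk L R =>
    rw [birthday]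
    exact max_le (Finset.sup_le fun i _ => hl _ ⟨i, rfl⟩) (Finset.sup_le fun j _ => hr _ ⟨j, rfl⟩)

/-- The order of games: `X ≤ Y` if no Left option of `X` is `≥ Y` and no Right option of `Y`
is `≤ X`. -/
def Le : CGame → CGame → Prop
  | mk L R, mk L' R' =>
      (∀ i, ¬ Le (mk L' R') (L i)) ∧ ∀ j, ¬ Le (R' j) (mk L R)
termination_by X Y => X.birthday + Y.birthday
decreasing_by
  · have := birthday_lt_of_mem_left (X := mk L R) ⟨i, rfl⟩
    omega
  · have := birthday_lt_of_mem_right (X := mk L' R') ⟨j, rfl⟩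
    omega

instance : LE CGame := ⟨Le⟩

theorem le_iff {X Y : CGame} :
    X ≤ Y ↔ (∀ x ∈ X.leftOptions, ¬ Y ≤ x) ∧ ∀ y ∈ Y.rightOptions, ¬ y ≤ X := by
  cases X with
  | mk L R =>
    cases Y with
    | mk L' R' =>
      change Le _ _ ↔ _
      rw [Le]
      simp only [leftOptions, rightOptions, Set.forall_mem_range]
      rfl

theorem not_le_iff {X Y : CGame} :
    ¬ X ≤ Y ↔ (∃ x ∈ X.leftOptions, Y ≤ x) ∨ ∃ y ∈ Y.rightOptions, y ≤ X := by
  rw [le_iff, not_and_or]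
  push Not
  rfl

theorem le_refl_aux (n : ℕ) : ∀ X : CGame, X.birthday < n → X ≤ X := by
  induction n with
  | zero => intro X h; omega
  | succ n ih =>
    intro X h
    refine le_iff.2 ⟨fun x hx hle => ?_, fun x hx hle => ?_⟩
    · exact (le_iff.1 hle).1 x hx (ih x (by have := birthday_lt_of_mem_left hx; omega))
    · exact (le_iff.1 hle).2 x hx (ih x (by have := birthday_lt_of_mem_right hx; omega))

theorem le_trans_aux (n : ℕ) : ∀ X Y Z : CGame,
    X.birthday + Y.birthday + Z.birthday < n → X ≤ Y → Y ≤ Z → X ≤ Z := by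
  induction n with
  | zero => intro X Y Z h; omega
  | succ n ih =>
    intro X Y Z h hXY hYZ
    refine le_iff.2 ⟨fun x hx hle => ?_, fun z hz hle => ?_⟩
    · exact (le_iff.1 hXY).1 x hx
        (ih Y Z x (by have := birthday_lt_of_mem_left hx; omega) hYZ hle)
    · exact (le_iff.1 hYZ).2 z hz
        (ih z X Y (by have := birthday_lt_of_mem_right hz; omega) hle hXY)

instance : Preorder CGame where
  le_refl X := le_refl_aux _ X (Nat.lt_succ_self _)
  le_trans X Y Z := le_trans_aux _ X Y Z (Nat.lt_succ_self _)

theorem not_le_of_mem_left {X x : CGame} (hx : x ∈ X.leftOptions) : ¬ X ≤ x :=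
  (le_iff.1 (le_refl X)).1 x hx

theorem not_le_of_mem_right {X x : CGame} (hx : x ∈ X.rightOptions) : ¬ x ≤ X :=
  (le_iff.1 (le_refl X)).2 x hx

theorem wins_left_left {X : CGame} :
    Wins X .left .left ↔ ∃ x ∈ X.leftOptions, Wins x .left .right := by
  cases X; simp [Wins, leftOptions]

theorem wins_left_right {X : CGame} :
    Wins X .left .right ↔ ∀ x ∈ X.rightOptions, Wins x .left .left := by
  cases X; simp [Wins, rightOptions]

theorem wins_right_iff (X : CGame) (q : Player) : Wins X .right q ↔ ¬ Wins X .left q := by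
  induction X generalizing q with
  | mk L R ihL ihR => cases q <;> simp [Wins, ihL, ihR]

theorem mem_leftOptions_add {X Y z : CGame} : z ∈ (X + Y).leftOptions ↔
    (∃ x ∈ X.leftOptions, z = x + Y) ∨ ∃ y ∈ Y.leftOptions, z = X + y := by
  cases X with
  | mk L R =>
    cases Y with
    | mk L' R' =>
      rw [mk_add_mk]
      simp only [leftOptions, Set.mem_range, exists_exists_eq_and]
      constructor
      · rintro ⟨i, rfl⟩
        induction i using Fin.addCases with
        | left i => exact .inl ⟨i, by simp⟩
        | right i => exact .inr ⟨i, by simp⟩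
      · rintro (⟨i, rfl⟩ | ⟨i, rfl⟩)
        · exact ⟨Fin.castAdd _ i, by simp⟩
        · exact ⟨Fin.natAdd _ i, by simp⟩

theorem mem_rightOptions_add {X Y z : CGame} : z ∈ (X + Y).rightOptions ↔
    (∃ x ∈ X.rightOptions, z = x + Y) ∨ ∃ y ∈ Y.rightOptions, z = X + y := by
  cases X with
  | mk L R =>
    cases Y with
    | mk L' R' =>
      rw [mk_add_mk]
      simp only [rightOptions, Set.mem_range, exists_exists_eq_and]
      constructor
      · rintro ⟨i, rfl⟩
        induction i using Fin.addCases with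
        | left i => exact .inl ⟨i, by simp⟩
        | right i => exact .inr ⟨i, by simp⟩
      · rintro (⟨i, rfl⟩ | ⟨i, rfl⟩)
        · exact ⟨Fin.castAdd _ i, by simp⟩
        · exact ⟨Fin.natAdd _ i, by simp⟩

/-- The negative of a game: the roles of Left and Right are exchanged. -/
def neg : CGame → CGame
  | mk L R => mk (fun j => neg (R j)) (fun i => neg (L i))

theorem mem_leftOptions_neg {X z : CGame} :
    z ∈ X.neg.leftOptions ↔ ∃ x ∈ X.rightOptions, z = x.neg := by
  cases X; simp [neg, leftOptions, rightOptions, eq_comm]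

theorem mem_rightOptions_neg {X z : CGame} :
    z ∈ X.neg.rightOptions ↔ ∃ x ∈ X.leftOptions, z = x.neg := by
  cases X; simp [neg, leftOptions, rightOptions, eq_comm]

/-- One move in `Y - X` turns either half into the other half for a smaller pair, exactly as in the
recursion of `≤`; hence the two halves are proved together. -/
theorem wins_add_neg_aux (n : ℕ) : ∀ X Y : CGame, X.birthday + Y.birthday < n →
    (Wins (Y + X.neg) .left .right ↔ X ≤ Y) ∧ (Wins (Y + X.neg) .left .left ↔ ¬ Y ≤ X) := by
  induction n with
  | zero => intro X Y h; omega
  | succ n ih =>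
    intro X Y h
    constructor
    · rw [wins_left_right, le_iff]
      simp only [mem_rightOptions_add, mem_rightOptions_neg]
      constructor
      · intro H
        refine ⟨fun x hx => ?_, fun y hy => ?_⟩
        · exact (ih x Y (by have := birthday_lt_of_mem_left hx; omega)).2.1
            (H _ (.inr ⟨_, ⟨x, hx, rfl⟩, rfl⟩))
        · exact (ih X y (by have := birthday_lt_of_mem_right hy; omega)).2.1
            (H _ (.inl ⟨y, hy, rfl⟩))
      · rintro ⟨H1, H2⟩ z (⟨y, hy, rfl⟩ | ⟨_, ⟨x, hx, rfl⟩, rfl⟩)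
        · exact (ih X y (by have := birthday_lt_of_mem_right hy; omega)).2.2 (H2 y hy)
        · exact (ih x Y (by have := birthday_lt_of_mem_left hx; omega)).2.2 (H1 x hx)
    · rw [wins_left_left, not_le_iff]
      simp only [mem_leftOptions_add, mem_leftOptions_neg]
      constructor
      · rintro ⟨z, ⟨y, hy, rfl⟩ | ⟨_, ⟨x, hx, rfl⟩, rfl⟩, hz⟩
        · exact .inl ⟨y, hy, (ih X y (by have := birthday_lt_of_mem_left hy; omega)).1.1 hz⟩
        · exact .inr ⟨x, hx, (ih x Y (by have := birthday_lt_of_mem_right hx; omega)).1.1 hz⟩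
      · rintro (⟨y, hy, hle⟩ | ⟨x, hx, hle⟩)
        · exact ⟨_, .inl ⟨y, hy, rfl⟩,
            (ih X y (by have := birthday_lt_of_mem_left hy; omega)).1.2 hle⟩
        · exact ⟨_, .inr ⟨_, ⟨x, hx, rfl⟩, rfl⟩,
            (ih x Y (by have := birthday_lt_of_mem_right hx; omega)).1.2 hle⟩

theorem wins_add_neg {X Y : CGame} : Wins (Y + X.neg) .left .right ↔ X ≤ Y :=
  (wins_add_neg_aux _ X Y (Nat.lt_succ_self _)).1

/-- Left carries her strategy from `X + Z` over to `Y + Z`: where a move has no counterpart, the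
failing comparison in the definition of `X ≤ Y` supplies either a matching option or a reversal. -/
theorem wins_add_mono_aux (n : ℕ) : ∀ X Y Z : CGame,
    X.birthday + Y.birthday + Z.birthday < n → X ≤ Y →
    ∀ q, Wins (X + Z) .left q → Wins (Y + Z) .left q := by
  induction n with
  | zero => intro X Y Z h; omega
  | succ n ih =>
    intro X Y Z h hXY q
    obtain ⟨h1, h2⟩ := le_iff.1 hXY
    cases q with
    | left =>
      rw [wins_left_left, wins_left_left]
      simp only [mem_leftOptions_add]
      rintro ⟨_, ⟨x, hx, rfl⟩ | ⟨z, hz, rfl⟩, hw⟩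
      · have hbx := birthday_lt_of_mem_left hx
        -- As `Y ≤ x` fails, some Left option of `Y` is above `x`, or some Right option `x'` of `x`
        -- is below `Y`. In the second case Left wins moving first in `x' + Z`, hence also in `Y +
        -- Z`.
        rcases not_le_iff.1 (h1 x hx) with ⟨y, hy, hle⟩ | ⟨x', hx', hle⟩
        · have hby := birthday_lt_of_mem_left hy
          exact ⟨_, .inl ⟨y, hy, rfl⟩, ih x y Z (by omega) hle _ hw⟩
        · have hbx' := birthday_lt_of_mem_right hx'
          have := ih x' Y Z (by omega) hle .left
            (wins_left_right.1 hw _ (mem_rightOptions_add.2 (.inl ⟨x', hx', rfl⟩)))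
          simpa only [mem_leftOptions_add] using wins_left_left.1 this
      · have hbz := birthday_lt_of_mem_left hz
        exact ⟨_, .inr ⟨z, hz, rfl⟩, ih X Y z (by omega) hXY _ hw⟩
    | right =>
      intro hw
      rw [wins_left_right] at hw ⊢
      simp only [mem_rightOptions_add] at hw ⊢
      rintro _ (⟨y, hy, rfl⟩ | ⟨z, hz, rfl⟩)
      · have hby := birthday_lt_of_mem_right hy
        rcases not_le_iff.1 (h2 y hy) with ⟨y', hy', hle⟩ | ⟨x, hx, hle⟩
        · have hby' := birthday_lt_of_mem_left hy'
          refine wins_left_left.2 ⟨_, mem_leftOptions_add.2 (.inl ⟨y', hy', rfl⟩), ?_⟩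
          refine ih X y' Z (by omega) hle .right (wins_left_right.2 ?_)
          simpa only [mem_rightOptions_add] using hw
        · have hbx := birthday_lt_of_mem_right hx
          exact ih x y Z (by omega) hle _ (hw _ (.inl ⟨x, hx, rfl⟩))
      · have hbz := birthday_lt_of_mem_right hz
        exact ih X Y z (by omega) hXY _ (hw _ (.inr ⟨z, hz, rfl⟩))

/-- Equality of games in terms of the order. -/
theorem equal_iff {X Y : CGame} : Equal X Y ↔ X ≤ Y ∧ Y ≤ X := by
  constructor
  · intro h
    -- Testing with `Z = -X` suffices: Left wins `X - X` moving second, hence also `Y - X`, which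
    -- means `X ≤ Y`.
    exact ⟨wins_add_neg.1 ((h X.neg _ _).1 (wins_add_neg.2 le_rfl)),
      wins_add_neg.1 ((h Y.neg _ _).2 (wins_add_neg.2 le_rfl))⟩
  · rintro ⟨h1, h2⟩ Z p q
    have key : Wins (X + Z) .left q ↔ Wins (Y + Z) .left q :=
      ⟨wins_add_mono_aux _ X Y Z (Nat.lt_succ_self _) h1 q,
        wins_add_mono_aux _ Y X Z (Nat.lt_succ_self _) h2 q⟩
    cases p
    · exact key
    · rw [wins_right_iff, wins_right_iff, key]

theorem value_eq_iff {X Y : CGame} : X.value = Y.value ↔ X ≤ Y ∧ Y ≤ X :=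
  Quotient.eq.trans equal_iff

end CGame

/-! ### Options of positions of digraph placement games. -/

namespace ColouredDigraph

variable {V : Type} (G : ColouredDigraph V)

theorem mem_moves {S : Finset V} {p : Player} {v : V} :
    v ∈ G.moves S p ↔ v ∈ S ∧ G.colour v = p := by
  simp [moves]

theorem mem_delete {S : Finset V} {u v : V} :
    u ∈ G.delete S v ↔ u ∈ S ∧ u ≠ v ∧ ¬ G.Adj v u := by
  simp [delete]

theorem mem_leftOptions_gameOn {S : Finset V} {x : CGame} : x ∈ (G.gameOn S).leftOptions ↔
    ∃ v ∈ S, G.colour v = .left ∧ x = G.gameOn (G.delete S v) := by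
  rw [gameOn]
  simp only [CGame.leftOptions, Set.mem_range]
  constructor
  · rintro ⟨i, rfl⟩
    have := G.mem_moves.1 ((G.moves S .left).equivFin.symm i).2
    exact ⟨_, this.1, this.2, rfl⟩
  · rintro ⟨v, hv, hc, rfl⟩
    exact ⟨(G.moves S .left).equivFin ⟨v, G.mem_moves.2 ⟨hv, hc⟩⟩, by simp⟩

theorem mem_rightOptions_gameOn {S : Finset V} {x : CGame} : x ∈ (G.gameOn S).rightOptions ↔
    ∃ v ∈ S, G.colour v = .right ∧ x = G.gameOn (G.delete S v) := by
  rw [gameOn]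
  simp only [CGame.rightOptions, Set.mem_range]
  constructor
  · rintro ⟨i, rfl⟩
    have := G.mem_moves.1 ((G.moves S .right).equivFin.symm i).2
    exact ⟨_, this.1, this.2, rfl⟩
  · rintro ⟨v, hv, hc, rfl⟩
    exact ⟨(G.moves S .right).equivFin ⟨v, G.mem_moves.2 ⟨hv, hc⟩⟩, by simp⟩

end ColouredDigraph

/-! ### The 22 values born by day two and their order. -/

namespace CGame

theorem mem_leftOptions_mk {m n : ℕ} (L : Fin m → CGame) (R : Fin n → CGame) (i : Fin m) :
    L i ∈ (mk L R).leftOptions := ⟨i, rfl⟩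

theorem mem_rightOptions_mk {m n : ℕ} (L : Fin m → CGame) (R : Fin n → CGame) (j : Fin n) :
    R j ∈ (mk L R).rightOptions := ⟨j, rfl⟩

/-- The game with the given lists of Left and Right options. -/
def ofLists (l r : List CGame) : CGame := mk (fun i : Fin l.length => l.get i) fun j => r.get j

theorem mem_leftOptions_ofLists {l r : List CGame} {x : CGame} :
    x ∈ (ofLists l r).leftOptions ↔ x ∈ l := by
  simp [ofLists, leftOptions, List.mem_iff_get]

theorem mem_rightOptions_ofLists {l r : List CGame} {x : CGame} :
    x ∈ (ofLists l r).rightOptions ↔ x ∈ r := by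
  simp [ofLists, rightOptions, List.mem_iff_get]

/-- Indices of the Left options of the games born by day two. -/
def leftIndices (k : ℕ) : List ℕ :=
  -- Among the entries, 4 and 5 are -2 and 2, 7 and 9 are 1/2 and -1/2, 8 and 15 are ↑ and ↓, 12 is
  -- ±1, 17 and 19 are ↓* and ↑*, and 21 is *2.
  [[], [], [0], [0], [], [2], [0], [0], [0], [1], [1], [2], [2], [2], [2], [3], [3], [0], [2],
    [0, 3], [0, 3], [0, 3]].getD k []

/-- Indices of the Right options of the games born by day two. -/
def rightIndices (k : ℕ) : List ℕ :=
  [[], [0], [], [0], [1], [], [1], [2], [3], [0], [1], [0], [1], [2], [3], [0], [1], [0, 3],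
    [0, 3], [0], [1], [0, 3]].getD k []

/-- The games of the enumeration below, with the options truncated at depth `d`. -/
def truncated : ℕ → ℕ → CGame
  | 0, _ => ofLists [] []
  | d + 1, k => ofLists ((leftIndices k).map (truncated d)) ((rightIndices k).map (truncated d))

/-- For `k < 22`, the `k`-th game in an enumeration of the values born by day two. The first one
is `0`, and the values born by day one are the first four, `0`, `-1`, `1`, `*`. -/
def dayTwo (k : ℕ) : CGame := truncated 2 k

/-- The bit `j` of `downMask k` tells whether `dayTwo j ≤ dayTwo k`. -/
def downMask (k : ℕ) : ℕ :=
  [99859, 18, 3901407, 132698, 16, 4194303, 1104, 3901403, 3376979, 1554, 1040, 4169306, 1119312,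
    4194267, 3659603, 99858, 66576, 132690, 3642962, 3901018, 1115216, 3376722].getD k 0

/-- The bit `j` of `upMask k` tells whether `dayTwo k ≤ dayTwo j`. -/
def upMask (k : ℕ) : ℕ :=
  [24997, 3074991, 36, 534700, 4194303, 32, 4094444, 8356, 24996, 3074989, 4194285, 10272, 292896,
    8224, 24608, 2943397, 4061605, 3041708, 288800, 534692, 3963300, 2910628].getD k 0

theorem leftIndices_lt {k l : ℕ} (hk : k < 22) (hl : l ∈ leftIndices k) : l < k ∧ l < 4 := by
  have : ∀ k < 22, ∀ l ∈ leftIndices k, l < k ∧ l < 4 := by decide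
  exact this k hk l hl

theorem rightIndices_lt {k l : ℕ} (hk : k < 22) (hl : l ∈ rightIndices k) : l < k ∧ l < 4 := by
  have : ∀ k < 22, ∀ l ∈ rightIndices k, l < k ∧ l < 4 := by decide
  exact this k hk l hl

/-- The first four games have no option other than `0`, so truncation at depth one loses nothing.
Thus the options of each `dayTwo k` again belong to the enumeration. -/
theorem truncated_one {l : ℕ} (hl : l < 4) : truncated 1 l = dayTwo l := by
  interval_cases l <;> rfl

theorem mem_leftOptions_dayTwo {k : ℕ} (hk : k < 22) {x : CGame} :
    x ∈ (dayTwo k).leftOptions ↔ ∃ l ∈ leftIndices k, x = dayTwo l := by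
  rw [dayTwo, truncated, mem_leftOptions_ofLists, List.mem_map]
  exact exists_congr fun l => and_congr_right fun hl => by
    rw [truncated_one (leftIndices_lt hk hl).2, eq_comm]

theorem mem_rightOptions_dayTwo {k : ℕ} (hk : k < 22) {x : CGame} :
    x ∈ (dayTwo k).rightOptions ↔ ∃ l ∈ rightIndices k, x = dayTwo l := by
  rw [dayTwo, truncated, mem_rightOptions_ofLists, List.mem_map]
  exact exists_congr fun l => and_congr_right fun hl => by
    rw [truncated_one (rightIndices_lt hk hl).2, eq_comm]

theorem birthday_truncated (d k : ℕ) : (truncated d k).birthday ≤ d := by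
  induction d generalizing k with
  | zero => exact le_of_eq (by simp [truncated, ofLists, birthday])
  | succ d ih =>
    rw [truncated]
    refine birthday_le_of_options ?_ ?_
    · simpa [mem_leftOptions_ofLists] using fun l _ => Nat.lt_succ_of_le (ih l)
    · simpa [mem_rightOptions_ofLists] using fun l _ => Nat.lt_succ_of_le (ih l)

theorem testBit_downMask {i k : ℕ} (hi : i < 22) (hk : k < 22) :
    (downMask i).testBit k = true ↔ dayTwo k ≤ dayTwo i := by
  -- The kernel checks that the table satisfies the recursion defining `≤`. Options have smaller
  -- indices, so by induction on `i + k` it is the order.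
  have table : ∀ i < 22, ∀ k < 22, (downMask i).testBit k =
      ((leftIndices k).all (fun l => !(downMask l).testBit i) &&
        (rightIndices i).all fun r => !(downMask k).testBit r) := by decide +kernel
  induction h : i + k using Nat.strong_induction_on generalizing i k with
  | _ n ih =>
    rw [table i hi k hk, le_iff]
    simp only [mem_leftOptions_dayTwo hk, mem_rightOptions_dayTwo hi, Bool.and_eq_true,
      List.all_eq_true, Bool.not_eq_true', ← Bool.not_eq_true]
    refine and_congr ⟨?_, ?_⟩ ⟨?_, ?_⟩
    · rintro H _ ⟨l, hl, rfl⟩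
      have := leftIndices_lt hk hl
      exact fun hle => H l hl ((ih (l + i) (by omega) (by omega) hi rfl).2 hle)
    · intro H l hl
      have := leftIndices_lt hk hl
      exact fun hb => H _ ⟨l, hl, rfl⟩
        ((ih (l + i) (by omega) (by omega) hi rfl).1 hb)
    · rintro H _ ⟨l, hl, rfl⟩
      have := rightIndices_lt hi hl
      exact fun hle => H l hl ((ih (k + l) (by omega) hk (by omega) rfl).2 hle)
    · intro H l hl
      have := rightIndices_lt hi hl
      exact fun hb => H _ ⟨l, hl, rfl⟩ ((ih (k + l) (by omega) hk (by omega) rfl).1 hb)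

theorem testBit_upMask {i k : ℕ} (hi : i < 22) (hk : k < 22) :
    (upMask i).testBit k = true ↔ dayTwo i ≤ dayTwo k := by
  have table : ∀ i < 22, ∀ k < 22, (upMask i).testBit k = (downMask k).testBit i := by
    decide +kernel
  rw [table i hi k hk, testBit_downMask hk hi]

/-! ### Profiles: comparisons with the day-two games as bits. -/

/-- Apply `f` to the value of `n`, so that the kernel evaluates `n` only once. -/
def force {α : Type} (n : ℕ) (f : ℕ → α) : α := Nat.rec (f 0) (fun m _ => f (Nat.succ m)) n

theorem force_eq {α : Type} (n : ℕ) (f : ℕ → α) : force n f = f n := by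
  cases n <;> rfl

/-- `Nat.testBit`, in a form that is fast to evaluate in the kernel. -/
def bit (m n : ℕ) : Bool := Nat.beq (Nat.land (Nat.shiftRight m n) 1) 1

theorem bit_eq (m n : ℕ) : bit m n = m.testBit n := by
  have h : bit m n = Nat.beq ((m >>> n) &&& 1) 1 := rfl
  rw [h, Nat.testBit_eq_decide_div_mod_eq, Nat.and_one_is_mod, Nat.shiftRight_eq_div_pow,
    Bool.eq_iff_iff, Nat.beq_eq, decide_eq_true_iff]

/-- A *profile* of a game: the bits `k` and `22 + k` tell whether the game is `≤ dayTwo k` and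
`≥ dayTwo k`, respectively. -/
def IsProfile (X : CGame) (P : ℕ) : Prop :=
  ∀ k < 22, (P.testBit k = true ↔ X ≤ dayTwo k) ∧ (P.testBit (22 + k) = true ↔ dayTwo k ≤ X)

/-- The bits `k` and `22 + k` tell whether some Left option is `≥ dayTwo k` and some Right option
is `≤ dayTwo k`, respectively. -/
def IsOptionMask (X : CGame) (W : ℕ) : Prop :=
  ∀ k < 22, (W.testBit k = true ↔ ∃ x ∈ X.leftOptions, dayTwo k ≤ x) ∧
    (W.testBit (22 + k) = true ↔ ∃ y ∈ X.rightOptions, y ≤ dayTwo k)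

/-- The bounds that are excluded by the comparison of the game with profile `P` with `0`. -/
def blockedByZero (P : ℕ) : ℕ :=
  -- If `X ≤ 0`, then `X` is not above a game with Left option `0`; the first constant has the bits
  -- `22 + k` for these. If `0 ≤ X`, then `X` is not below a game with Right option `0`; the second
  -- constant has the bits `k` for these. The constants of `blockedByDayOne` arise likewise from
  -- `-1`, `1` and `*`.
  Nat.lor (cond (bit P 0) 15944847982592 0) (cond (bit P 22) 3049994 0)

/-- The bounds that are excluded by the comparison of the game with profile `P` with the nonzero
games born by day one. -/
def blockedByDayOne (P : ℕ) : ℕ :=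
  Nat.lor (cond (bit P 1) 6442450944 0) (Nat.lor (cond (bit P 2) 1228494864384 0)
    (Nat.lor (cond (bit P 3) 15805479649280 0) (Nat.lor (cond (bit P 23) 1119312 0)
      (Nat.lor (cond (bit P 24) 8320 0) (cond (bit P 25) 2507008 0)))))

/-- The bitwise complement of a 44-bit number. -/
def compl44 (P : ℕ) : ℕ := Nat.xor P 17592186044415

/-- The profile of a game with option mask `W`. -/
def profile (W : ℕ) : ℕ :=
  -- Two rounds suffice: comparisons with `0` are read off `W`, those with the other day-one games
  -- depend on these only, and all others depend only on comparisons with day-one games.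
  force W fun W => force (Nat.lor W (blockedByZero (compl44 W))) fun V =>
    compl44 (Nat.lor V (blockedByDayOne (compl44 V)))

theorem testBit_compl44 (P : ℕ) {k : ℕ} (hk : k < 44) :
    (compl44 P).testBit k = !P.testBit k := by
  have h : compl44 P = P ^^^ (2 ^ 44 - 1) := rfl
  rw [h, Nat.testBit_xor, Nat.testBit_two_pow_sub_one]
  simp [hk]

theorem testBit_lor (a b k : ℕ) : (Nat.lor a b).testBit k = (a.testBit k || b.testBit k) :=
  Nat.testBit_or a b k

theorem testBit_cond (b : Bool) (c k : ℕ) :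
    (cond b c 0).testBit k = (c.testBit k && b) := by
  cases b <;> simp

theorem testBit_blockedByZero (W : ℕ) {k : ℕ} (hk : k < 22) :
    (blockedByZero (compl44 W)).testBit k = (decide (0 ∈ rightIndices k) && !W.testBit 22) ∧
    (blockedByZero (compl44 W)).testBit (22 + k) =
      (decide (0 ∈ leftIndices k) && !W.testBit 0) := by
  have h : ∀ k < 22, Nat.testBit 15944847982592 k = false ∧
      Nat.testBit 3049994 k = decide (0 ∈ rightIndices k) ∧
      Nat.testBit 15944847982592 (22 + k) = decide (0 ∈ leftIndices k) ∧
      Nat.testBit 3049994 (22 + k) = false := by decide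
  obtain ⟨h1, h2, h3, h4⟩ := h k hk
  have c0 := testBit_compl44 W (k := 0) (by decide)
  have c22 := testBit_compl44 W (k := 22) (by decide)
  constructor <;>
  simp only [blockedByZero, bit_eq, testBit_lor, testBit_cond, h1, h2, h3, h4, c0, c22,
    Bool.false_and, Bool.false_or, Bool.or_false]

theorem testBit_blockedByDayOne (V : ℕ) {k : ℕ} (hk : k < 22) :
    (blockedByDayOne (compl44 V)).testBit k = ((decide (1 ∈ rightIndices k) && !V.testBit 23) ||
      ((decide (2 ∈ rightIndices k) && !V.testBit 24) ||
        (decide (3 ∈ rightIndices k) && !V.testBit 25))) ∧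
    (blockedByDayOne (compl44 V)).testBit (22 + k) =
      ((decide (1 ∈ leftIndices k) && !V.testBit 1) ||
      ((decide (2 ∈ leftIndices k) && !V.testBit 2) ||
        (decide (3 ∈ leftIndices k) && !V.testBit 3))) := by
  have h : ∀ k < 22, (Nat.testBit 6442450944 k = false ∧ Nat.testBit 1228494864384 k = false ∧
      Nat.testBit 15805479649280 k = false) ∧
      (Nat.testBit 1119312 k = decide (1 ∈ rightIndices k) ∧
        Nat.testBit 8320 k = decide (2 ∈ rightIndices k) ∧
        Nat.testBit 2507008 k = decide (3 ∈ rightIndices k)) := by decide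
  have h' : ∀ k < 22, (Nat.testBit 6442450944 (22 + k) = decide (1 ∈ leftIndices k) ∧
      Nat.testBit 1228494864384 (22 + k) = decide (2 ∈ leftIndices k) ∧
      Nat.testBit 15805479649280 (22 + k) = decide (3 ∈ leftIndices k)) ∧
      (Nat.testBit 1119312 (22 + k) = false ∧ Nat.testBit 8320 (22 + k) = false ∧
        Nat.testBit 2507008 (22 + k) = false) := by decide
  obtain ⟨⟨h1, h2, h3⟩, h4, h5, h6⟩ := h k hk
  obtain ⟨⟨h7, h8, h9⟩, h10, h11, h12⟩ := h' k hk
  have c1 := testBit_compl44 V (k := 1) (by decide)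
  have c2 := testBit_compl44 V (k := 2) (by decide)
  have c3 := testBit_compl44 V (k := 3) (by decide)
  have c23 := testBit_compl44 V (k := 23) (by decide)
  have c24 := testBit_compl44 V (k := 24) (by decide)
  have c25 := testBit_compl44 V (k := 25) (by decide)
  constructor <;>
  simp only [blockedByDayOne, bit_eq, testBit_lor, testBit_cond, h1, h2, h3, h4, h5, h6, h7, h8,
    h9, h10, h11, h12, c1, c2, c3, c23, c24, c25, Bool.false_and, Bool.false_or, Bool.or_false]

/-- This is the recursion of `≤` in bits: `X ≤ dayTwo k` fails exactly if a Left option of `X` is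
above `dayTwo k` or a Right option of `dayTwo k` is below `X`, and dually. -/
theorem testBit_profile (W : ℕ) {k : ℕ} (hk : k < 22) :
    (profile W).testBit k = (!W.testBit k &&
      (rightIndices k).all fun r => !(profile W).testBit (22 + r)) ∧
    (profile W).testBit (22 + k) = (!W.testBit (22 + k) &&
      (leftIndices k).all fun l => !(profile W).testBit l) := by
  set V := Nat.lor W (blockedByZero (compl44 W)) with hV
  have hP : ∀ j < 44, (profile W).testBit j =
      !(V.testBit j || (blockedByDayOne (compl44 V)).testBit j) := by
    intro j hj
    rw [profile, force_eq, force_eq, testBit_compl44 _ hj, testBit_lor]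
  have hmem : ∀ j < 4, (1 ∉ rightIndices j ∧ 2 ∉ rightIndices j ∧ 3 ∉ rightIndices j) ∧
      (1 ∉ leftIndices j ∧ 2 ∉ leftIndices j ∧ 3 ∉ leftIndices j) := by decide
  -- The second round does not affect the bits of the first four games, whose only possible option
  -- is `0`.
  have hsmall : ∀ j < 4, (profile W).testBit j = (!V.testBit j) ∧
      (profile W).testBit (22 + j) = !V.testBit (22 + j) := by
    intro j hj
    obtain ⟨⟨h1, h2, h3⟩, h4, h5, h6⟩ := hmem j hj
    have := testBit_blockedByDayOne V (k := j) (by omega)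
    rw [hP j (by omega), hP (22 + j) (by omega), this.1, this.2]
    simp [h1, h2, h3, h4, h5, h6]
  have hV0 : V.testBit 0 = W.testBit 0 ∧ V.testBit 22 = W.testBit 22 := by
    have := testBit_blockedByZero W (k := 0) (by omega)
    rw [hV, testBit_lor, testBit_lor, this.1, show (22 : ℕ) = 22 + 0 from rfl, this.2]
    simp [leftIndices, rightIndices]
  have s0 := hsmall 0 (by omega)
  have s1 := hsmall 1 (by omega)
  have s2 := hsmall 2 (by omega)
  have s3 := hsmall 3 (by omega)
  have hR : (rightIndices k).all (fun r => !(profile W).testBit (22 + r)) =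
      !((decide (0 ∈ rightIndices k) && !W.testBit 22) ||
        ((decide (1 ∈ rightIndices k) && !V.testBit 23) ||
        ((decide (2 ∈ rightIndices k) && !V.testBit 24) ||
        (decide (3 ∈ rightIndices k) && !V.testBit 25)))) := by
    have hall : ∀ k < 22, rightIndices k = [0, 1, 2, 3].filter (· ∈ rightIndices k) := by decide
    rw [hall k hk, List.all_filter]
    simp [s0, s1, s2, s3, hV0]
  have hL : (leftIndices k).all (fun l => !(profile W).testBit l) =
      !((decide (0 ∈ leftIndices k) && !W.testBit 0) ||
        ((decide (1 ∈ leftIndices k) && !V.testBit 1) ||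
        ((decide (2 ∈ leftIndices k) && !V.testBit 2) ||
        (decide (3 ∈ leftIndices k) && !V.testBit 3)))) := by
    have hall : ∀ k < 22, leftIndices k = [0, 1, 2, 3].filter (· ∈ leftIndices k) := by decide
    rw [hall k hk, List.all_filter]
    simp [s0, s1, s2, s3, hV0]
  have hZ := testBit_blockedByZero W hk
  have hD := testBit_blockedByDayOne V hk
  have taut : ∀ a b c : Bool, (!((a || b) || c)) = (!a && !(b || c)) := by decide
  constructor
  · rw [hP k (by omega), hR, hD.1, ← taut, ← hZ.1, hV, testBit_lor]
  · rw [hP (22 + k) (by omega), hL, hD.2, ← taut, ← hZ.2, hV, testBit_lor]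

theorem IsOptionMask.isProfile {X : CGame} {W : ℕ} (h : IsOptionMask X W) :
    IsProfile X (profile W) := by
  intro k hk
  induction k using Nat.strong_induction_on with
  | _ k ih =>
    obtain ⟨h1, h2⟩ := testBit_profile W hk
    rw [h1, h2, le_iff, le_iff]
    simp only [mem_leftOptions_dayTwo hk, mem_rightOptions_dayTwo hk, Bool.and_eq_true,
      List.all_eq_true, Bool.not_eq_true', ← Bool.not_eq_true, (h k hk).1, (h k hk).2, not_exists,
      not_and, forall_exists_index, and_imp]
    refine ⟨and_congr_right fun _ => ?_, and_comm.trans (and_congr_left fun _ => ?_)⟩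
    · constructor
      · rintro H _ r hr rfl
        have := rightIndices_lt hk hr
        exact fun hle => H r hr ((ih r this.1 (by omega)).2.2 hle)
      · intro H r hr hb
        have := rightIndices_lt hk hr
        exact H _ r hr rfl ((ih r this.1 (by omega)).2.1 hb)
    · constructor
      · rintro H _ r hr rfl
        have := leftIndices_lt hk hr
        exact fun hle => H r hr ((ih r this.1 (by omega)).1.2 hle)
      · intro H r hr hb
        have := leftIndices_lt hk hr
        exact H _ r hr rfl ((ih r this.1 (by omega)).1.1 hb)

/-- Every option of `X` is equal to one of the first `n` games born by day two. -/
def HasOptionsIn (n : ℕ) (X : CGame) : Prop :=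
  (∀ x ∈ X.leftOptions, ∃ k < n, x ≤ dayTwo k ∧ dayTwo k ≤ x) ∧
    ∀ x ∈ X.rightOptions, ∃ k < n, x ≤ dayTwo k ∧ dayTwo k ≤ x

/-- A Left option `x ≥ Y` of `X` would be equal to some `dayTwo k`; the common profile then turns `Y
≤ dayTwo k` into `X ≤ dayTwo k`, so `X ≤ x`, which never holds. Right options of `Y` are treated
dually. By symmetry, equal profiles give equal games. -/
theorem le_of_isProfile {X Y : CGame} {P : ℕ} (hX : HasOptionsIn 22 X) (hY : HasOptionsIn 22 Y)
    (hPX : IsProfile X P) (hPY : IsProfile Y P) : X ≤ Y := by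
  refine le_iff.2 ⟨fun x hx hle => ?_, fun y hy hle => ?_⟩
  · obtain ⟨k, hk, h1, h2⟩ := hX.1 x hx
    exact not_le_of_mem_left hx (((hPX k hk).1.1 ((hPY k hk).1.2 (hle.trans h1))).trans h2)
  · obtain ⟨k, hk, h1, h2⟩ := hY.2 y hy
    exact not_le_of_mem_right hy
      (h1.trans ((hPY k hk).2.1 ((hPX k hk).2.2 (h2.trans hle))))

/-! ### Possible option masks, and completeness of the day-two list. -/

/-- `l` contains `0` and is closed under joining with the masks `f k` with `k < n`. -/
def ClosedUnder (n : ℕ) (f : ℕ → ℕ) (l : List ℕ) : Prop :=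
  0 ∈ l ∧ (∀ m ∈ l, m < 2 ^ 22) ∧ ∀ m ∈ l, ∀ k < n, m ||| f k ∈ l

instance (n : ℕ) (f : ℕ → ℕ) (l : List ℕ) : Decidable (ClosedUnder n f l) := by
  unfold ClosedUnder
  infer_instance

theorem ClosedUnder.foldr_mem {n : ℕ} {f : ℕ → ℕ} {l : List ℕ} (h : ClosedUnder n f l)
    {s : List ℕ} (hs : ∀ k ∈ s, k < n) : s.foldr (fun k m => m ||| f k) 0 ∈ l := by
  induction s with
  | nil => exact h.1
  | cons k s ih =>
    exact h.2.2 _ (ih fun j hj => hs j (List.mem_cons_of_mem _ hj)) _ (hs k List.mem_cons_self)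

theorem testBit_foldr_or (f : ℕ → ℕ) (s : List ℕ) (j : ℕ) :
    (s.foldr (fun k m => m ||| f k) 0).testBit j = true ↔ ∃ k ∈ s, (f k).testBit j = true := by
  induction s with
  | nil => simp
  | cons k s ih => simp [ih, or_comm]

/-- The lower half of the option mask is the union of the down-sets of the Left options, the upper
half the union of the up-sets of the Right options. So only lists closed under these unions have to
be searched, not all sets of options. -/
theorem exists_isOptionMask {n : ℕ} (hn : n ≤ 22) {ld lu : List ℕ}
    (hd : ClosedUnder n downMask ld) (hu : ClosedUnder n upMask lu) {X : CGame}
    (hX : HasOptionsIn n X) : ∃ A ∈ ld, ∃ B ∈ lu, IsOptionMask X (A ||| B <<< 22) := by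
  cases X with
  | mk L R =>
    simp only [HasOptionsIn, leftOptions, rightOptions, Set.forall_mem_range] at hX
    choose f hf hf1 hf2 using hX.1
    choose g hg hg1 hg2 using hX.2
    have hfm : ∀ k ∈ List.ofFn f, k < n := by simpa [List.mem_ofFn] using hf
    have hgm : ∀ k ∈ List.ofFn g, k < n := by simpa [List.mem_ofFn] using hg
    refine ⟨_, hd.foldr_mem hfm, _, hu.foldr_mem hgm, fun k hk => ?_⟩
    have hA := hd.2.1 _ (hd.foldr_mem hfm)
    constructor
    · rw [Nat.testBit_or, Nat.testBit_shiftLeft, Bool.or_eq_true, testBit_foldr_or]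
      simp only [List.mem_ofFn', leftOptions, Set.mem_range,
        exists_exists_eq_and, show ¬ k ≥ 22 by omega, decide_false, Bool.false_and,
        Bool.false_eq_true, or_false]
      refine exists_congr fun i => ?_
      rw [testBit_downMask (by have := hf i; omega) hk]
      exact ⟨fun h => h.trans (hf2 i), fun h => h.trans (hf1 i)⟩
    · rw [Nat.testBit_or, Nat.testBit_shiftLeft, Bool.or_eq_true,
        Nat.testBit_lt_two_pow (hA.trans_le (Nat.pow_le_pow_right two_pos (by omega))),
        Nat.add_sub_cancel_left, Bool.and_eq_true, testBit_foldr_or]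
      simp only [List.mem_ofFn', rightOptions, Set.mem_range,
        exists_exists_eq_and, Bool.false_eq_true, false_or, ge_iff_le, Nat.le_add_right,
        decide_true, true_and]
      refine exists_congr fun i => ?_
      rw [testBit_upMask (by have := hg i; omega) hk]
      exact ⟨fun h => (hg1 i).trans h, fun h => (hg2 i).trans h⟩

/-- A profile with both bits `k` and `22 + k` set belongs to a game equal to `dayTwo k`. This
reduces the classification of each day to a finite check. -/
theorem exists_eq_dayTwo_of_closed {n m : ℕ} (hn : n ≤ 22) (hm : m ≤ 22) {ld lu : List ℕ}
    (hd : ClosedUnder n downMask ld) (hu : ClosedUnder n upMask lu)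
    (h : ∀ A ∈ ld, ∀ B ∈ lu, ∃ k < m, (profile (A ||| B <<< 22)).testBit k = true ∧
      (profile (A ||| B <<< 22)).testBit (22 + k) = true) {X : CGame} (hX : HasOptionsIn n X) :
    ∃ k < m, X ≤ dayTwo k ∧ dayTwo k ≤ X := by
  obtain ⟨A, hA, B, hB, hW⟩ := exists_isOptionMask hn hd hu hX
  obtain ⟨k, hk, h1, h2⟩ := h A hA B hB
  have := hW.isProfile k (by omega)
  exact ⟨k, hk, this.1.1 h1, this.2.1 h2⟩

theorem exists_eq_of_birthday_le_zero {X : CGame} (hX : X.birthday ≤ 0) :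
    ∃ k < 1, X ≤ dayTwo k ∧ dayTwo k ≤ X := by
  refine exists_eq_dayTwo_of_closed (n := 0) (ld := [0]) (lu := [0]) (by omega) (by omega)
    (by decide +kernel) (by decide +kernel) (by decide +kernel) ⟨fun x hx => ?_, fun x hx => ?_⟩
  · have := birthday_lt_of_mem_left hx
    omega
  · have := birthday_lt_of_mem_right hx
    omega

theorem exists_eq_of_birthday_le_one {X : CGame} (hX : X.birthday ≤ 1) :
    ∃ k < 4, X ≤ dayTwo k ∧ dayTwo k ≤ X := by
  refine exists_eq_dayTwo_of_closed (n := 1) (ld := [0, 99859]) (lu := [0, 24997]) (by omega)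
    (by omega) (by decide +kernel) (by decide +kernel) (by decide +kernel)
    ⟨fun x hx => exists_eq_of_birthday_le_zero ?_, fun x hx => exists_eq_of_birthday_le_zero ?_⟩
  · have := birthday_lt_of_mem_left hx
    omega
  · have := birthday_lt_of_mem_right hx
    omega

/-- Every game born by day two is equal to a game of the enumeration. -/
theorem exists_eq_of_birthday_le_two {X : CGame} (hX : X.birthday ≤ 2) :
    ∃ k < 22, X ≤ dayTwo k ∧ dayTwo k ≤ X := by
  refine exists_eq_dayTwo_of_closed (n := 4) (ld := [0, 18, 99859, 132698, 231003, 3901407])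
    (lu := [0, 36, 24997, 534700, 551341, 3074991]) (by omega)
    (by omega) (by decide +kernel) (by decide +kernel) (by decide +kernel)
    ⟨fun x hx => exists_eq_of_birthday_le_one ?_, fun x hx => exists_eq_of_birthday_le_one ?_⟩
  · have := birthday_lt_of_mem_left hx
    omega
  · have := birthday_lt_of_mem_right hx
    omega

theorem hasOptionsIn_of_birthday_le_three {X : CGame} (hX : X.birthday ≤ 3) :
    HasOptionsIn 22 X := by
  refine ⟨fun x hx => exists_eq_of_birthday_le_two ?_, fun x hx => exists_eq_of_birthday_le_two ?_⟩
  · have := birthday_lt_of_mem_left hx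
    omega
  · have := birthday_lt_of_mem_right hx
    omega

/-- A game whose options are equal to games born by day two is equal to a game born by day
three. -/
theorem HasOptionsIn.exists_birthday_le_three {X : CGame} (hX : HasOptionsIn 22 X) :
    ∃ Y : CGame, Y.birthday ≤ 3 ∧ Y ≤ X ∧ X ≤ Y := by
  cases X with
  | mk L R =>
    simp only [HasOptionsIn, leftOptions, rightOptions, Set.forall_mem_range] at hX
    choose f hf hf1 hf2 using hX.1
    choose g hg hg1 hg2 using hX.2
    refine ⟨mk (fun i => dayTwo (f i)) fun j => dayTwo (g j), birthday_le_of_options ?_ ?_,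
      le_iff.2 ⟨?_, ?_⟩, le_iff.2 ⟨?_, ?_⟩⟩
    · rintro _ ⟨i, rfl⟩
      exact Nat.lt_succ_of_le (birthday_truncated 2 _)
    · rintro _ ⟨i, rfl⟩
      exact Nat.lt_succ_of_le (birthday_truncated 2 _)
    · rintro _ ⟨i, rfl⟩ h
      exact not_le_of_mem_left (mem_leftOptions_mk _ _ i) (h.trans (hf2 i))
    · rintro _ ⟨i, rfl⟩ h
      exact not_le_of_mem_right (mem_rightOptions_mk _ (fun j => dayTwo (g j)) i)
        ((hg2 i).trans h)
    · rintro _ ⟨i, rfl⟩ h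
      exact not_le_of_mem_left (mem_leftOptions_mk _ _ i) (h.trans (hf1 i))
    · rintro _ ⟨i, rfl⟩ h
      exact not_le_of_mem_right (mem_rightOptions_mk L R i) ((hg1 i).trans h)

end CGame

/-! ### Digraphs on eight vertices as numbers, and evaluation of their profiles. -/

namespace ColouredDigraph

open CGame

/-- The digraph on eight vertices encoded by a number: bit `9 * u + v` is unset if `v` is deleted
when `u` is chosen, and bit `9 * v + 8` is set if `v` is blue. -/
def ofCode (code : ℕ) : ColouredDigraph (Fin 8) where
  Adj u v := u ≠ v ∧ code.testBit (9 * u + v) = false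
  loopless _ h := h.1 rfl
  colour v := if code.testBit (9 * v + 8) then .left else .right

/-- The option mask of a position with remaining vertices `s`, given the profiles `p v` of the
options, for the vertices of the list `l`. -/
def optionFold (s code : ℕ) (p : ℕ → ℕ) (l : List ℕ) : ℕ :=
  List.rec 0 (fun v _ w => cond (bit s v)
    (Nat.lor w (cond (bit code (Nat.add (Nat.mul 9 v) 8))
      (Nat.mod (Nat.shiftRight (p v) 22) 4194304) (Nat.shiftLeft (Nat.mod (p v) 4194304) 22))) w) l

/-- The profile of the position of the digraph game with the given code in which the vertices
given by the mask `s` remain; `n` bounds their number. A chosen vertex has its own bit unset in its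
mask. -/
def evalMask (code n : ℕ) : ℕ → ℕ :=
  Nat.rec (fun _ => profile 0) (fun _ ih s => force s fun s => profile (optionFold s code
    (fun v => ih (Nat.land s (Nat.shiftRight code (Nat.mul 9 v)))) [0, 1, 2, 3, 4, 5, 6, 7])) n

/-- An option mask records what lies below Left options and above Right options. So a blue vertex
contributes the upper half of its option's profile, moved down, and a red vertex the lower half,
moved up. -/
theorem testBit_optionFold (s code : ℕ) (p : ℕ → ℕ) (l : List ℕ) {k : ℕ} (hk : k < 22) :
    ((optionFold s code p l).testBit k = true ↔ ∃ v ∈ l, s.testBit v = true ∧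
      code.testBit (9 * v + 8) = true ∧ (p v).testBit (22 + k) = true) ∧
    ((optionFold s code p l).testBit (22 + k) = true ↔ ∃ v ∈ l, s.testBit v = true ∧
      code.testBit (9 * v + 8) = false ∧ (p v).testBit k = true) := by
  have hlow : ∀ q : ℕ, (Nat.mod (Nat.shiftRight q 22) 4194304).testBit k = q.testBit (22 + k) ∧
      (Nat.mod (Nat.shiftRight q 22) 4194304).testBit (22 + k) = false ∧
      (Nat.shiftLeft (Nat.mod q 4194304) 22).testBit k = false ∧
      (Nat.shiftLeft (Nat.mod q 4194304) 22).testBit (22 + k) = q.testBit k := by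
    intro q
    have h1 : Nat.shiftLeft (Nat.mod q 4194304) 22 = (q % 2 ^ 22) <<< 22 := rfl
    have h2 : Nat.mod (Nat.shiftRight q 22) 4194304 = (q >>> 22) % 2 ^ 22 := rfl
    refine ⟨?_, ?_, ?_, ?_⟩
    · rw [h2, Nat.testBit_mod_two_pow, Nat.testBit_shiftRight]
      simp [hk]
    · rw [h2, Nat.testBit_mod_two_pow]
      simp
    · rw [h1, Nat.testBit_shiftLeft]
      simp [hk]
    · rw [h1, Nat.testBit_shiftLeft, Nat.add_sub_cancel_left, Nat.testBit_mod_two_pow]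
      simp [hk]
  induction l with
  | nil => simp [optionFold]
  | cons v l ih =>
    have hstep : optionFold s code p (v :: l) = cond (s.testBit v)
        (Nat.lor (optionFold s code p l) (cond (code.testBit (9 * v + 8))
          (Nat.mod (Nat.shiftRight (p v) 22) 4194304) (Nat.shiftLeft (Nat.mod (p v) 4194304) 22)))
        (optionFold s code p l) := by
      rw [← bit_eq, ← bit_eq]
      rfl
    rw [hstep]
    simp only [List.exists_mem_cons_iff, ← ih.1, ← ih.2]
    obtain ⟨l1, l2, l3, l4⟩ := hlow (p v)
    cases s.testBit v <;> cases code.testBit (9 * v + 8) <;>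
    · simp only [cond_true, cond_false, testBit_lor, l1, l2, l3, l4]
      simp [or_comm]

/-- The bits from `9 * v` to `9 * v + 7` form the mask of the vertices that survive `v`, so a move
is a bitwise conjunction. Adjacency excludes loops, hence `v` itself is removed only because its own
bit is required to be unset. -/
theorem mem_delete_ofCode {code s : ℕ} {S : Finset (Fin 8)}
    (hself : ∀ v < 8, code.testBit (9 * v + v) = false)
    (hS : ∀ v : Fin 8, v ∈ S ↔ s.testBit v = true) (v u : Fin 8) :
    u ∈ (ofCode code).delete S v ↔ (s &&& (code >>> (9 * (v : ℕ)))).testBit u = true := by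
  rw [mem_delete, hS, Nat.testBit_and, Nat.testBit_shiftRight, Bool.and_eq_true]
  refine and_congr_right fun _ => ?_
  simp only [ofCode]
  by_cases huv : u = v
  · subst huv
    simp [hself u u.2]
  · simp [huv, Ne.symm huv]

theorem exists_mem_vertexList {q : ℕ → Prop} :
    (∃ v ∈ [0, 1, 2, 3, 4, 5, 6, 7], q v) ↔ ∃ v : Fin 8, q v := by
  rw [show [0, 1, 2, 3, 4, 5, 6, 7] = List.range 8 from rfl]
  simp only [List.mem_range, Fin.exists_iff, exists_prop]

/-- Every move removes a vertex, so recursion depth `n` is enough; at depth `0` the position is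
empty and its option mask is `0`. -/
theorem isProfile_evalMask {code : ℕ} (hself : ∀ v < 8, code.testBit (9 * v + v) = false) (n : ℕ) :
    ∀ (s : ℕ) (S : Finset (Fin 8)), (∀ v : Fin 8, v ∈ S ↔ s.testBit v = true) → S.card ≤ n →
      IsProfile ((ofCode code).gameOn S) (evalMask code n s) := by
  induction n with
  | zero =>
    intro s S hS hn
    obtain rfl : S = ∅ := by simpa using hn
    refine IsOptionMask.isProfile fun k _ => ?_
    simp [mem_leftOptions_gameOn, mem_rightOptions_gameOn]
  | succ n ih =>
    intro s S hS hn
    change IsProfile _ (force s fun s => profile (optionFold s code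
      (fun v => evalMask code n (s &&& (code >>> (9 * v)))) [0, 1, 2, 3, 4, 5, 6, 7]))
    rw [force_eq]
    refine IsOptionMask.isProfile fun k hk => ?_
    have hopt : ∀ v : Fin 8, v ∈ S → IsProfile ((ofCode code).gameOn ((ofCode code).delete S v))
        (evalMask code n (s &&& (code >>> (9 * (v : ℕ))))) := by
      intro v hv
      refine ih _ _ (mem_delete_ofCode hself hS v) ?_
      have := (ofCode code).card_delete_lt
        (⟨v, (mem_moves _).2 ⟨hv, rfl⟩⟩ : (ofCode code).moves S ((ofCode code).colour v))
      dsimp only at this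
      omega
    obtain ⟨h1, h2⟩ := testBit_optionFold s code
      (fun v => evalMask code n (s &&& (code >>> (9 * v)))) [0, 1, 2, 3, 4, 5, 6, 7] hk
    constructor
    · refine h1.trans ?_
      simp only [exists_mem_vertexList, mem_leftOptions_gameOn]
      constructor
      · rintro ⟨v, hv, hc, hb⟩
        exact ⟨_, ⟨v, (hS v).2 hv, by simp [ofCode, hc], rfl⟩,
          (hopt v ((hS v).2 hv) k hk).2.1 hb⟩
      · rintro ⟨_, ⟨v, hv, hc, rfl⟩, hle⟩
        refine ⟨v, (hS v).1 hv, ?_, (hopt v hv k hk).2.2 hle⟩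
        by_contra hb
        simp [ofCode, hb] at hc
    · refine h2.trans ?_
      simp only [exists_mem_vertexList, mem_rightOptions_gameOn]
      constructor
      · rintro ⟨v, hv, hc, hb⟩
        exact ⟨_, ⟨v, (hS v).2 hv, by simp [ofCode, hc], rfl⟩,
          (hopt v ((hS v).2 hv) k hk).1.1 hb⟩
      · rintro ⟨_, ⟨v, hv, hc, rfl⟩, hle⟩
        refine ⟨v, (hS v).1 hv, ?_, (hopt v hv k hk).1.2 hle⟩
        by_contra hb
        simp [ofCode, hb] at hc

/-- The code is well-formed, and every option of its game is equal to a game born by day two. -/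
def validCode (code : ℕ) : Bool :=
  [0, 1, 2, 3, 4, 5, 6, 7].all fun v => cond (bit code (9 * v + v)) false
    -- Here 255 is the set of all vertices, of which at most seven remain after a move. A common bit
    -- `k < 22` of `p` and `p >>> 22` says that the option is equal to `dayTwo k`.
    (force (evalMask code 7 (Nat.land 255 (Nat.shiftRight code (9 * v)))) fun p =>
      Nat.blt 0 (Nat.land (Nat.land p (Nat.shiftRight p 22)) 4194303))

theorem testBit_of_validCode {code v : ℕ} (h : validCode code = true) (hv : v < 8) :
    code.testBit (9 * v + v) = false := by
  rw [validCode, List.all_eq_true] at h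
  have := h v (by interval_cases v <;> decide)
  rw [bit_eq] at this
  by_contra hb
  simp [hb] at this

theorem isProfile_game {code : ℕ} (h : validCode code = true) :
    IsProfile (ofCode code).game (evalMask code 8 255) := by
  refine isProfile_evalMask (fun v hv => testBit_of_validCode h hv) 8 _ _ (fun v => ?_) (by simp)
  have : ∀ v : Fin 8, Nat.testBit 255 v = true := by decide
  simp [this v]

theorem hasOptionsIn_game {code : ℕ} (h : validCode code = true) :
    HasOptionsIn 22 (ofCode code).game := by
  have hS : ∀ v : Fin 8, v ∈ (Finset.univ : Finset (Fin 8)) ↔ Nat.testBit 255 v = true := by decide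
  have key : ∀ v : Fin 8, ∃ k < 22,
      (ofCode code).gameOn ((ofCode code).delete Finset.univ v) ≤ dayTwo k ∧
        dayTwo k ≤ (ofCode code).gameOn ((ofCode code).delete Finset.univ v) := by
    intro v
    have hp := isProfile_evalMask (fun v hv => testBit_of_validCode h hv) 7 _ _
      (mem_delete_ofCode (fun v hv => testBit_of_validCode h hv) hS v) (by
        have := (ofCode code).card_delete_lt
          (⟨v, (mem_moves _).2 ⟨Finset.mem_univ v, rfl⟩⟩ :
            (ofCode code).moves Finset.univ ((ofCode code).colour v))
        simp only [Finset.card_univ, Fintype.card_fin] at this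
        omega)
    rw [validCode, List.all_eq_true] at h
    have hv := h v (by fin_cases v <;> decide)
    rw [force_eq] at hv
    have hne : evalMask code 7 (255 &&& (code >>> (9 * (v : ℕ)))) &&&
        (evalMask code 7 (255 &&& (code >>> (9 * (v : ℕ))))) >>> 22 &&& (2 ^ 22 - 1) ≠ 0 := by
      intro h0
      have h0' : Nat.land (Nat.land (evalMask code 7 (Nat.land 255 (Nat.shiftRight code (9 * v))))
        (Nat.shiftRight (evalMask code 7 (Nat.land 255 (Nat.shiftRight code (9 * v)))) 22))
          4194303 = 0 := h0
      rw [h0'] at hv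
      cases hb : bit code (9 * v + v) <;> rw [hb] at hv <;> exact absurd hv (by decide)
    obtain ⟨k, hk⟩ := Nat.exists_testBit_of_ne_zero hne
    rw [Nat.testBit_and, Nat.testBit_and, Nat.testBit_shiftRight, Nat.testBit_two_pow_sub_one,
      Bool.and_eq_true, Bool.and_eq_true, decide_eq_true_iff] at hk
    exact ⟨k, hk.2, (hp k hk.2).1.1 hk.1.1, (hp k hk.2).2.1 hk.1.2⟩
  constructor
  · intro x hx
    obtain ⟨v, -, -, rfl⟩ := (mem_leftOptions_gameOn _).1 hx
    exact key v
  · intro x hx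
    obtain ⟨v, -, -, rfl⟩ := (mem_rightOptions_gameOn _).1 hx
    exact key v

/-! ### The table of profiles with digraphs realizing them. -/

/-- All keys with upper half in `downs` and lower half in `ups`, where the four lowest bits of
both halves are given by `tag`, together with codes of digraph games with these keys as profiles. -/
structure Block where
  tag : ℕ
  ups : List ℕ
  downs : List ℕ
  codes : List ℕ

/-- Membership in a list of numbers, in a form that is fast to evaluate in the kernel. -/
def memNat (x : ℕ) : List ℕ → Bool
  | [] => false
  | y :: l => cond (Nat.beq x y) true (memNat x l)

theorem mem_of_memNat {x : ℕ} {l : List ℕ} (h : memNat x l = true) : x ∈ l := by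
  induction l with
  | nil => exact absurd h (by simp [memNat])
  | cons y l ih =>
    rw [memNat] at h
    cases hb : Nat.beq x y
    · rw [hb] at h
      exact List.mem_cons_of_mem _ (ih h)
    · rw [Nat.eq_of_beq_eq_true hb]
      exact List.mem_cons_self

/-- The four lowest bits of both halves of a key. -/
def keyTag (P : ℕ) : ℕ :=
  Nat.add (Nat.land P 15) (Nat.mul 16 (Nat.land (Nat.shiftRight P 22) 15))

/-- A product form is possible because, once the comparisons with the day-one games (the tag) are
fixed, the lower half of a profile depends only on the Left options and the upper half only on the
Right options. -/
def Block.keys (b : Block) : List ℕ :=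
  b.downs.flatMap fun d => b.ups.map fun u => Nat.lor (Nat.shiftLeft d 22) u

def Block.contains (b : Block) (P : ℕ) : Bool :=
  cond (Nat.beq (keyTag P) b.tag)
    (cond (memNat (Nat.mod P 4194304) b.ups) (memNat (Nat.shiftRight P 22) b.downs) false) false

theorem Block.mem_keys_of_contains {b : Block} {P : ℕ} (h : b.contains P = true) : P ∈ b.keys := by
  rw [contains] at h
  cases h1 : Nat.beq (keyTag P) b.tag <;> rw [h1] at h
  · exact absurd h (by simp)
  cases h2 : memNat (Nat.mod P 4194304) b.ups <;> rw [cond_true, h2] at h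
  · exact absurd h (by simp)
  refine List.mem_flatMap.2 ⟨_, mem_of_memNat h, List.mem_map.2 ⟨_, mem_of_memNat h2, ?_⟩⟩
  change (P >>> 22) <<< 22 ||| P % 2 ^ 22 = P
  refine Nat.eq_of_testBit_eq fun j => ?_
  rw [Nat.testBit_or, Nat.testBit_shiftLeft, Nat.testBit_shiftRight, Nat.testBit_mod_two_pow]
  by_cases hj : 22 ≤ j
  · simp [hj, Nat.add_sub_cancel' hj, Nat.not_lt.2 hj]
  · simp [hj, Nat.not_le.1 hj]

/-- Equality as lists matches codes with keys one by one, so that distinctness of the keys passes to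
the codes. -/
def Block.Valid (b : Block) : Prop :=
  b.codes.map (fun c => evalMask c 8 255) = b.keys ∧ b.codes.all validCode = true

instance (b : Block) : Decidable b.Valid := by
  unfold Block.Valid
  infer_instance

/-- This list and the next contain all candidates for the lower half and for the unshifted upper
half of the option mask of a game born by day three. -/
def downMasks : List ℕ := [
    0, 16, 18, 1040, 1042, 1104, 1106, 1554, 1618, 66576, 66578, 66640, 66642, 67090, 67154,
    99858, 99859, 99922, 99923, 132690, 132698, 198226, 198234, 230994, 230995, 231002, 231003,
    1115216, 1115218, 1115730, 1119312, 1119314, 1119826, 1148498, 1148499, 1152594, 1152595,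
    1246802, 1246810, 1250898, 1250906, 1279570, 1279571, 1279578, 1279579, 1283666, 1283667,
    1283674, 1283675, 3376722, 3376723, 3376730, 3376731, 3376979, 3376987, 3380818, 3380819,
    3380826, 3380827, 3381075, 3381083, 3642962, 3642963, 3642970, 3642971, 3643219, 3643227,
    3659603, 3659611, 3901018, 3901019, 3901275, 3901403, 3901407, 3905114, 3905115, 3905371,
    3905499, 3905503, 4167258, 4167259, 4167515, 4167643, 4167647, 4169306, 4169307, 4169563,
    4169691, 4169695, 4183899, 4184027, 4184031, 4185947, 4186075, 4186079, 4194267, 4194271,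
    4194303]

def upMasks : List ℕ := [
    0, 32, 36, 8224, 8228, 8356, 10272, 10276, 10404, 24608, 24612, 24740, 24996, 24997, 26656,
    26660, 26788, 27044, 27045, 288800, 288804, 288932, 289188, 289189, 292896, 292900, 293028,
    293284, 293285, 534692, 534700, 551076, 551084, 551332, 551333, 551340, 551341, 813220,
    813228, 813476, 813477, 813484, 813485, 817316, 817324, 817572, 817573, 817580, 817581,
    2910628, 2910629, 2910636, 2910637, 2914724, 2914725, 2914732, 2914733, 2943397, 2943405,
    2947493, 2947501, 3041708, 3041709, 3045804, 3045805, 3074477, 3074989, 3074991, 3078573,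
    3079085, 3079087, 3963300, 3963301, 3963308, 3963309, 3996069, 3996077, 4061605, 4061613,
    4094380, 4094381, 4094444, 4094445, 4127149, 4127213, 4127661, 4127663, 4127725, 4127727,
    4192685, 4192749, 4193197, 4193199, 4193261, 4193263, 4194285, 4194287, 4194303]

def block0 : Block where
  tag := 0
  ups := [
    0, 32, 8224, 10272, 24608, 26656, 288800, 292896]
  downs := [
    0, 16, 1040, 1104, 66576, 66640, 1115216, 1119312]
  codes := [
    4648418546110562304, 2361345388753254481928, 2368461059068409385544, 627223264653757251840,
    11547247071227154432, 2956091085876105445448, 46125887232854458368, 2365803935271047331848,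
    2416537072415765823628, 11628311864488632336, 152195543204847026304, 345885619168123158544,
    650887274964080134400, 11265706129768512, 11619304665281859584, 78407758023206502552,
    3099809628965566537792, 2379634668041060876800, 2368105452997139988992,
    2379634668043208360448, 660146676072831850754, 2434811497026290304, 2386748595765348802568,
    3099809664147724034048, 11664341073853547008, 2384242260887585439744, 798461194534178005280,
    2956667251354104992384, 11655333599725093376, 9232434270254268416, 2386552717768793260548,
    2988386068332082989632, 2365830956293508431888, 13844645838057766912, 297823298479672263140,
    345885478430634672144, 2877701102489299058688, 4683745845915601460, 2891536160544581222400,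
    23067437325820625034, 14091381890941106, 11664340661507596304, 297841312877779091940,
    11529242218514744064, 2361214773912183767040, 41505174208796236746, 4683778810192300672,
    2380044316708681941008, 2361214773903593832448, 9232959819632476160, 3062164049075619512366,
    936757749541643878416, 1111427589442216575488, 936757749541643747328, 401216985625283134208,
    2361192248709709185024, 4647714858668785664, 594907514012336099456, 2368116733722199720000,
    2757860613273233261312, 4620710852885188736, 627189597573355113216, 2305860738960982016,
    2365803954444251037952]

def block1 : Block where
  tag := 4
  ups := [
    36, 8228, 8356, 10276, 10404, 24612, 24740, 24996, 26660, 26788, 27044, 288804, 288932,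
    289188, 292900, 293028, 293284, 534692, 551076, 551332, 813220, 813476, 817316, 817572,
    2910628, 2914724, 3963300]
  downs := [
    0, 16, 1040, 1104, 66576, 66640, 1115216]
  codes := [
    159121199660905669120, 154789616452773085316, 152195543067407810692, 2368181835891445305928,
    2368461059068413579848, 11547247071229256208, 2365810890713522765888, 11547247071229256192,
    2368181835874265436744, 59963702931886213280, 2392419138936197376, 2368181835874265436680,
    59963702931886213248, 2368731311916097679360, 2314868032649953282, 309730578423114760208,
    2734729838098926026786, 27679651109833541642, 2674931044514502312640, 2603100511120916672,
    41516958856029177988, 2534878494075748745676, 371817765812285174016, 161418633628874964992,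
    11547247071246033408, 2730118152217870483490, 4612390027991842816, 9232995004002467840,
    2368461058999692005976, 2365921175646161266720, 761549692022609158448, 328177955815555072528,
    2711671677902805139500, 2439597867007826329664, 650891778529347766528,
    2361193216204850997262, 41516958858176661668, 328177955815487963648, 2621314919882033636,
    4623470710791700608, 3127299601621397434592, 23094472220734390608, 346624207307988533264,
    2734729838098926026914, 2368118816351673422344, 2674931044514502312130, 11583275868264997376,
    4623470708644216960, 2477015853159657007360, 2366407469792149869184, 2359904037535416448,
    14408037146099874, 2730118152217870483618, 2361183243640624005888, 2444194480611519582272,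
    2368681913749443412480, 2365799609987926266368, 2969966507198932976128,
    936920580616647868438, 299849669993623111732, 894748185665812332634, 2365885006249227110576,
    200633956074002710784, 41516958858176662196, 500593992626688183040, 200633956070244614400,
    4623470710800089728, 2460519838083086060036, 2370695734692833087488, 420411183602827001878,
    2434820293102535296, 2365799609987926262272, 41516958856029178548, 2365885006249227118768,
    4623470708652606080, 198636838333931323394, 2365799609987926229504, 2434820293119312512,
    3198273201197089190, 2395971967802203578376, 749534103584148947456, 11529241668758962944,
    798461194534178005296, 147583857048982651008, 798443180170028261680, 798461194534178005282,
    297462784024515838168, 968483354917631842320, 14372852684161152, 2361193216204850997294,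
    41516958858176661684, 798461192369514488098, 2387129178521096684036, 4623470710800089216,
    2534878353338273235400, 11664340627176956432, 2439597870924840697920, 2384241700136655273984,
    2368127823550928171528, 2674931044514502312134, 2365885006283452639264, 4623470708652605568,
    2477015993897137006848, 2366659671371618161280, 2440968796468347008, 5260239562495724160,
    660435469398936914178, 2988381564732455619136, 2965314145046268973056,
    2365966592176551888922, 297823298479135392228, 2368181835822725829208, 147588471125361250432,
    2877701102764176965632, 2365810895111034503232, 2314870117856444612, 9013906257365056,
    79416496514218050216, 3062159580729100550656, 4701760244425091124, 3412836825505837613160,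
    2534878353338268778952, 23067437325820887178, 346624066570500177936, 2730118152080498638890,
    2361210269739581065218, 79128266138066338472, 9013906249007168, 4623470708610663040,
    2534878353338268778956, 297823157741647036900, 2670166488962000184064, 2314870135036313796,
    2730118152217937592362, 2467990222414282880, 11664349595039563792, 3062164049075619774522,
    297841312877644874212, 40091263819604560356, 147588471125361774720, 660115168158388586752,
    2365810895111038697536, 9499814897189034, 2693372513919961572, 79416496514218050218,
    14518535693226112, 2368682434481746870788, 3412836825505837613176, 2534878353338269041096,
    14493199361796079616, 420411042865338384400, 2365794956062945722368, 11664349595056341008,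
    79128266138066338474, 14408037146099890, 3412836825505804058744, 2534878353338269041124,
    2365810886314949869632, 13844786575682306048, 4972009186344012416, 2730118152217937592490,
    2361597572634972389392, 594907514012470317184, 2365966592176551888906,
    2365921175577441789984, 590305345907730680328, 3062159827019705172000, 2278394452644608,
    2365810890712986026048, 41559217405130047488, 9974770028390410, 79416496514352267936,
    3062159545544728399874, 7593086568305393792, 4623470710758080640, 3062159545544728395776,
    27041560839340032, 309730578423114498064, 2494931160760727502856, 2757788573271398157056,
    2674931044514502312128, 627189579981177457408, 4623470708610596992, 2534878353338260390348,
    2366407469787854901888, 2361210269679317336064, 9007309179240448, 18036526269988864,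
    2361264326191123267840]

def block2 : Block where
  tag := 5
  ups := [
    24997, 27045, 289189, 293285, 551333, 813477, 817573, 2910629, 2914725, 2943397, 2947493,
    3963301, 3996069, 4061605]
  downs := [
    0, 16, 1040, 66576]
  codes := [
    2323877336443654272, 2392419139070414848, 2405624800063516782592, 2988390558806298560512,
    2603241248609272000, 2534878494075748747724, 2891374799018262720, 2405624800063516784640,
    11540858847547908, 2323877336460492928, 2515819154899564990984, 5260204369269418016,
    16816476210396659712, 18446744108440486018, 2370420476114425552896, 3066989976549624905736,
    3066988287699899121664, 16798461816182145024, 2359906133479456896, 2477015993897271191552,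
    39857026093591560192, 3085435031773608673280, 11541408603361796, 2379630016300073369600,
    653197621538561460488, 5260204369537853472, 16816476214691627008, 18446744108440486026,
    2370420476114459107328, 14518535827443840, 36905512524708931842, 16798461824772079616,
    2379630016317253238784, 2477015993897271224320, 2431961597213606016, 36905512541888801026,
    2994040812653204611276, 5260239562499918464, 2386624775362831188484, 212137579296044875778,
    7503278471416644072, 2988372539941014833728, 19928720478240, 3062736006297166041088,
    3062159545544862613504, 13862677097156672, 9232520220961325056, 2534878353338260392396,
    2891480352135053312, 3071382917581717389312, 11540583969640960, 9148046667595776,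
    18036526270054400, 9063068266954752, 2988390554339524446720, 36902660273418010624]

def block3 : Block where
  tag := 12
  ups := [
    534700, 551084, 551340, 813228, 813484, 817324, 817580, 2910636, 2914732, 3041708, 3045804,
    3963308, 4094380, 4094444]
  downs := [
    0, 16, 1040, 1104]
  codes := [
    27679651111981025290, 3071403324517327589632, 371817203687424749824, 885524813632849870914,
    7256301800102365188, 371817765812274688256, 2603104909234667712, 2368731311881737940992,
    14408054325977218, 2891536301556939096064, 2891536161369206554624, 3177460673906468716800,
    4612390030139326464, 368934881478553239552, 677947186830175764488, 885524813632849870930,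
    11265706129801280, 4623470704349249664, 7251868569186402306, 36046947639754840,
    153139979605652042, 2368734124432481792000, 304372282926286717696, 2361192394429292496960,
    9237498620803416064, 17626917306506, 34463091328, 2365830956259664723968,
    2663825153986476345920, 885524813632849870946, 2663825153986476345856, 297588889475128229890,
    25703045873812373508, 13844082888238432272, 2361183270181422514176, 3062159545544661549120,
    2891536160888178606080, 2314905319408402628, 2314878931062358210, 18446744108172312714,
    2467990222447837312, 78407687104773619864, 149924849290551370304, 885524813632849870866,
    2341924685992305152, 3071400931980025544960, 25703045873811849220, 2757860613273233260800,
    2361210269679317336576, 3062159545544661286912, 14408054393086080, 11329477804195840,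
    2368821346407272387072, 562984416182408, 2361183263631280734464, 33024]

def block4 : Block where
  tag := 13
  ups := [
    551341, 813485, 817581, 2910637, 2914733, 2943405, 2947501, 3041709, 3045805, 3074477,
    3074989, 3078573, 3079085, 3963309, 3996077, 4061613, 4094381, 4094445, 4127149, 4127213,
    4127661, 4127725, 4192685, 4192749, 4193197, 4193261, 4194285]
  downs := [
    0, 16, 1040]
  codes := [
    371817203687424749568, 2534878494075748753868, 5314247564797827108, 5706063120582574386,
    159121201866759152128, 2405624800029157044224, 14408329203884162, 2610246075931124959232,
    11259383870837252, 9152444714076224, 3209733489338377060416, 2516107385275850920448,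
    2332963698315886720, 5278218767778900004, 14408123045453954, 227452397035716608,
    5404319557345273888, 2607663349162836396, 16818728010212442112, 2525330757312705696256,
    16816476210398756864, 2525330757862461510144, 2748565151206479110928, 298030227082811944960,
    2656331146616564088848, 2434970217732049469456, 2153971712, 11265706062692416,
    2449345877786706864128, 2405714869747653513728, 5706245502107648258, 3003264184690059386956,
    3062159545544795766848, 2320255461586215040, 2610246075948304828416, 5314247565066299424,
    9152994469890112, 3209733489338410614848, 2516109637075664605696, 2516397867451682099720,
    7593104178107384320, 16816476214693724160, 18446744108440748170, 5278218768047335456,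
    2625677747672318380, 16818728010749313024, 2525333009112519381504, 16816476210935627776,
    2525333009114666865152, 11265701767725120, 9049049416221248, 3006819284014724383296,
    34731526784, 4647714824842117120, 590307069605137530880, 2534878353338260398540,
    11261308016443904, 5706063120582050098, 156815358857545458176, 3062159545544795504640,
    14412452372488320, 2610228800395839408128, 7593104173426540544, 11259108992925696,
    3062159545544793407488, 11259108992926208, 2405714834554691490304, 7593104177704731136,
    16816476214559506432, 4432777707656, 7593104173409763328, 3136090607718771427840,
    16818728010078224384, 3135964506929205053952, 16816476210264539136, 16816757685241249792,
    11259108724490240, 4647714858672848896, 9172263437893632, 22196391018816, 67633664]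

def block5 : Block where
  tag := 15
  ups := [
    3074991, 3079087, 4127663, 4127727, 4193199, 4193263, 4194287, 4194303]
  downs := [
    0, 16]
  codes := [
    3209733489346966995008, 148647375094559304, 7593667123497402512, 16816757685375467520,
    2251847161414272, 18446744108574965890, 54043230290838016, 4305453056,
    3209733489346966732864, 4532187018703432, 7593667123363184784, 16816757685241249800,
    3246629208773066489856, 34865414274, 4372561920, 4096]

def block6 : Block where
  tag := 32
  ups := [
    0, 32, 8224, 10272, 24608, 26656, 288800]
  downs := [
    18, 1042, 1106, 1554, 1618, 66578, 66642, 67090, 67154, 99858, 99922, 132690, 198226, 230994,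
    1115218, 1115730, 1119314, 1119826, 1148498, 1152594, 1246802, 1250898, 1279570, 1283666,
    3376722, 3380818, 3642962]
  codes := [
    2416537072415774212236, 85406280960103288832, 159166798572789836288, 894678366423374495824,
    159193257220550565888, 2361194507140885266504, 2365821954067619905548, 631877992165035534592,
    631877992712643864576, 2368105452997140513280, 631877992850082818048, 200615941671200358720,
    200615941675495326016, 631877992162888050688, 1111572267580581355872, 631873489113016494080,
    2594100006046859610, 2720904042295213834250, 4626059008472582322, 4755824197471861024,
    2988382132114815289936, 3099809628965499428864, 2688622237417443049486,
    2366572466943580909624, 2956668095779035124352, 2386604480611632685056,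
    2387180941363936108544, 2402745381676128542720, 2679398893976740429994,
    2372942491906055012352, 501026338188768529152, 2379634668043241914880,
    2372942509497838403608, 2372944761297652088856, 2679398885180647407786,
    2660951868419573416448, 2956090860970344415872, 2434979231635909824578,
    108509729430656647172, 2956090860970344415744, 108509729430656647168, 2365803956642748174346,
    2730127158696017789440, 159238293319936778240, 9014456072458306, 2895834401202110680,
    159238363688685142016, 4755824193176893728, 159238363654317015040, 124563395543050485846,
    327907106772416991318, 894748326403300655194, 327925121170926473302, 139963466707767296,
    2366286013638064996438, 327762991586488614998, 419708908195838759510, 3058028298728247298,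
    419715560239039320662, 419715558040016065110, 3058309769141555200, 3060561568955240448,
    3058028298459811840, 156806912408763498496, 27679703893339930624, 894676675374423890000,
    631945117339173853642, 4620706446221394338, 4683750243962112564, 2365804005038573879296,
    2330666018395521280, 345885487757030406144, 30044023871743905792, 345885487894469359616,
    2363719137460983627800, 2382168133334506799128, 345885485558007150592,
    2988386209069571344976, 159238293388656247296, 2366572466943648018456, 159229286189418283520,
    159229286189368279040, 306812245943956471808, 4625777533462317234, 2442178327889360453816,
    2441890101911255253176, 419715558589771813462, 2441890101979974729912, 3058305371095044096,
    3058446108583399424, 2441890097513208742072, 2366443448582797428852, 2363520616921397460992,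
    553412209054342138624, 85451299364207726592, 2365795473395132959002, 2693302694931726820,
    2365795473395132958986, 2667887390529454866432, 27679703893342028288, 2596383796467544906240,
    2439582529061035989632, 1111427589442552127488, 2434970843043143375360,
    2656340153813474611210, 3058239400397393920, 124704986527318147282, 125281447348341047506,
    124704986596037624018, 419711021446449939030, 419711021515169415766, 419708767447612998230,
    603607831899406336, 2365803957020694686016, 9009508270133314, 2956090860965982343808,
    4620710852885188738, 9062233397395456, 2365794945633857044480, 2373414634733586598,
    20982640134364467200, 501026338188764334848, 2372942632643409149952, 2372942509497838403584,
    2372942650235326758912, 2372942439129094176768, 2660951868428054167722, 4622958211690054310,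
    2435162527570403786962, 2365799613836250546176, 2330670416433643776, 2660951869252687888554,
    4620706446236074150, 85478338554107662336, 308992551017410461696, 297823298754550170084,
    345885478430643060752, 4620706446236074402, 4626094602980499602, 225972636893174562968,
    3058235002350882816, 87811498379899044050, 88387959200921944274, 87811498448618520786,
    419711021446449873494, 419711021515169350230, 401549967881335472214, 115340023506195710038,
    2684010551399015661634, 445279919949635627280, 415060909444533583890, 2372870451903800475648,
    318701749134071693398, 740301724614327403008, 2365809028149018886314, 4623314496363807376,
    4623460250407256720, 4623455233852162704, 2660951868977814175914, 2660951869252692082858,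
    2660951866778790920362, 161418633611573592064, 30102077535962406928, 2956106701088881901632,
    297841207599406514660, 2365795473395132926746, 50737553444905753546, 161706863981282852864,
    2361183267845486691072, 161418598427736276992, 913123419448133441616, 936758310292573650964,
    1111427589442552119808, 936757749541644402688, 159229286017565065216, 2365866992022382086180,
    50737571037091797834, 3062164049075619514414, 2656340169316517429442, 1111427589450806517760,
    2762400244652358894336, 4620698509165854792, 2365830956293508169728, 376510076784983670784,
    2368116733722065502272, 2368109809083699298376, 2365803952382203789336,
    627189298506192358144, 4611686052856332424]

def block7 : Block where
  tag := 36
  ups := [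
    36, 8228, 8356, 10276, 10404, 24612, 24740, 24996, 26660, 26788, 27044, 288804, 288932,
    289188, 534692, 551076, 551332, 813220, 813476, 2910628]
  downs := [
    18, 1042, 1106, 1554, 1618, 66578, 66642, 67090, 67154, 99858, 99922, 132690, 198226, 230994,
    1115218, 1115730, 1148498, 1246802, 1279570, 3376722]
  codes := [
    85406280960103305216, 479625232760040803072, 159157228457941412352, 159157228457941410320,
    328177955815487963154, 2365885006146013677604, 894678364224284153936, 2365885006146013677728,
    2365885006146013685796, 5629520236727485088, 2534878423706979664328, 3029886721316825858304,
    328177392865534541842, 2416537213153262567564, 159157228457941410304, 2674967073311521243330,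
    85370252163103203840, 2361372419557296046168, 2891339614646173904, 2274453766912,
    2365799609985779302912, 2368681913749443936768, 2365799609987926790656,
    631878001509005322240, 2368123467395649995264, 200633956069709840640, 4623470635629185716,
    2365885006257817045168, 200633956074004807936, 4623470710791178420, 106260663303323797590,
    200633956069575622912, 5634023905174831288, 631877992169330501888, 2365799609987926786560,
    4623470708643629748, 2365885006257817053360, 2365799609987926753792, 2396404313368847065088,
    200615941671066140928, 2361187783229863559680, 2368732228906849087616, 11266255818510402,
    2663338895175147776160, 2366572466945795502104, 2663338754437659412640,
    968465344917168871504, 2661032911428445718688, 2663338754472019159200, 4623470710791112884,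
    401964932110393311744, 159229286120682029568, 2657146577907286152, 7503278471550992864,
    2365799469250438431232, 2674931044514502314194, 2661032911428445726880,
    2361372410761203044444, 159238293457359273984, 2988381569164861868624,
    2444194480611519582208, 498071976833783909120, 2366209265422263568436,
    2365885147020940994612, 2648139361472680136, 4626058871111549076, 894784214466589360218,
    2365885006249092892848, 4626199608599904404, 4623470710757624498, 3066990539521187119104,
    2370407504316681375744, 2657146560727417032, 2395827852648487460864, 385751322482870059212,
    4623470708610140850, 2365885006283452639408, 2988381561079854063872, 2396404313400790884352,
    749534103575559012864, 2391389253571950542848, 501026338189305400064, 30044005729936265216,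
    341273801876578842624, 175435953579804328022, 200633956069708005632, 4623470635596480682,
    2391389253571547889688, 200633956070244876544, 4623470710800089792, 2460519838083086060100,
    2372942491906054946816, 175435953579802230870, 2372942509497838407704,
    2391389394309438898176, 4623470708652606144, 2391391505371361574936, 2365799609987959783936,
    2981687315730067226648, 2372942439129496813568, 182269684153370411028,
    2877692102677312651306, 2361192255341071618114, 2448809843877869015552,
    346624069044401078292, 2813137498523373535232, 894676116822516979792, 2594100005841273094,
    2675358149770217956, 5629520236593267368, 14518535686934658, 2421144184465822191644,
    346624066845377953812, 2965314233007199191552, 2361192255341071614018, 5341289860441555624,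
    3251238766149697245696, 2895972939667210448, 48476764221809229824, 2361525515040934461460,
    159229286258120982528, 2481091646006860739072, 2361192255890827432002,
    2667887390540242747392, 936919879403106861076, 660115168433266501888, 968463093117355186256,
    2603107205297340738, 2693373080855644644, 226990449103894463146, 14518535693226114,
    159229286086322290688, 936919876929207926800, 7502996996574282208, 9014456004821058,
    5341289860441555640, 2361183272243543728128, 2895972939667210456, 159238293457359208448,
    4620851552188510238, 2421149374444640141490, 124711770239172350038, 124711770239172345942,
    2421149409630891280562, 500593992626684250880, 2421149374169762236594, 894748185669570396250,
    2716292775749487689906, 2421149409354134325426, 4623470710757558964, 500593992626683988736,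
    2384255886297221038258, 894748185682992169050, 327907106772685422678, 2421149409629012230322,
    4623470708610075316, 2421149409354134323378, 894748185665275428954, 2434820293119312384,
    124551573594028638294, 3058028298728243202, 419859673769257800278, 401412931344851533910,
    419859673219501986390, 125281517717085225170, 3058309769409986562, 419715560230449386070,
    3058309769409986560, 3060561569223671810, 4623470710800026324, 401714701656949784662,
    419711054431798760022, 401264453294636662870, 419711162183938294358, 401412929145828278358,
    4623470708652542676, 3058450506898341888, 419715558031426130518, 419711162252657771094,
    3058028298459807744, 2965314215415013150720, 2803914113110100826178, 4621221017705056394,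
    9013906257365058, 3062159862204077261312, 2877701102781356834816, 894676112424470468688,
    2675358665166291364, 4701764642471602228, 5629520236559712936, 2534878423707012956616,
    2421144184465822187548, 346624066570499915796, 618056020623937372160, 180161577369935960,
    5341289860408001192, 2361192255341071614024, 894676112424470452304, 2670166629699488539392,
    2361525515040934461464, 345885487757164623872, 30044024146621812736, 30044005729802047488,
    30208263970898712576, 2472059962139932885202, 2363719137460983660568, 4623470618416611498,
    2330670416442032384, 2363719278198472015896, 3413287185468843098170, 2460519556608109349444,
    4620706446236108966, 175435953579801706582, 2363719137460983631896, 341273801876176189440,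
    3413287185468809543738, 2679398613326397440170, 175435951380778451030,
    2972463943693212450840, 4620706446236139698, 85451299364190949888, 553412209054879009536,
    159229286051979340288, 2368190990030154688672, 401964932110393278482, 4626058871111549072,
    968465340519122360400, 2365885006249092892832, 2365885006249092900900, 4623470710758146226,
    2657146560727421088, 2365794954567445725242, 918473203224240193554, 2481087623306364322060,
    376527950446015414476, 2674967073311521243346, 2365885006249092901024,
    2988381561079854055680, 4827881791509788928, 2988381564766815357520, 3029880069260747210936,
    419859673769257734742, 401412931344817979478, 2441908116584642642104, 401408568482678964310,
    3058305371363475458, 419715560230449320534, 3058305371363475456, 3058446108583432192,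
    4623470710800025812, 401714701656916230230, 2439584258902041559224, 401264453294603108438,
    402126428642497265750, 3029880069329466687672, 4623470708652542164, 3060557171177160704,
    419715558031426064982, 419711162252657705558, 2439584254503995048120, 9499814897191082,
    2803914113659856640066, 4621221017705056426, 9014456013178946, 156811843162224414720,
    660115168158388594944, 968463088719308675152, 4621625608374462494, 2693373063675775348,
    5629520236559712952, 2534878423707013218760, 2365794954563150757946, 936919876929205567508,
    2670166629836927484672, 9534999269279914, 5341289860408001208, 14408037146103986,
    968463088719308671056, 2670166629836927492864, 2361597572634972389400, 603612229945917440,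
    2877692102677312651274, 9009508269609026, 288247970574250058, 328177955815555072016,
    2361183259029244882954, 894678364224284153872, 4701760347504297984, 585472596968128512,
    4623470710757558436, 328177955815487963136, 2361246291872891142656, 300507206661103943828,
    374348648031008588032, 45054275743514712, 2674931044514502279362, 2361192776436769882138,
    2366659636186910528128, 2965314233002904228352, 4620693260833133056, 2391389235979630280704,
    501026338189301205760, 2686539410550982836224, 2391389394309304680450, 175399924782785364054,
    4627747727539994794, 968535161960650506330, 4627747727539962026, 2372942650235326791680,
    4623470710758342826, 180047639598161985622, 2372942491905920729088, 175399924782783266902,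
    2372942509497838407680, 2391391505371630010368, 4623470708610859178, 4627888465028317354,
    2674931044514426781906, 2372942650235326763008, 2372942439129094160384,
    308992621386154639360, 3062164049075619778602, 297823298754013299172, 78413070350411702418,
    2368461063466460090952, 161423102026954702848, 895270587575283374096, 4620706446236076450,
    4626094055640604818, 4623470710758146752, 2534882856937896149448, 2965323122064654205000,
    346624066570508566544, 2730118152080498642986, 297823263569641210340, 3413413286258107482216,
    2603100511188025552, 2366416455623807898184, 161418633628879159296, 4612460534174974208,
    83010374954383475456, 2368732224440015990916, 445153819194477390336, 2365885147020940994580,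
    936920580616647344146, 2365885006249092892692, 885524813628957524058, 2657142162617470976,
    4701764814270294036, 4623470710757558452, 498288149617470294784, 2688622237417443033094,
    936920017666693922834, 2372870451903800479744, 9035828189804544, 4623470708610074804,
    2365885006283452639376, 13601861382832312, 2432568493305627136, 740301724339449496064,
    2365804867041049585694, 3062164049075619778618, 297841313152522781156, 73801384331984314546,
    2534882856938164847048, 4621555237482817566, 2365810890730176249920, 2361192255888747053128,
    4626094055573495986, 3413413286258141036664, 2534882856937896411592, 4621555237482801182,
    936919876929214218256, 7575054595492151456, 297841277968150692324, 3413413286258107482232,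
    2361192255890827427912, 936775761741138362384, 2891339614713413872, 161418633605131010048,
    2965314109859548073984, 2365966592039112935434, 2757788573271381445376, 9535549025028616,
    3062159827019705171968, 2342097278337024, 2365810890712851808320, 631855027763835699200,
    4567577661674240, 5629520219379843752, 2534878423706968916424, 4611686052856594568,
    309730578423080812560, 2490319474742300114968, 4621221017696602632, 2674931044514502279360,
    2341890085735759872, 373555713788751249408, 306266902421700608, 161418633605151719424]

def block8 : Block where
  tag := 37
  ups := [
    24997, 27045, 289189, 551333, 813477, 2910629, 2943397]
  downs := [
    18, 1042, 1554, 66578, 67090, 99858]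
  codes := [
    2379630016300071280640, 2428447936089378816, 2515821406699378675848, 2359906133479456900,
    2515821406699378676360, 5260204377859352612, 2274453766928, 2379630016317251182592,
    14518535827443842, 7503278471550861792, 7061667206685554976, 159229286223744794624,
    304371301635512828194, 2665563807325708747264, 2379630016317251149824, 14518535827443856,
    2481087605714178277644, 2379630016317253246976, 306814497812489633792, 212137579296044875786,
    3099053022044177670724, 864711057175613440, 3062159545544862618112, 13862677097156738,
    2405570719375205569024, 2359904003175677952, 2323857442454897032, 18318046003200,
    2370420476114324889600, 3066990117287113261056, 2431961597196828672, 2370420616851813244928,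
    2431961597213605888, 7503278454236774888, 2988372539941014833664, 19928720478208,
    3062159545544862617600, 13862677097156608, 9148184106549248, 306266902421766144,
    9063068266921984, 9172125998907392]

def block9 : Block where
  tag := 44
  ups := [
    534700, 551084, 551340, 813228, 813484, 2910636, 3041708]
  downs := [
    18, 1042, 1106, 1554, 1618, 132690]
  codes := [
    2361192396353437845570, 885560842429868802130, 11265706129801288, 180162127125676120,
    2891339683365650640, 32317844291948904912, 2361192290518598549570, 2663825153986744781376,
    894748185669704613970, 2663825153986744781312, 108509729430656122884, 2361183270181422516480,
    3006828291213978798784, 2365803952244701663242, 302741255626153787532, 885524813632849838162,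
    11263644545499136, 2365795050607276692096, 2368821346415862321664, 17626917240970,
    4611703885491339284, 9154643737331778, 4623470687169380512, 371835218085934231808,
    631801002151097997770, 2361192255341071614536, 2621112609778434184, 2361192248651402182656,
    297823263569641734628, 297588889475128229894, 2603135695560114384, 2365803966074485510728,
    4626094072820474002, 226431999657187082392, 618028976898480144384, 149915842091296629248,
    3071400931980025549056, 2341889501620216320, 627207312939061316352, 11259246498996224,
    34462761096, 4611703644973170708]

def block10 : Block where
  tag := 45
  ups := [
    551341, 813485, 2910637, 2943405, 3041709, 3074477, 3074989]
  downs := [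
    18, 1042, 1554]
  codes := [
    11265706062692424, 2891480420854005968, 5278218768047335460, 32317844257589166544,
    5404319565935208484, 9049049416221250, 9049049416212546, 11263644478390272,
    2405714834563281424896, 7593104177838948352, 34731196554, 2323857442454897096,
    4791830038150381578, 4647714824304721920, 11259246431879168, 11259246431887360,
    7593104177704730624, 34731196552, 3135946492530695571968, 4647714858664460288, 67371008]

def block11 : Block where
  tag := 47
  ups := [
    3074991]
  downs := [
    18]
  codes := [
    0]

def block12 : Block where
  tag := 48
  ups := [
    0, 32, 8224, 24608]
  downs := [
    99859, 99923, 230995, 1148499, 1152595, 1279571, 1283667, 3376723, 3376979, 3380819, 3381075,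
    3642963, 3643219, 3659603]
  codes := [
    2365808466839847960704, 2365808467114725867648, 627223264791196205312,
    2365795508000590414592, 149904618608071934208, 345885487757030406152, 345885487894469359632,
    78443711538093310130, 87631657316735385664, 85451316956345802768, 825503089837037715468,
    631810013748403444616, 149904618608063545600, 345885479098376337472, 2365799613836250546184,
    78407682741074280614, 85487345753362403330, 2368109809015046836808, 345885478430643191824,
    2368109782678575906888, 2365809028149018894506, 78410290791202013840, 78410431528690369168,
    2660951866778790928554, 161418633611573592128, 30111084735217147920, 297841207599406645732,
    161418633742570094656, 936181289319643035712, 936181289457081989184, 78410431528723661456,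
    30237466999732437008, 1111427589579856855296, 631810009358951062346, 936758310292574306324,
    2365803939057061462046, 2587156402279714654890, 2435555699597016100994,
    2435555699597016625282, 2365795472847591705146, 85559403347400331266, 50737571037100186442,
    936757749541660655632, 161418598420759052290, 2365867269649068099620, 2365867269649068100132,
    373557860035717103786, 2366380409234670092360, 401217017855053531904, 2368109809015046902344,
    2368109809083766379080, 2956099758841072320584, 2368127792131430547840,
    2365803952384351272970, 2368109809083766407240, 2365803954444393644288]

def block13 : Block where
  tag := 52
  ups := [
    36, 8228, 8356, 24612, 24740, 24996]
  downs := [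
    99859, 99923, 230995, 1148499, 1279571, 3376723, 3376979]
  codes := [
    677929163635640369164, 668705941132366971020, 2365885146814782564528, 2421144184483002056732,
    631810009350356933066, 2365795332082320408704, 345885487757298841608, 30208263970898712592,
    345885487894603577408, 78407682741074315430, 345885487890174392384, 78407682741074346162,
    306812254774392389648, 40091264369360374244, 825503125021409804300, 2365795095300639113274,
    631810009350356933578, 2365803939057065656350, 373557886423727734952, 78413070350478811282,
    373557895219820757160, 39532606497021886720, 345885476231619936272, 2365803939669362212936,
    2365804867041066362910, 78413070350478811314, 297841277968150708708, 30111084735217139728,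
    297841066861918290404, 161418633605131141184, 2366804279849169979402, 2667905404526385037408,
    373557895220089192618, 2365803948482404417608, 2365803966074552685128,
    2365803948482366668872, 594916521211725058192, 2365804463002275023368,
    2365804462727397115914, 2361768726989371474200, 2365803966074552713288, 2365799730122254844160]

def block14 : Block where
  tag := 53
  ups := [
    24997]
  downs := [
    99859]
  codes := [
    18482843565961675072]

def block15 : Block where
  tag := 160
  ups := [
    0, 32, 8224, 10272]
  downs := [
    132698, 198234, 231002, 1246810, 1250906, 1279578, 1283674, 3376730, 3380826, 3642970,
    3901018, 3905114, 4167258, 4169306]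
  codes := [
    2421144169079168444446, 159238293388656247312, 2956667374499474407940, 159238363585597538832,
    401552782631228145750, 401550530833561944150, 402126991583717883990, 401550530831414460502,
    5260488622951532660, 159229286155041767440, 2956090913747170984452, 9587746234576926,
    401550530833427726422, 401550530850607595606, 401694083071550160982, 401549967881326821462,
    2370420423337766764544, 2684010551399015661570, 2431961562870317568, 2431961562866123264,
    2735315593572722749554, 2365811006762849218674, 2440172191992997294194,
    2440167688393369923698, 5269229178464501984, 9014453924413514, 4683746292592199780,
    2361183787376775266330, 4622975838235836582, 4622975803876098726, 659498424358060177664,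
    198310098659770237184, 2679398583905611567146, 2490315308349679339778,
    1111427589446847094784, 2656340171405660672042, 2589758954514570805400,
    2365794946042472433690, 4620710852885188746, 622640662916915920896, 1111427589579923963904,
    156806912409308758032, 52813074037020, 159229286017565065232, 5269229178430947552,
    4621625610521944094, 14161716745216030, 2439581921924389826730, 2361192266363774304282,
    2508757950522972045312, 2630119912114880768, 4620713043318366464, 9027162329989376,
    78398679939914797312, 2365804096005903352064, 2365803934686864638208]

def block16 : Block where
  tag := 164
  ups := [
    36, 8228, 8356, 10276, 10404, 534692]
  downs := [
    132698, 198234, 231002, 1246810, 1279578, 3376730, 3901018]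
  codes := [
    2365889509883080067232, 3030454368386498658820, 2365889509883080001696,
    2531816204681164644608, 2665554943819036967688, 159238293216853361168, 401549970082631778390,
    401694083071684378710, 419708488725844459606, 401549967883608522838, 419996714156743983190,
    401549967881461039190, 159229288388424761360, 2517980991229360554752, 1111428152529944494592,
    159238293216857554960, 4611738832038295836, 159229286051958358032, 9223398659545268992,
    4626058871111548944, 26622690493184, 4625495921157996560, 2370420423337766768640,
    2988381564732455619072, 4621625610521946142, 2365885002125924288612, 14161716745218078,
    2363660228509913186304, 7575072187678195936, 196131781364272463888, 2365794946042606651418,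
    2413951562407346176, 4701764745550809088, 622703730903876763652, 2413955926094118912,
    622640662916907532288, 2965323117056722440192, 26594638959360, 4611703816845918208,
    2365794945047650763032, 9007233717502344, 2365803952244758040832]

def block17 : Block where
  tag := 172
  ups := [
    534700]
  downs := [
    132698]
  codes := [
    4620693252041867264]

def block18 : Block where
  tag := 176
  ups := [
    0, 32, 8224]
  downs := [
    231003, 1279579, 1283675, 3376731, 3376987, 3380827, 3381083, 3642971, 3643227, 3659611,
    3901019, 3901275, 3901403, 3905115, 3905371, 3905499, 4167259, 4167515, 4167643, 4169307,
    4169563, 4169691, 4183899, 4184027, 4185947, 4186075, 4194267]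
  codes := [
    2366443730057774139508, 159238293251217301520, 2365795508017778680080,
    2365809028149018919082, 152197267086040220304, 2660951866778790953130, 235205609906411798592,
    2365795095317818990650, 196131781398632210448, 779742349939765059840, 299768913441520392912,
    779742349939765051648, 78407700333260365990, 198310098797209714946, 78407700333260325030,
    2361768723319892799622, 2361768723319358025862, 2361768723319355928710,
    2679398601506387546154, 2494926994368106727682, 2660951857432677994538,
    2366443730401371523172, 2365867269649068120102, 2365808460809367556696,
    2365795473532645279770, 2368109809015046902360, 2365795473532641085466, 39532624089207931136,
    2365803957020694718784, 2365803939669370601800, 2365809027599275688090,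
    2365809168336764043418, 2660951857432927961258, 159238293251183747088, 336662104179598236490,
    2365795508017770291456, 78443720471625220262, 78443720540344696998, 78407691537167302822,
    2365867269649068099700, 2365867269649068107892, 2365795473395200034874,
    2365867269580348622964, 345885476216453012298, 196131781398598125584, 2365803939057338302494,
    705596985653789268810, 2365795095163200167994, 2365867269649068099684,
    2366804279711731025946, 2365795473395200034842, 899290617556418822168, 899579125009500733464,
    2365795473395202148378, 2368109808465291088472, 2368109808534010565208,
    2365795473395202131994, 51386081318365430016, 53691924327579123968, 177685037325157007380,
    2365869521380162308212, 2365804867049656819742, 177685037324889096212,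
    2365869521517601261684, 233097327142238818322, 177685037462328049684, 156932450379408998416,
    156932450379425775632, 159220278852670062608, 2365803956745816811840, 2365803956883255765312,
    299768616023617048832, 2363498109467472560386, 2365803952384351272984,
    2365803935305407070216, 2365803952384349175834, 2365803952384351272986, 78407687139102429440,
    2361768727015141277976, 78407687139169538304, 2368109795254508585216]

def block19 : Block where
  tag := 180
  ups := [
    36, 8228, 8356]
  downs := [
    231003, 1279579, 3376731, 3376987, 3901019, 3901275, 3901403]
  codes := [
    85451316956377026568, 159238293251217293328, 2365795508017778680064, 2365804867049656297502,
    2365795095300639121466, 196131781398632202256, 2366804279849169979418,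
    2365803966005833208408, 2365795473532638988314, 2365803953241861392410,
    622712738103131504644, 2365803939669362213192, 2882304307596506433674, 262875127850496819416,
    177685037324888571924, 2365803952453070749720, 2587164881131420123160,
    2365803935305407004680, 2965323134648908484610, 2365803952246905504024, 2365803952245294891264]

def block20 : Block where
  tag := 240
  ups := [
    0, 32]
  downs := [
    3901407, 3905503, 4167647, 4169695, 4184031, 4186079, 4194271, 4194303]
  codes := [
    454386761380756324362, 454386761380754227210, 94927024781734838564, 94926884044246483236,
    2663834161228536385698, 2661528318219322691746, 899290617556418822224,
    2365795473122471716890, 2365795403439309717522, 159220278852670062864,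
    2365803956745833589056, 613363265276679459072, 2587164881165779861528,
    2365803952281265242136, 2365803952281265242392, 2513377904868794171648]

def block21 : Block where
  tag := 244
  ups := [
    36]
  downs := [
    3901407]
  codes := [
    2365803952279117758720]

/-- All keys of games born by day three, with digraphs realizing them. -/
def blocks : List Block := [
    block0, block1, block2, block3, block4, block5, block6, block7, block8, block9, block10,
    block11, block12, block13, block14, block15, block16, block17, block18, block19, block20,
    block21]

/-! ### Verification of the table, and the number of values. -/

theorem block0_valid : block0.Valid := by decide +kernel

theorem block1_valid : block1.Valid := by decide +kernel

theorem block2_valid : block2.Valid := by decide +kernel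

theorem block3_valid : block3.Valid := by decide +kernel

theorem block4_valid : block4.Valid := by decide +kernel

theorem block5_valid : block5.Valid := by decide +kernel

theorem block6_valid : block6.Valid := by decide +kernel

theorem block7_valid : block7.Valid := by decide +kernel

theorem block8_valid : block8.Valid := by decide +kernel

theorem block9_valid : block9.Valid := by decide +kernel

theorem block10_valid : block10.Valid := by decide +kernel

theorem block11_valid : block11.Valid := by decide +kernel

theorem block12_valid : block12.Valid := by decide +kernel

theorem block13_valid : block13.Valid := by decide +kernel

theorem block14_valid : block14.Valid := by decide +kernel

theorem block15_valid : block15.Valid := by decide +kernel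

theorem block16_valid : block16.Valid := by decide +kernel

theorem block17_valid : block17.Valid := by decide +kernel

theorem block18_valid : block18.Valid := by decide +kernel

theorem block19_valid : block19.Valid := by decide +kernel

theorem block20_valid : block20.Valid := by decide +kernel

theorem block21_valid : block21.Valid := by decide +kernel

theorem blocks_valid : ∀ b ∈ blocks, b.Valid := by
  simp only [blocks, List.forall_mem_cons]
  exact ⟨block0_valid, block1_valid, block2_valid, block3_valid, block4_valid, block5_valid,
    block6_valid, block7_valid, block8_valid, block9_valid, block10_valid, block11_valid,
    block12_valid, block13_valid, block14_valid, block15_valid, block16_valid, block17_valid,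
    block18_valid, block19_valid, block20_valid, block21_valid,
    fun _ h => absurd h List.not_mem_nil⟩

def codes : List ℕ := blocks.flatMap Block.codes

def keys : List ℕ := blocks.flatMap Block.keys

theorem map_evalMask_codes : codes.map (fun c => evalMask c 8 255) = keys := by
  have h : ∀ l : List Block, (∀ b ∈ l, b.Valid) →
      (l.flatMap Block.codes).map (fun c => evalMask c 8 255) = l.flatMap Block.keys := by
    intro l hl
    induction l with
    | nil => rfl
    | cons b l ih =>
      rw [List.flatMap_cons, List.flatMap_cons, List.map_append, (hl b List.mem_cons_self).1,
        ih fun c hc => hl c (List.mem_cons_of_mem _ hc)]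
  exact h _ blocks_valid

theorem validCode_of_mem {c : ℕ} (hc : c ∈ codes) : validCode c = true := by
  obtain ⟨b, hb, hcb⟩ := List.mem_flatMap.1 hc
  exact List.all_eq_true.1 (blocks_valid b hb).2 c hcb

theorem closedUnder_downMasks : ClosedUnder 22 downMask downMasks := by
  have h0 : 0 ∈ downMasks := mem_of_memNat (by decide +kernel)
  have h1 : downMasks.all (fun m => Nat.blt m 4194304) = true := by decide +kernel
  have h2 : downMasks.all (fun m => (List.range 22).all fun k =>
      force (Nat.lor m (downMask k)) fun x => memNat x downMasks) = true := by decide +kernel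
  refine ⟨h0, fun m hm => ?_, fun m hm k hk => mem_of_memNat ?_⟩
  · simpa [Nat.blt_eq] using List.all_eq_true.1 h1 m hm
  · have := List.all_eq_true.1 (List.all_eq_true.1 h2 m hm) k (List.mem_range.2 hk)
    rwa [force_eq] at this

theorem closedUnder_upMasks : ClosedUnder 22 upMask upMasks := by
  have h0 : 0 ∈ upMasks := mem_of_memNat (by decide +kernel)
  have h1 : upMasks.all (fun m => Nat.blt m 4194304) = true := by decide +kernel
  have h2 : upMasks.all (fun m => (List.range 22).all fun k =>
      force (Nat.lor m (upMask k)) fun x => memNat x upMasks) = true := by decide +kernel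
  refine ⟨h0, fun m hm => ?_, fun m hm k hk => mem_of_memNat ?_⟩
  · simpa [Nat.blt_eq] using List.all_eq_true.1 h1 m hm
  · have := List.all_eq_true.1 (List.all_eq_true.1 h2 m hm) k (List.mem_range.2 hk)
    rwa [force_eq] at this

/-- This is the exhaustive search behind the upper bound: every possible pair of a mask of Left
options and a mask of Right options is evaluated and its profile found in the block with the same
tag. -/
theorem profile_mem_keys {A B : ℕ} (hA : A ∈ downMasks) (hB : B ∈ upMasks) :
    profile (A ||| B <<< 22) ∈ keys := by
  have h : downMasks.all (fun A => upMasks.all fun B =>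
      force (profile (Nat.lor A (Nat.shiftLeft B 22))) fun P =>
        blocks.any fun b => b.contains P) = true := by decide +kernel
  have := List.all_eq_true.1 (List.all_eq_true.1 h A hA) B hB
  rw [force_eq] at this
  obtain ⟨b, hb, hc⟩ := List.any_eq_true.1 this
  exact List.mem_flatMap.2 ⟨b, hb, Block.mem_keys_of_contains hc⟩

def increasing : ℕ → List ℕ → Bool
  | _, [] => true
  | a, b :: l => cond (Nat.blt a b) (increasing b l) false

theorem pairwise_of_increasing {a : ℕ} {l : List ℕ} (h : increasing a l = true) :
    (a :: l).Pairwise (· < ·) := by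
  induction l generalizing a with
  | nil => exact List.pairwise_singleton _ _
  | cons b l ih =>
    rw [increasing] at h
    cases hab : Nat.blt a b <;> rw [hab] at h
    · exact absurd h (by simp)
    have hab' : a < b := by simpa [Nat.blt_eq] using hab
    refine List.pairwise_cons.2 ⟨fun c hc => ?_, ih h⟩
    rcases List.mem_cons.1 hc with rfl | hc
    · exact hab'
    · exact hab'.trans ((List.pairwise_cons.1 (ih h)).1 c hc)

theorem nodup_keys : keys.Nodup := by
  -- The blocks are ordered by tag, and each block by its keys, so placing the tag above the 44 bits
  -- of the key gives an increasing list. The successor keeps the entries above the initial bound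
  -- `0`.
  have h : increasing 0 (keys.map fun P =>
      Nat.succ (Nat.add (Nat.shiftLeft (keyTag P) 44) P)) = true := by decide +kernel
  exact List.Nodup.of_map _ ((List.pairwise_cons.1 (pairwise_of_increasing h)).2.imp
    fun h => Nat.ne_of_lt h)

theorem length_codes : codes.length = 1474 := by decide +kernel

theorem evalMask_injOn : Set.InjOn (fun c => evalMask c 8 255) {c | c ∈ codes} := by
  have h := map_evalMask_codes ▸ nodup_keys
  exact fun c hc d hd hcd => List.inj_on_of_nodup_map h hc hd hcd

theorem nodup_codes : codes.Nodup :=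
  List.Nodup.of_map (fun c => evalMask c 8 255) (map_evalMask_codes ▸ nodup_keys)

/-- Every game born by day three is equal to the game of one of the listed digraphs. -/
theorem exists_code_of_birthday_le_three {X : CGame} (hX : X.birthday ≤ 3) :
    ∃ c ∈ codes, (ofCode c).game ≤ X ∧ X ≤ (ofCode c).game := by
  have hopt := hasOptionsIn_of_birthday_le_three hX
  obtain ⟨A, hA, B, hB, hW⟩ :=
    exists_isOptionMask le_rfl closedUnder_downMasks closedUnder_upMasks hopt
  have hk := profile_mem_keys hA hB
  rw [← map_evalMask_codes] at hk
  obtain ⟨c, hc, hck⟩ := List.mem_map.1 hk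
  have hv := validCode_of_mem hc
  have hP := isProfile_game hv
  rw [hck] at hP
  exact ⟨c, hc, le_of_isProfile (hasOptionsIn_game hv) hopt hP hW.isProfile,
    le_of_isProfile hopt (hasOptionsIn_game hv) hW.isProfile hP⟩

/-- Profiles depend only on the value, so distinct keys give distinct values. All these values are
born by day three since valid codes have day-two options. -/
theorem ncard_valuesBornBy_three : (valuesBornBy 3).ncard = 1474 := by
  have hinj : Set.InjOn (fun c => (ofCode c).game.value) {c | c ∈ codes} := by
    intro c hc d hd hcd
    obtain ⟨h1, h2⟩ := value_eq_iff.1 hcd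
    -- `IsProfile` says nothing about bits from 44 on; this bound makes them vanish.
    have hkeys : keys.all (fun P => Nat.blt P 17592186044416) = true := by decide +kernel
    have hlt : ∀ {e : ℕ}, e ∈ codes → evalMask e 8 255 < 2 ^ 44 := by
      intro e he
      have : evalMask e 8 255 ∈ keys := map_evalMask_codes ▸ List.mem_map_of_mem he
      simpa [Nat.blt_eq] using List.all_eq_true.1 hkeys _ this
    refine evalMask_injOn hc hd (Nat.eq_of_testBit_eq fun j => Bool.eq_iff_iff.2 ?_)
    have hPc := isProfile_game (validCode_of_mem hc)
    have hPd := isProfile_game (validCode_of_mem hd)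
    rcases lt_or_ge j 22 with hj | hj
    · rw [(hPc j hj).1, (hPd j hj).1]
      exact ⟨fun h => h2.trans h, fun h => h1.trans h⟩
    obtain ⟨k, rfl⟩ := Nat.exists_eq_add_of_le hj
    rcases lt_or_ge k 22 with hk | hk
    · rw [(hPc k hk).2, (hPd k hk).2]
      exact ⟨fun h => h.trans h1, fun h => h.trans h2⟩
    · have hpow : 2 ^ 44 ≤ 2 ^ (22 + k) := Nat.pow_le_pow_right two_pos (by omega)
      rw [Nat.testBit_lt_two_pow ((hlt hc).trans_le hpow),
        Nat.testBit_lt_two_pow ((hlt hd).trans_le hpow)]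
  have himage : (fun c => (ofCode c).game.value) '' {c | c ∈ codes} = valuesBornBy 3 := by
    ext v
    constructor
    · rintro ⟨c, hc, rfl⟩
      obtain ⟨Y, hY, h⟩ := (hasOptionsIn_game (validCode_of_mem hc)).exists_birthday_le_three
      exact ⟨Y, hY, value_eq_iff.2 h⟩
    · rintro ⟨X, hX, rfl⟩
      obtain ⟨c, hc, h⟩ := exists_code_of_birthday_le_three hX
      exact ⟨c, hc, value_eq_iff.2 h⟩
  rw [← himage, hinj.ncard_image]
  have : {c | c ∈ codes} = ((codes.toFinset : Finset ℕ) : Set ℕ) := by ext; simp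
  rw [this, Set.ncard_coe_finset, List.toFinset_card_of_nodup nodup_codes, length_codes]

end ColouredDigraph

/-! ### The extremal game, and its irreversible Right options in small digraphs. -/

namespace CGame

theorem dayTwo_le_dayTwo {k i : ℕ} (h : k < 22 ∧ i < 22 ∧ (downMask i).testBit k = true) :
    dayTwo k ≤ dayTwo i :=
  (testBit_downMask h.2.1 h.1).1 h.2.2

theorem not_dayTwo_le_dayTwo {k i : ℕ} (h : k < 22 ∧ i < 22 ∧ (downMask i).testBit k = false) :
    ¬ dayTwo k ≤ dayTwo i := by
  rw [← testBit_downMask h.2.1 h.1, h.2.2]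
  decide

/-- The game `{2 | ↑, ↑*, ±1}`. -/
def extremal : CGame := ofLists [dayTwo 5] [dayTwo 8, dayTwo 19, dayTwo 12]

theorem birthday_extremal : extremal.birthday = 3 := by
  refine le_antisymm (birthday_le_of_options (fun x hx => ?_) fun x hx => ?_) ?_
  · rw [extremal, mem_leftOptions_ofLists, List.mem_singleton] at hx
    exact hx ▸ Nat.lt_succ_of_le (birthday_truncated 2 5)
  · rw [extremal, mem_rightOptions_ofLists] at hx
    simp only [List.mem_cons, List.not_mem_nil, or_false] at hx
    rcases hx with rfl | rfl | rfl <;> exact Nat.lt_succ_of_le (birthday_truncated 2 _)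
  · have h1 : dayTwo 5 ∈ extremal.leftOptions := by simp [extremal, mem_leftOptions_ofLists]
    have h2 : dayTwo 2 ∈ (dayTwo 5).leftOptions :=
      (mem_leftOptions_dayTwo (by decide)).2 ⟨2, by decide, rfl⟩
    have h3 : dayTwo 0 ∈ (dayTwo 2).leftOptions :=
      (mem_leftOptions_dayTwo (by decide)).2 ⟨0, by decide, rfl⟩
    have := birthday_lt_of_mem_left h1
    have := birthday_lt_of_mem_left h2
    have := birthday_lt_of_mem_left h3
    omega

theorem antichain_of_le {k i : ℕ} (hk : k ∈ [8, 19, 12]) (hi : i ∈ [8, 19, 12])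
    (h : dayTwo k ≤ dayTwo i) : k = i := by
  have table : ∀ k ∈ [8, 19, 12], ∀ i ∈ [8, 19, 12], (downMask i).testBit k = true → k = i := by
    decide
  have lt : ∀ k ∈ [8, 19, 12], k < 22 := by decide
  exact table k hk i hi ((testBit_downMask (lt i hi) (lt k hk)).2 h)

/-- The Left option 2 of `extremal` is above `0`, `*` and `1`, the Left options of ↑, ↑* and ±1.
Hence a position above `extremal` can fail to be above one of these three only because of a Right
move. -/
theorem not_extremal_le {i l : ℕ} (hi : i ∈ [8, 19, 12]) (hl : l ∈ leftIndices i) :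
    ¬ extremal ≤ dayTwo l := by
  have table : ∀ i ∈ [8, 19, 12], ∀ l ∈ leftIndices i,
      l < 22 ∧ 5 < 22 ∧ (downMask 5).testBit l = true := by decide
  intro h
  exact (le_iff.1 h).1 (dayTwo 5) (by simp [extremal, mem_leftOptions_ofLists])
    (dayTwo_le_dayTwo (table i hi l hl))

end CGame

namespace ColouredDigraph

open CGame

variable {V : Type} {G : ColouredDigraph V} {S : Finset V}

theorem gameOn_le_dayTwo_iff {k : ℕ} (hk : k < 22) : G.gameOn S ≤ dayTwo k ↔
    (∀ b ∈ S, G.colour b = .left → ¬ dayTwo k ≤ G.gameOn (G.delete S b)) ∧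
      ∀ r ∈ rightIndices k, ¬ dayTwo r ≤ G.gameOn S := by
  rw [le_iff]
  simp only [mem_leftOptions_gameOn, mem_rightOptions_dayTwo hk]
  refine and_congr ⟨?_, ?_⟩ ⟨?_, ?_⟩
  · exact fun h b hb hc => h _ ⟨b, hb, hc, rfl⟩
  · rintro h _ ⟨b, hb, hc, rfl⟩
    exact h b hb hc
  · exact fun h r hr => h _ ⟨r, hr, rfl⟩
  · rintro h _ ⟨r, hr, rfl⟩
    exact h r hr

theorem dayTwo_le_gameOn_iff {k : ℕ} (hk : k < 22) : dayTwo k ≤ G.gameOn S ↔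
    (∀ l ∈ leftIndices k, ¬ G.gameOn S ≤ dayTwo l) ∧
      ∀ r ∈ S, G.colour r = .right → ¬ G.gameOn (G.delete S r) ≤ dayTwo k := by
  rw [le_iff]
  simp only [mem_rightOptions_gameOn, mem_leftOptions_dayTwo hk]
  refine and_congr ⟨?_, ?_⟩ ⟨?_, ?_⟩
  · exact fun h r hr => h _ ⟨r, hr, rfl⟩
  · rintro h _ ⟨r, hr, rfl⟩
    exact h r hr
  · exact fun h b hb hc => h _ ⟨b, hb, hc, rfl⟩
  · rintro h _ ⟨b, hb, hc, rfl⟩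
    exact h b hb hc

theorem not_gameOn_le_dayTwo_iff {k : ℕ} (hk : k < 22) : ¬ G.gameOn S ≤ dayTwo k ↔
    (∃ b ∈ S, G.colour b = .left ∧ dayTwo k ≤ G.gameOn (G.delete S b)) ∨
      ∃ r ∈ rightIndices k, dayTwo r ≤ G.gameOn S := by
  rw [gameOn_le_dayTwo_iff hk, not_and_or]
  push Not
  rfl

theorem not_dayTwo_le_gameOn_iff {k : ℕ} (hk : k < 22) : ¬ dayTwo k ≤ G.gameOn S ↔
    (∃ l ∈ leftIndices k, G.gameOn S ≤ dayTwo l) ∨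
      ∃ r ∈ S, G.colour r = .right ∧ G.gameOn (G.delete S r) ≤ dayTwo k := by
  rw [dayTwo_le_gameOn_iff hk, not_and_or]
  push Not
  rfl

theorem not_le_zero_iff : ¬ G.gameOn S ≤ dayTwo 0 ↔
    ∃ b ∈ S, G.colour b = .left ∧ dayTwo 0 ≤ G.gameOn (G.delete S b) := by
  simp [not_gameOn_le_dayTwo_iff, rightIndices]

theorem not_zero_le_iff : ¬ dayTwo 0 ≤ G.gameOn S ↔
    ∃ r ∈ S, G.colour r = .right ∧ G.gameOn (G.delete S r) ≤ dayTwo 0 := by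
  simp [not_dayTwo_le_gameOn_iff, leftIndices]

theorem zero_le_of_no_red (h : ∀ r ∈ S, G.colour r ≠ .right) : dayTwo 0 ≤ G.gameOn S := by
  by_contra h0
  obtain ⟨r, hr, hc, -⟩ := not_zero_le_iff.1 h0
  exact h r hr hc

theorem le_zero_of_no_blue (h : ∀ b ∈ S, G.colour b ≠ .left) : G.gameOn S ≤ dayTwo 0 := by
  by_contra h0
  obtain ⟨r, hr, hc, -⟩ := not_le_zero_iff.1 h0
  exact h r hr hc

theorem exists_red_of_not_zero_le (h : ¬ dayTwo 0 ≤ G.gameOn S) : ∃ r ∈ S, G.colour r = .right := by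
  obtain ⟨r, hr, hc, -⟩ := not_zero_le_iff.1 h
  exact ⟨r, hr, hc⟩

theorem exists_blue_of_not_le_zero (h : ¬ G.gameOn S ≤ dayTwo 0) : ∃ r ∈ S, G.colour r = .left := by
  obtain ⟨r, hr, hc, -⟩ := not_le_zero_iff.1 h
  exact ⟨r, hr, hc⟩

theorem not_le_zero_delete {r : V} (h : dayTwo 0 ≤ G.gameOn S) (hr : r ∈ S)
    (hc : G.colour r = .right) : ¬ G.gameOn (G.delete S r) ≤ dayTwo 0 :=
  ((dayTwo_le_gameOn_iff (by decide)).1 h).2 r hr hc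

theorem not_zero_le_delete {b : V} (h : G.gameOn S ≤ dayTwo 0) (hb : b ∈ S)
    (hc : G.colour b = .left) : ¬ dayTwo 0 ≤ G.gameOn (G.delete S b) :=
  ((gameOn_le_dayTwo_iff (by decide)).1 h).1 b hb hc

theorem not_zero_le_of_no_blue {r : V} (h : ∀ b ∈ S, G.colour b ≠ .left) (hr : r ∈ S)
    (hc : G.colour r = .right) : ¬ dayTwo 0 ≤ G.gameOn S := fun h0 =>
  not_le_zero_delete h0 hr hc
    (le_zero_of_no_blue fun b hb => h b (G.mem_delete.1 hb).1)

theorem not_le_zero_of_no_red {b : V} (h : ∀ r ∈ S, G.colour r ≠ .right) (hb : b ∈ S)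
    (hc : G.colour b = .left) : ¬ G.gameOn S ≤ dayTwo 0 := fun h0 =>
  not_zero_le_delete h0 hb hc
    (zero_le_of_no_red fun r hr => h r (G.mem_delete.1 hr).1)

theorem one_le_of_no_red {b : V} (h : ∀ r ∈ S, G.colour r ≠ .right) (hb : b ∈ S)
    (hc : G.colour b = .left) : dayTwo 2 ≤ G.gameOn S := by
  refine (dayTwo_le_gameOn_iff (by decide)).2 ⟨fun l hl => ?_, fun r hr hc => absurd hc (h r hr)⟩
  obtain rfl : l = 0 := by simpa [leftIndices] using hl
  exact not_le_zero_of_no_red h hb hc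

theorem moves_delete_subset (S : Finset V) (v : V) (p : Player) :
    G.moves (G.delete S v) p ⊆ G.moves S p := fun u hu => by
  rw [mem_moves, mem_delete] at hu
  exact (mem_moves _).2 ⟨hu.1.1, hu.2⟩

theorem card_moves_delete_le (S : Finset V) (v : V) (p : Player) :
    (G.moves (G.delete S v) p).card ≤ (G.moves S p).card :=
  Finset.card_le_card (moves_delete_subset S v p)

theorem card_moves_delete_lt {v : V} {p : Player} (hv : v ∈ S) (hc : G.colour v = p) :
    (G.moves (G.delete S v) p).card < (G.moves S p).card :=
  Finset.card_lt_card ((Finset.ssubset_iff_of_subset (moves_delete_subset S v p)).2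
    ⟨v, (mem_moves _).2 ⟨hv, hc⟩, fun h => ((G.mem_delete.1 ((mem_moves _).1 h).1).2.1 rfl)⟩)

theorem no_blue_of_card (h : (G.moves S .left).card = 0) : ∀ b ∈ S, G.colour b ≠ .left :=
  fun b hb hc => by
    rw [Finset.card_eq_zero] at h
    exact Finset.notMem_empty b (h ▸ (mem_moves _).2 ⟨hb, hc⟩)

theorem no_red_of_card (h : (G.moves S .right).card = 0) : ∀ b ∈ S, G.colour b ≠ .right :=
  fun b hb hc => by
    rw [Finset.card_eq_zero] at h
    exact Finset.notMem_empty b (h ▸ (mem_moves _).2 ⟨hb, hc⟩)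

theorem le_one_of_card (h : (G.moves S .left).card ≤ 1) : G.gameOn S ≤ dayTwo 2 := by
  refine (gameOn_le_dayTwo_iff (by decide)).2 ⟨fun b hb hc hle => ?_, by simp [rightIndices]⟩
  have := card_moves_delete_lt hb hc
  exact not_dayTwo_le_dayTwo (k := 2) (i := 0) (by decide)
    (hle.trans (le_zero_of_no_blue (no_blue_of_card (by omega))))

theorem le_two_of_card (h : (G.moves S .left).card ≤ 2) : G.gameOn S ≤ dayTwo 5 := by
  refine (gameOn_le_dayTwo_iff (by decide)).2 ⟨fun b hb hc hle => ?_, by simp [rightIndices]⟩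
  have := card_moves_delete_lt hb hc
  exact not_dayTwo_le_dayTwo (k := 5) (i := 2) (by decide) (hle.trans (le_one_of_card (by omega)))

theorem neg_one_le_of_card (h : (G.moves S .right).card ≤ 1) : dayTwo 1 ≤ G.gameOn S := by
  refine (dayTwo_le_gameOn_iff (by decide)).2 ⟨by simp [leftIndices], fun r hr hc hle => ?_⟩
  have := card_moves_delete_lt hr hc
  exact not_dayTwo_le_dayTwo (k := 0) (i := 1) (by decide)
    ((zero_le_of_no_red (no_red_of_card (by omega))).trans hle)

/-- Right has a move to a position `≤ *` from a position `≤ ↑` that is not `≤ 0`. -/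
theorem exists_delete_le_star (h : G.gameOn S ≤ dayTwo 8) (h0 : ¬ G.gameOn S ≤ dayTwo 0) :
    ∃ r ∈ S, G.colour r = .right ∧ G.gameOn (G.delete S r) ≤ dayTwo 3 := by
  rcases (not_dayTwo_le_gameOn_iff (by decide)).1
    (((gameOn_le_dayTwo_iff (by decide)).1 h).2 3 (by decide)) with ⟨l, hl, hle⟩ | h
  · obtain rfl : l = 0 := by simpa [leftIndices] using hl
    exact absurd hle h0
  · exact h

theorem exists_delete_le_zero_of_le_star (h : G.gameOn S ≤ dayTwo 3) :
    ∃ r ∈ S, G.colour r = .right ∧ G.gameOn (G.delete S r) ≤ dayTwo 0 :=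
  not_zero_le_iff.1 (((gameOn_le_dayTwo_iff (by decide)).1 h).2 0 (by decide))

theorem exists_delete_le_zero_of_le_upStar (h : G.gameOn S ≤ dayTwo 19) :
    ∃ r ∈ S, G.colour r = .right ∧ G.gameOn (G.delete S r) ≤ dayTwo 0 :=
  not_zero_le_iff.1 (((gameOn_le_dayTwo_iff (by decide)).1 h).2 0 (by decide))

theorem exists_delete_le_neg_one (h : G.gameOn S ≤ dayTwo 12) :
    ∃ r ∈ S, G.colour r = .right ∧ G.gameOn (G.delete S r) ≤ dayTwo 1 := by
  rcases (not_dayTwo_le_gameOn_iff (by decide)).1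
    (((gameOn_le_dayTwo_iff (by decide)).1 h).2 1 (by decide)) with ⟨l, hl, hle⟩ | h
  · simp [leftIndices] at hl
  · exact h

theorem not_zero_le_of_le_neg_one (h : G.gameOn S ≤ dayTwo 1) : ¬ dayTwo 0 ≤ G.gameOn S :=
  fun h0 => not_dayTwo_le_dayTwo (k := 0) (i := 1) (by decide) (h0.trans h)

theorem two_le_card_of_red {r s : V} (hr : r ∈ S) (hc : G.colour r = .right)
    (hs : s ∈ G.delete S r) (hc' : G.colour s = .right) : 2 ≤ (G.moves S .right).card := by
  have h1 := card_moves_delete_lt hr hc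
  have h2 := card_moves_delete_lt hs hc'
  omega

/-- Right moves to a position `≤ *`, from which he has yet another move to one `≤ 0`. -/
theorem two_le_card_of_up (h : G.gameOn S ≤ dayTwo 8) (h0 : ¬ G.gameOn S ≤ dayTwo 0) :
    2 ≤ (G.moves S .right).card := by
  obtain ⟨r, hr, hc, h1⟩ := exists_delete_le_star h h0
  obtain ⟨s, hs, hc', -⟩ := exists_delete_le_zero_of_le_star h1
  exact two_le_card_of_red hr hc hs hc'

/-- Right has a move to a position `≤ -1`, where a red vertex must remain. -/
theorem two_le_card_of_pm_one (h : G.gameOn S ≤ dayTwo 12) : 2 ≤ (G.moves S .right).card := by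
  obtain ⟨r, hr, hc, h1⟩ := exists_delete_le_neg_one h
  obtain ⟨s, hs, hc'⟩ := exists_red_of_not_zero_le (not_zero_le_of_le_neg_one h1)
  exact two_le_card_of_red hr hc hs hc'

/-- As 2 is a Left option of `extremal`, the position is not `≤ 2`. Since 2 has no Right options,
only a Left move can be responsible. -/
theorem exists_delete_ge_two (h : extremal ≤ G.gameOn S) :
    ∃ v ∈ S, G.colour v = .left ∧ dayTwo 5 ≤ G.gameOn (G.delete S v) := by
  rcases (not_gameOn_le_dayTwo_iff (by decide)).1 ((le_iff.1 h).1 (dayTwo 5)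
    (by simp [extremal, mem_leftOptions_ofLists])) with h | ⟨r, hr, -⟩
  · exact h
  · simp [rightIndices] at hr

theorem three_le_card_of_extremal_le (h : extremal ≤ G.gameOn S) :
    3 ≤ (G.moves S .left).card := by
  obtain ⟨v, hv, hc, hle⟩ := exists_delete_ge_two h
  by_contra hlt
  have := card_moves_delete_lt hv hc
  exact not_dayTwo_le_dayTwo (k := 5) (i := 2) (by decide) (hle.trans (le_one_of_card (by omega)))

/-- Either Left can reverse Right's move, or its result lies above a Right option of `extremal`.
Excluding the first alternative is what exhibits ↑, ↑* and ±1 as actual options. -/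
theorem extremal_le_delete_red {r : V} (h : extremal ≤ G.gameOn S) (hr : r ∈ S)
    (hc : G.colour r = .right) :
    (∃ b ∈ G.delete S r, G.colour b = .left ∧ extremal ≤ G.gameOn (G.delete (G.delete S r) b)) ∨
      ∃ i ∈ [8, 19, 12], dayTwo i ≤ G.gameOn (G.delete S r) := by
  rcases CGame.not_le_iff.1 ((le_iff.1 h).2 _ ((mem_rightOptions_gameOn _).2 ⟨r, hr, hc, rfl⟩))
    with ⟨_, hx, hle⟩ | ⟨y, hy, hle⟩
  · obtain ⟨b, hb, hcb, rfl⟩ := (mem_leftOptions_gameOn _).1 hx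
    exact .inl ⟨b, hb, hcb, hle⟩
  · rw [extremal, mem_rightOptions_ofLists] at hy
    simp only [List.mem_cons, List.not_mem_nil, or_false] at hy
    rcases hy with rfl | rfl | rfl
    · exact .inr ⟨8, by decide, hle⟩
    · exact .inr ⟨19, by decide, hle⟩
    · exact .inr ⟨12, by decide, hle⟩

theorem lt_of_mem_antichain {i : ℕ} (hi : i ∈ [8, 19, 12]) : i < 22 := by
  have : ∀ i ∈ [8, 19, 12], i < 22 := by decide
  exact this i hi

/-- If `extremal ≤ S` and `S` is not `≥` one of `↑`, `↑*`, `±1`, then Right can move to a position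
`≤` this game. -/
theorem exists_delete_le_of_not_le {i : ℕ} (hi : i ∈ [8, 19, 12]) (h : extremal ≤ G.gameOn S)
    (hle : ¬ dayTwo i ≤ G.gameOn S) :
    ∃ r ∈ S, G.colour r = .right ∧ G.gameOn (G.delete S r) ≤ dayTwo i := by
  rcases (not_dayTwo_le_gameOn_iff (lt_of_mem_antichain hi)).1 hle with ⟨l, hl, hle⟩ | h
  · exact absurd (h.trans hle) (not_extremal_le hi hl)
  · exact h

/-- If a position with at most two blue vertices is `≥ 2`, then it has no red vertices. -/
theorem no_red_of_two_le (h : dayTwo 5 ≤ G.gameOn S) (hcard : (G.moves S .left).card ≤ 2) :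
    ∀ r ∈ S, G.colour r ≠ .right := fun r hr hc =>
  ((dayTwo_le_gameOn_iff (by decide)).1 h).2 r hr hc
    (le_two_of_card ((card_moves_delete_le S r _).trans hcard))

theorem not_le_zero_of_two_le (h : dayTwo 5 ≤ G.gameOn S) : ¬ G.gameOn S ≤ dayTwo 0 :=
  fun h0 => not_dayTwo_le_dayTwo (k := 5) (i := 0) (by decide) (h.trans h0)

/-- In a small digraph whose game is `≥ extremal`, no Right option that is `≤ ↑`, `≤ ↑*`, or
`≤ ±1` is reversible. -/
theorem not_extremal_le_delete_delete {r b : V} {i : ℕ} (hi : i ∈ [8, 19, 12])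
    (hcard : (G.moves S .left).card + (G.moves S .right).card ≤ 7)
    (hr : r ∈ S) (hc : G.colour r = .right) (hle : G.gameOn (G.delete S r) ≤ dayTwo i)
    (hb : b ∈ G.delete S r) (hcb : G.colour b = .left) :
    ¬ extremal ≤ G.gameOn (G.delete (G.delete S r) b) := by
  -- The reversed position has three blue vertices, so `S` has at least four, and at most three red
  -- ones. Right must return below `dayTwo i` by some `r'`, after which at most one red vertex
  -- remains.
  intro hK
  have c1 := three_le_card_of_extremal_le hK
  have c2 := card_moves_delete_lt hb hcb
  have c3 := card_moves_delete_le (G := G) S r .left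
  have c4 := card_moves_delete_lt hr hc
  have c5 := card_moves_delete_le (G := G) (G.delete S r) b .right
  have hlt := lt_of_mem_antichain hi
  obtain ⟨r', hr', hc', hH⟩ := exists_delete_le_of_not_le hi hK
    (((gameOn_le_dayTwo_iff hlt).1 hle).1 b hb hcb)
  have c6 := card_moves_delete_lt hr' hc'
  have c7 := card_moves_delete_le (G := G) (G.delete (G.delete S r) b) r' .left
  -- A second reversal would use up another blue vertex, so that no red vertex is left for the move
  -- that Right needs next.
  rcases extremal_le_delete_red hK hr' hc' with ⟨b', hb', hcb', hK'⟩ | ⟨j, hj, hjH⟩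
  · have c8 := three_le_card_of_extremal_le hK'
    have c9 := card_moves_delete_lt hb' hcb'
    obtain ⟨q, hq, hcq, -⟩ := exists_delete_le_of_not_le hi hK'
      (((gameOn_le_dayTwo_iff hlt).1 hH).1 b' hb' hcb')
    exact no_red_of_card (by omega) q (G.mem_delete.1 hq).1 hcq
  -- Without it, the position after `r'` is equal to `dayTwo i`. For ↑ and ±1 two red vertices would
  -- be needed; only ↑* requires more work.
  · obtain rfl := antichain_of_le hj hi (hjH.trans hH)
    have hj' : j = 8 ∨ j = 19 ∨ j = 12 := by simpa using hj
    rcases hj' with rfl | rfl | rfl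
    · have := two_le_card_of_up hH fun h0 =>
        not_dayTwo_le_dayTwo (k := 8) (i := 0) (by decide) (hjH.trans h0)
      omega
    · obtain ⟨q, hq, hcq, -⟩ := exists_delete_le_zero_of_le_upStar hH
      have c8 := card_moves_delete_lt hq hcq
      -- After `v` at most two blue vertices and hence no red ones remain. By counting, `b` deletes
      -- no red vertex, so `v` played before `b` also deletes all red vertices and spares `w`. The
      -- result is `≥ 1 ≥ ↑*`, against `hle`.
      obtain ⟨v, hv, hcv, hP⟩ := exists_delete_ge_two hK
      have c9 := card_moves_delete_lt hv hcv
      have hno := no_red_of_two_le hP (by omega)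
      obtain ⟨w, hw, hcw⟩ := exists_blue_of_not_le_zero (not_le_zero_of_two_le hP)
      have heq : G.moves (G.delete (G.delete S r) b) .right = G.moves (G.delete S r) .right :=
        Finset.eq_of_subset_of_card_le (moves_delete_subset _ _ _) (by omega)
      refine ((gameOn_le_dayTwo_iff (by decide)).1 hle).1 v (G.mem_delete.1 hv).1 hcv
        ((dayTwo_le_dayTwo (k := 19) (i := 2) (by decide)).trans
          (one_le_of_no_red (b := w) (fun u hu hcu => ?_) ?_ hcw))
      · have hu' := G.mem_delete.1 hu
        have : u ∈ G.moves (G.delete (G.delete S r) b) .right :=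
          heq ▸ (mem_moves _).2 ⟨hu'.1, hcu⟩
        exact hno u (G.mem_delete.2 ⟨((mem_moves _).1 this).1, hu'.2⟩) hcu
      · have hw' := G.mem_delete.1 hw
        exact G.mem_delete.2 ⟨(G.mem_delete.1 hw'.1).1, hw'.2⟩
    · have := two_le_card_of_pm_one hH
      omega

/-! ### Exactly three red vertices. -/

theorem ne_left_of_eq_right {v : V} (h : G.colour v = .right) : G.colour v ≠ .left :=
  fun h' => Player.noConfusion (h.symm.trans h')

theorem not_le_up_of_ge {r : V} (h : dayTwo 8 ≤ G.gameOn S) (hr : r ∈ S)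
    (hc : G.colour r = .right) : ¬ G.gameOn (G.delete S r) ≤ dayTwo 0 := fun h0 =>
  ((dayTwo_le_gameOn_iff (by decide)).1 h).2 r hr hc
    (h0.trans (dayTwo_le_dayTwo (k := 0) (i := 8) (by decide)))

/-- A position without blue vertices that has a red vertex is `≤ ↑*`. -/
theorem le_upStar_of_no_blue {r : V} (h : ∀ b ∈ S, G.colour b ≠ .left) (hr : r ∈ S)
    (hc : G.colour r = .right) : G.gameOn S ≤ dayTwo 19 := by
  refine (gameOn_le_dayTwo_iff (by decide)).2 ⟨fun b hb hcb => absurd hcb (h b hb), fun l hl => ?_⟩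
  obtain rfl : l = 0 := by simpa [rightIndices] using hl
  exact not_zero_le_of_no_blue h hr hc

/-- A digraph with exactly three red vertices such that deleting their closed out-neighbourhoods
gives `↑`, `↑*`, and `±1`, respectively, does not exist. -/
theorem false_of_three_red {r₁ r₂ r₃ : V} (hr : ∀ r ∈ S, G.colour r = .right → r = r₁ ∨ r = r₂ ∨ r = r₃)
    (h₂ : r₂ ∈ S) (hc₂ : G.colour r₂ = .right)
    (up_le : dayTwo 8 ≤ G.gameOn (G.delete S r₁)) (le_up : G.gameOn (G.delete S r₁) ≤ dayTwo 8)
    (upStar_le : dayTwo 19 ≤ G.gameOn (G.delete S r₂))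
    (le_upStar : G.gameOn (G.delete S r₂) ≤ dayTwo 19)
    (le_pm_one : G.gameOn (G.delete S r₃) ≤ dayTwo 12) : False := by
  have red_eq : ∀ {r s}, r ∈ G.delete S s → G.colour r = .right →
      r ≠ s ∧ (r = r₁ ∨ r = r₂ ∨ r = r₃) := fun {r s} hrs hc =>
    ⟨(G.mem_delete.1 hrs).2.1, hr r (G.mem_delete.1 hrs).1 hc⟩
  have h0 : ¬ G.gameOn (G.delete S r₁) ≤ dayTwo 0 := fun h0 =>
    not_dayTwo_le_dayTwo (k := 8) (i := 0) (by decide) (up_le.trans h0)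
  -- both remaining red vertices occur after the deletions of `r₁` and of `r₃`
  obtain ⟨s, hs, hcs, hT⟩ := exists_delete_le_star le_up h0
  obtain ⟨s', hs', hcs', hT'⟩ := exists_delete_le_zero_of_le_star hT
  obtain ⟨t, ht, hct, hU⟩ := exists_delete_le_neg_one le_pm_one
  obtain ⟨t', ht', hct'⟩ := exists_red_of_not_zero_le (not_zero_le_of_le_neg_one hU)
  have hs1 := red_eq hs hcs
  have hs2 := red_eq (G.mem_delete.1 hs').1 hcs'
  have hs3 := (G.mem_delete.1 hs').2.1
  have ht1 := red_eq ht hct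
  have ht2 := red_eq (G.mem_delete.1 ht').1 hct'
  have ht3 := (G.mem_delete.1 ht').2.1
  -- no blue vertex survives the second Right move in either case
  have killed_pm : ∀ b ∈ G.delete (G.delete S r₃) t, G.colour b ≠ .left := by
    intro b hb hcb
    refine ((gameOn_le_dayTwo_iff (by decide)).1 hU).1 b hb hcb (neg_one_le_of_card ?_)
    refine (card_moves_delete_le _ _ _).trans (Finset.card_le_one.2 fun x hx y hy => ?_)
    rw [mem_moves] at hx hy
    have hx1 := red_eq (G.mem_delete.1 hx.1).1 hx.2
    have hy1 := red_eq (G.mem_delete.1 hy.1).1 hy.2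
    have hx2 := (G.mem_delete.1 hx.1).2.1
    have hy2 := (G.mem_delete.1 hy.1).2.1
    grind
  have killed_up : ∀ b ∈ G.delete S r₁, G.colour b = .left → G.Adj r₂ b ∨ G.Adj r₃ b := by
    intro b hb hcb
    by_contra hno
    push Not at hno
    have hbs : ∀ {q}, (q = r₁ ∨ q = r₂ ∨ q = r₃) → q ≠ r₁ → ¬ G.Adj q b := by
      rintro q (rfl | rfl | rfl) hq
      · exact absurd rfl hq
      · exact hno.1
      · exact hno.2
    have hbT : b ∈ G.delete (G.delete (G.delete S r₁) s) s' := by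
      refine G.mem_delete.2 ⟨G.mem_delete.2 ⟨hb, ?_, hbs hs1.2 hs1.1⟩, ?_, hbs hs2.2 hs2.1⟩
      · rintro rfl
        exact ne_left_of_eq_right hcs hcb
      · rintro rfl
        exact ne_left_of_eq_right hcs' hcb
    refine not_le_zero_of_no_red (fun q hq hcq => ?_) hbT hcb hT'
    have hq1 := G.mem_delete.1 hq
    have hq2 := G.mem_delete.1 hq1.1
    have hq3 := red_eq hq2.1 hcq
    grind
  have h21 : r₂ ∈ G.delete S r₁ ∧ r₃ ∈ G.delete S r₁ := by
    have := G.mem_delete.1 hs'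
    grind
  have h13 : r₁ ∈ G.delete S r₃ ∧ r₂ ∈ G.delete S r₃ := by
    have := G.mem_delete.1 ht'
    grind
  have hc₁ : G.colour r₁ = .right := by grind
  have hc₃ : G.colour r₃ = .right := by grind
  -- Right options of a position `≥ ↑` are not `≤ 0`: a blue `x` survives `r₁` and `r₃`, and a blue
  -- `p` survives `r₁` and `r₂`.
  obtain ⟨x, hx, hcx⟩ := exists_blue_of_not_le_zero (not_le_up_of_ge up_le h21.2 hc₃)
  obtain ⟨p, hp, hcp⟩ := exists_blue_of_not_le_zero (not_le_up_of_ge up_le h21.1 hc₂)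
  have hx1 := G.mem_delete.1 hx
  have hx2 := G.mem_delete.1 hx1.1
  have hp1 := G.mem_delete.1 hp
  have hp2 := G.mem_delete.1 hp1.1
  have h13' := G.mem_delete.1 h13.1
  have ht_eq : t = r₁ ∨ t = r₂ := by grind
  -- If Right's move to `≤ -1` after `r₃` is `r₁`, the blue vertex `x` survives it, contradicting
  -- `killed_pm`.
  rcases ht_eq with rfl | rfl
  · exact killed_pm x (G.mem_delete.2 ⟨G.mem_delete.2 ⟨hx2.1, hx1.2⟩, hx2.2⟩) hcx
  obtain rfl : t' = r₁ := by grind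
  have h12 : t' ∈ G.delete S t :=
    G.mem_delete.2 ⟨h13'.1, ht3, (G.mem_delete.1 ht').2.2⟩
  -- Now `t` is `r₂` and `t'` is `r₁`. If `r₃` survives `r₂`, choosing it next leaves `r₁` and no
  -- blue vertex, a position `≤ ↑*`, which no Right option of ↑* is. If not, `r₁` is the only red
  -- vertex after `r₂`, so it is Right's move to `≤ 0`; but it leaves `p` and no red vertex.
  by_cases h32 : r₃ ∈ G.delete S t
  · refine ((dayTwo_le_gameOn_iff (by decide)).1 upStar_le).2 r₃ h32 hc₃
      (le_upStar_of_no_blue (r := t') (fun b hb => ?_) ?_ hct')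
    · have hb1 := G.mem_delete.1 hb
      have hb2 := G.mem_delete.1 hb1.1
      exact killed_pm b (G.mem_delete.2 ⟨G.mem_delete.2 ⟨hb2.1, hb1.2⟩, hb2.2⟩)
    · exact G.mem_delete.2 ⟨h12, h13'.2⟩
  · obtain ⟨q, hq, hcq, hle⟩ := exists_delete_le_zero_of_le_upStar le_upStar
    have hq1 := red_eq hq hcq
    obtain rfl : q = t' := by
      rcases hq1.2 with h | h | h
      · exact h
      · exact absurd h hq1.1
      · exact absurd (h ▸ hq) h32
    refine not_le_zero_of_no_red (b := p) (fun u hu hcu => ?_) ?_ hcp hle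
    · have hu1 := G.mem_delete.1 hu
      have hu2 := red_eq hu1.1 hcu
      rcases hu2.2 with h | h | h
      · exact hu1.2.1 h
      · exact hu2.1 h
      · exact h32 (h ▸ hu1.1)
    · exact G.mem_delete.2 ⟨G.mem_delete.2 ⟨hp2.1, hp1.2⟩, hp2.2⟩

/-! ### Three blue and four red vertices: the structure of ↑ and ↑*. -/

/-- A position whose only blue vertex deletes all red vertices and is not deleted by any of them is
`≥ 0`. -/
theorem zero_le_of_dominating {w : V} (hw : w ∈ S) (hcw : G.colour w = .left)
    (h : ∀ q ∈ S, G.colour q = .right → G.Adj w q ∧ ¬ G.Adj q w) : dayTwo 0 ≤ G.gameOn S := by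
  by_contra h0
  obtain ⟨q, hq, hcq, hle⟩ := not_zero_le_iff.1 h0
  refine not_zero_le_delete hle (b := w) (G.mem_delete.2 ⟨hw, ?_, (h q hq hcq).2⟩) hcw
    (zero_le_of_no_red fun u hu hcu => ?_)
  · rintro rfl
    exact ne_left_of_eq_right hcq hcw
  · have hu1 := G.mem_delete.1 hu
    exact hu1.2.2 (h u (G.mem_delete.1 hu1.1).1 hcu).1

/-- A position with a blue vertex that deletes all red vertices and is not deleted by any of them
is `≥ ↑*`. -/
theorem upStar_le_of_dominating {w : V} (hw : w ∈ S) (hcw : G.colour w = .left)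
    (h : ∀ q ∈ S, G.colour q = .right → G.Adj w q ∧ ¬ G.Adj q w) : dayTwo 19 ≤ G.gameOn S := by
  have h0 := zero_le_of_dominating hw hcw h
  refine (dayTwo_le_gameOn_iff (by decide)).2 ⟨fun l hl => ?_, fun q hq hcq hle => ?_⟩
  · have hl' : l = 0 ∨ l = 3 := by simpa [leftIndices] using hl
    rcases hl' with rfl | rfl
    · exact fun hle => not_zero_le_delete hle hw hcw (zero_le_of_no_red fun u hu hcu =>
        (G.mem_delete.1 hu).2.2 (h u (G.mem_delete.1 hu).1 hcu).1)
    · exact fun hle => ((gameOn_le_dayTwo_iff (by decide)).1 hle).2 0 (by decide) h0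
  · refine ((gameOn_le_dayTwo_iff (by decide)).1 hle).2 0 (by decide)
      (zero_le_of_dominating (w := w) (G.mem_delete.2 ⟨hw, ?_, (h q hq hcq).2⟩) hcw
        fun u hu => h u (G.mem_delete.1 hu).1)
    rintro rfl
    exact ne_left_of_eq_right hcq hcw

theorem mem_delete_of_ne {u v : V} (hu : u ∈ S) (hne : u ≠ v) (h : ¬ G.Adj v u) :
    u ∈ G.delete S v :=
  G.mem_delete.2 ⟨hu, hne, h⟩

theorem ne_of_colour {u v : V} (hu : G.colour u = .left) (hv : G.colour v = .right) : u ≠ v := by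
  rintro rfl
  exact ne_left_of_eq_right hv hu

/-- A position with a blue vertex that deletes exactly the red vertices is not equal to `↑`. -/
theorem not_mem_of_up {v : V} (hcv : G.colour v = .left)
    (hred : ∀ q ∈ S, G.colour q = .right → G.Adj v q)
    (hblue : ∀ w ∈ S, G.colour w = .left → ¬ G.Adj v w)
    (up_le : dayTwo 8 ≤ G.gameOn S) (le_up : G.gameOn S ≤ dayTwo 8) : v ∉ S := by
  intro hv
  have hno : ∀ q ∈ G.delete S v, G.colour q ≠ .right := fun q hq hcq =>
    (G.mem_delete.1 hq).2.2 (hred q (G.mem_delete.1 hq).1 hcq)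
  -- Another blue vertex would survive `v`, which removes all red ones, so Left would have an option
  -- `≥ 1 ≥ ↑`. Consequently the blue vertex that must survive each red move is `v` itself.
  have honly : ∀ w ∈ S, G.colour w = .left → w = v := by
    intro w hw hcw
    by_contra hne
    exact ((gameOn_le_dayTwo_iff (by decide)).1 le_up).1 v hv hcv
      ((dayTwo_le_dayTwo (k := 8) (i := 2) (by decide)).trans
        (one_le_of_no_red hno (mem_delete_of_ne hw hne (hblue w hw hcw)) hcw))
  have hkill : ∀ q ∈ S, G.colour q = .right → ¬ G.Adj q v := by
    intro q hq hcq
    obtain ⟨w, hw, hcw⟩ := exists_blue_of_not_le_zero (not_le_up_of_ge up_le hq hcq)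
    exact honly w (G.mem_delete.1 hw).1 hcw ▸ (G.mem_delete.1 hw).2.2
  obtain ⟨s, hs, hcs, hT⟩ := exists_delete_le_star le_up fun h0 =>
    not_dayTwo_le_dayTwo (k := 8) (i := 0) (by decide) (up_le.trans h0)
  -- `v` outlives both of Right's moves, and from the position `≤ 0` reached Left plays `v`, leaving
  -- no red vertex.
  obtain ⟨s', hs', hcs', hT'⟩ := exists_delete_le_zero_of_le_star hT
  refine not_zero_le_delete hT' (b := v) (mem_delete_of_ne (mem_delete_of_ne hv
    (ne_of_colour hcv hcs) (hkill s hs hcs)) (ne_of_colour hcv hcs')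
    (hkill s' (G.mem_delete.1 hs').1 hcs')) hcv (zero_le_of_no_red fun q hq hcq => ?_)
  have hq1 := G.mem_delete.1 hq
  exact hq1.2.2 (hred q (G.mem_delete.1 (G.mem_delete.1 hq1.1).1).1 hcq)

/-- Left has a move to a position `≥ *` from a position equal to `↑*`. -/
theorem exists_delete_ge_star (upStar_le : dayTwo 19 ≤ G.gameOn S)
    (le_upStar : G.gameOn S ≤ dayTwo 19) :
    ∃ b ∈ S, G.colour b = .left ∧ dayTwo 3 ≤ G.gameOn (G.delete S b) := by
  rcases (not_gameOn_le_dayTwo_iff (by decide)).1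
    (((dayTwo_le_gameOn_iff (by decide)).1 upStar_le).1 3 (by decide)) with h | ⟨l, hl, hle⟩
  · exact h
  · obtain rfl : l = 0 := by simpa [rightIndices] using hl
    exact absurd hle (((gameOn_le_dayTwo_iff (by decide)).1 le_upStar).2 0 (by decide))

theorem not_le_zero_of_star_le (h : dayTwo 3 ≤ G.gameOn S) : ¬ G.gameOn S ≤ dayTwo 0 :=
  ((dayTwo_le_gameOn_iff (by decide)).1 h).1 0 (by decide)

/-- A position with a blue vertex that deletes exactly the red vertices is not equal to `↑*`. -/
theorem not_mem_of_upStar {v : V} (hcv : G.colour v = .left)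
    (hred : ∀ q ∈ S, G.colour q = .right → G.Adj v q)
    (hblue : ∀ w ∈ S, G.colour w = .left → ¬ G.Adj v w)
    (upStar_le : dayTwo 19 ≤ G.gameOn S) (le_upStar : G.gameOn S ≤ dayTwo 19) : v ∉ S := by
  intro hv
  have hno : ∀ q ∈ G.delete S v, G.colour q ≠ .right := fun q hq hcq =>
    (G.mem_delete.1 hq).2.2 (hred q (G.mem_delete.1 hq).1 hcq)
  have honly : ∀ w ∈ S, G.colour w = .left → w = v := by
    intro w hw hcw
    by_contra hne
    exact ((gameOn_le_dayTwo_iff (by decide)).1 le_upStar).1 v hv hcv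
      ((dayTwo_le_dayTwo (k := 19) (i := 2) (by decide)).trans
        (one_le_of_no_red hno (mem_delete_of_ne hw hne (hblue w hw hcw)) hcw))
  -- Left's move to a position `≥ *` must leave her another blue vertex, but `v` is the only one.
  obtain ⟨b, hb, hcb, hle⟩ := exists_delete_ge_star upStar_le le_upStar
  obtain ⟨w, hw, hcw⟩ := exists_blue_of_not_le_zero (not_le_zero_of_star_le hle)
  exact (G.mem_delete.1 hw).2.1
    ((honly w (G.mem_delete.1 hw).1 hcw).trans (honly b hb hcb).symm)

/-- The structure of a position equal to `↑*` with at most two blue vertices. -/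
theorem exists_of_upStar (hcard : (G.moves S .left).card ≤ 2)
    (upStar_le : dayTwo 19 ≤ G.gameOn S) (le_upStar : G.gameOn S ≤ dayTwo 19) :
    ∃ w₁ ∈ S, ∃ w₂ ∈ S, G.colour w₁ = .left ∧ G.colour w₂ = .left ∧ w₁ ≠ w₂ ∧ ¬ G.Adj w₁ w₂ ∧
      G.Adj w₂ w₁ ∧ (∀ b ∈ S, G.colour b = .left → b = w₁ ∨ b = w₂) ∧
      (∀ q ∈ S, G.colour q = .right → G.Adj w₂ q) ∧
      ¬ dayTwo 0 ≤ G.gameOn (G.delete S w₁) ∧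
      ∀ q ∈ G.delete S w₁, G.colour q = .right →
        dayTwo 0 ≤ G.gameOn (G.delete (G.delete S w₁) q) := by
  -- `w₁` is Left's move to a position `≥ *`, and `w₂` her next move from there to one `≥ 0`.
  obtain ⟨w₁, hw₁, hc₁, hT⟩ := exists_delete_ge_star upStar_le le_upStar
  obtain ⟨w₂, hw₂', hc₂, hT0⟩ := not_le_zero_iff.1 (not_le_zero_of_star_le hT)
  obtain ⟨hw₂, hne, hadj⟩ := G.mem_delete.1 hw₂'
  have honly : ∀ b ∈ S, G.colour b = .left → b = w₁ ∨ b = w₂ := by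
    classical
    intro b hb hcb
    by_contra hno
    push Not at hno
    have hsub : ({w₁, w₂, b} : Finset V) ⊆ G.moves S .left := by
      intro u hu
      simp only [Finset.mem_insert, Finset.mem_singleton] at hu
      rcases hu with rfl | rfl | rfl
      · exact (mem_moves _).2 ⟨hw₁, hc₁⟩
      · exact (mem_moves _).2 ⟨hw₂, hc₂⟩
      · exact (mem_moves _).2 ⟨hb, hcb⟩
    have := (Finset.card_le_card hsub).trans hcard
    rw [Finset.card_eq_three.2 ⟨w₁, w₂, b, hne.symm, hno.1.symm, hno.2.symm, rfl⟩] at this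
    omega
  have hkill : ∀ q ∈ G.delete S w₁, G.colour q = .right → G.Adj w₂ q := by
    intro q hq hcq
    by_contra hno
    refine not_zero_le_of_no_blue (r := q) (fun b hb hcb => ?_)
      (mem_delete_of_ne hq (ne_of_colour hc₂ hcq).symm hno) hcq hT0
    have hb1 := G.mem_delete.1 hb
    have hb2 := G.mem_delete.1 hb1.1
    rcases honly b hb2.1 hcb with rfl | rfl
    · exact hb2.2.1 rfl
    · exact hb1.2.1 rfl
  have hpos : ∀ q ∈ G.delete S w₁, G.colour q = .right →
      dayTwo 0 ≤ G.gameOn (G.delete (G.delete S w₁) q) := by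
    intro q hq hcq
    rcases (not_gameOn_le_dayTwo_iff (by decide)).1
      (((dayTwo_le_gameOn_iff (by decide)).1 hT).2 q hq hcq) with ⟨b, hb, hcb, hle⟩ | ⟨l, hl, hle⟩
    · refine absurd (le_zero_of_no_blue fun u hu hcu => ?_) (not_le_zero_of_star_le hle)
      have hu1 := G.mem_delete.1 hu
      have hu2 := G.mem_delete.1 (G.mem_delete.1 hu1.1).1
      have hb2 := G.mem_delete.1 (G.mem_delete.1 hb).1
      have h1 := (honly u hu2.1 hcu).resolve_left hu2.2.1
      have h2 := (honly b hb2.1 hcb).resolve_left hb2.2.1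
      exact hu1.2.1 (h1.trans h2.symm)
    · obtain rfl : l = 0 := by simpa [rightIndices] using hl
      exact hle
  -- Otherwise every red vertex left by `w₁` spares `w₂` and is deleted by it, making this Left
  -- option `≥ ↑*`.
  have hnot : ¬ dayTwo 0 ≤ G.gameOn (G.delete S w₁) := by
    intro h0
    refine ((gameOn_le_dayTwo_iff (by decide)).1 le_upStar).1 w₁ hw₁ hc₁
      (upStar_le_of_dominating hw₂' hc₂ fun q hq hcq => ⟨hkill q hq hcq, ?_⟩)
    obtain ⟨b, hb, hcb⟩ := exists_blue_of_not_le_zero (not_le_zero_delete h0 hq hcq)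
    have hb1 := G.mem_delete.1 hb
    have hb2 := G.mem_delete.1 hb1.1
    exact (honly b hb2.1 hcb).resolve_left hb2.2.1 ▸ hb1.2.2
  obtain ⟨b, hb, hcb, hb0⟩ := not_le_zero_iff.1
    (((dayTwo_le_gameOn_iff (by decide)).1 upStar_le).1 0 (by decide))
  obtain rfl : b = w₂ := (honly b hb hcb).resolve_left fun h => hnot (h ▸ hb0)
  -- Since `w₁` does not lead to `≥ 0`, Left's winning first move is `w₂`. Were `w₁` to survive it,
  -- `w₁` would dominate the remaining red vertices and this Left option would be `≥ ↑*`.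
  have hadj' : G.Adj b w₁ := by
    by_contra hno
    have hw₁' : w₁ ∈ G.delete S b := mem_delete_of_ne hw₁ hne.symm hno
    refine ((gameOn_le_dayTwo_iff (by decide)).1 le_upStar).1 b hb hcb
      (upStar_le_of_dominating hw₁' hc₁ fun q hq hcq => ⟨?_, ?_⟩)
    · have hq1 := G.mem_delete.1 hq
      by_contra hno'
      exact hq1.2.2 (hkill q (mem_delete_of_ne hq1.1 (ne_of_colour hc₁ hcq).symm hno') hcq)
    · obtain ⟨u, hu, hcu⟩ := exists_blue_of_not_le_zero (not_le_zero_delete hb0 hq hcq)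
      have hu1 := G.mem_delete.1 hu
      have hu2 := G.mem_delete.1 hu1.1
      exact (honly u hu2.1 hcu).resolve_right hu2.2.1 ▸ hu1.2.2
  refine ⟨w₁, hw₁, b, hb, hc₁, hc₂, hne.symm, hadj, hadj', honly, fun q hq hcq => ?_, hnot, hpos⟩
  by_contra hno
  refine not_zero_le_of_no_blue (r := q) (fun u hu hcu => ?_)
      (mem_delete_of_ne hq (ne_of_colour hc₂ hcq).symm hno) hcq hb0
  have hu1 := G.mem_delete.1 hu
  rcases honly u hu1.1 hcu with rfl | rfl
  · exact hu1.2.2 hadj'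
  · exact hu1.2.1 rfl

/-- The structure of a position equal to `↑` with at most three red vertices and at most two blue
vertices, where at least one of the latter deletes the other. -/
theorem exists_of_up {w₁ w₂ : V} (hc₁ : G.colour w₁ = .left) (hc₂ : G.colour w₂ = .left)
    (hne : w₁ ≠ w₂) (hadj : ¬ G.Adj w₁ w₂) (hadj' : G.Adj w₂ w₁)
    (honly : ∀ b ∈ S, G.colour b = .left → b = w₁ ∨ b = w₂)
    (hcard : (G.moves S .right).card ≤ 3)
    (up_le : dayTwo 8 ≤ G.gameOn S) (le_up : G.gameOn S ≤ dayTwo 8) :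
    w₁ ∈ S ∧ w₂ ∈ S ∧
      (∃ a ∈ S, G.colour a = .right ∧ G.Adj a w₁ ∧ ¬ G.Adj a w₂) ∧
      ∃ a ∈ S, G.colour a = .right ∧ G.Adj a w₂ ∧ ¬ G.Adj a w₁ := by
  have h0 : ¬ G.gameOn S ≤ dayTwo 0 := fun h0 =>
    not_dayTwo_le_dayTwo (k := 8) (i := 0) (by decide) (up_le.trans h0)
  have hopt : ∀ q ∈ S, G.colour q = .right →
      ∃ b ∈ G.delete S q, G.colour b = .left ∧ dayTwo 0 ≤ G.gameOn (G.delete (G.delete S q) b) :=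
    fun q hq hcq => not_le_zero_iff.1 (not_le_up_of_ge up_le hq hcq)
  -- `c` is Left's winning first move; `r` and `r'` lead Right through a position `≤ *` to one `≤
  -- 0`, in which at most one red vertex remains.
  obtain ⟨c, hc, hcc, hc0⟩ := not_le_zero_iff.1 h0
  obtain ⟨r, hr, hcr, hT⟩ := exists_delete_le_star le_up h0
  obtain ⟨r', hr', hcr', hT'⟩ := exists_delete_le_zero_of_le_star hT
  have hr'S := (G.mem_delete.1 hr').1
  have hTS : ∀ {u}, u ∈ G.delete (G.delete S r) r' → u ∈ S := fun hu =>
    (G.mem_delete.1 (G.mem_delete.1 hu).1).1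
  -- a position in which only one blue vertex remains
  have hsingle : ∀ w, (∀ b ∈ S, G.colour b = .left → b = w) → False := by
    intro w hw
    obtain rfl := hw c hc hcc
    have hkill : ∀ q ∈ S, G.colour q = .right → ¬ G.Adj q c := by
      intro q hq hcq
      obtain ⟨b, hb, hcb, -⟩ := hopt q hq hcq
      exact hw b (G.mem_delete.1 hb).1 hcb ▸ (G.mem_delete.1 hb).2.2
    refine not_zero_le_delete hT' (b := c) (mem_delete_of_ne (mem_delete_of_ne hc
      (ne_of_colour hcc hcr) (hkill r hr hcr)) (ne_of_colour hcc hcr')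
      (hkill r' hr'S hcr')) hcc (zero_le_of_no_red fun q hq hcq => ?_)
    have hq1 := G.mem_delete.1 hq
    refine not_zero_le_of_no_blue (r := q) (fun b hb hcb => ?_)
      (mem_delete_of_ne (hTS hq1.1) hq1.2.1 hq1.2.2) hcq hc0
    exact (G.mem_delete.1 hb).2.1 (hw b (G.mem_delete.1 hb).1 hcb)
  have hw₁ : w₁ ∈ S := by
    by_contra hno
    exact hsingle w₂ fun b hb hcb => (honly b hb hcb).resolve_left fun h => hno (h ▸ hb)
  have hw₂ : w₂ ∈ S := by
    by_contra hno
    exact hsingle w₁ fun b hb hcb => (honly b hb hcb).resolve_right fun h => hno (h ▸ hb)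
  have hboth : ∀ q ∈ S, G.colour q = .right → G.Adj q w₁ → ¬ G.Adj q w₂ := by
    intro q hq hcq h1 h2
    obtain ⟨b, hb, hcb, -⟩ := hopt q hq hcq
    have hb1 := G.mem_delete.1 hb
    rcases honly b hb1.1 hcb with rfl | rfl
    · exact hb1.2.2 h1
    · exact hb1.2.2 h2
  have hthird : ∀ {q u}, q ∈ G.delete (G.delete S r) r' → G.colour q = .right →
      u ∈ G.delete (G.delete S r) r' → G.colour u = .right → u = q := by
    intro q u hq hcq hu hcu
    have c1 := card_moves_delete_lt hr hcr
    have c2 := card_moves_delete_lt hr' hcr'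
    exact Finset.card_le_one.1 (by omega) u ((mem_moves _).2 ⟨hu, hcu⟩) q
      ((mem_moves _).2 ⟨hq, hcq⟩)
  -- after a move of `w₂`, no blue vertex remains
  have hw₂_move : ∀ {P : Finset V}, P ⊆ S → ∀ {q}, q ∈ P → G.colour q = .right → ¬ G.Adj w₂ q →
      ¬ dayTwo 0 ≤ G.gameOn (G.delete P w₂) := by
    intro P hP q hq hcq hno
    refine not_zero_le_of_no_blue (r := q) (fun b hb hcb => ?_)
      (mem_delete_of_ne hq (ne_of_colour hc₂ hcq).symm hno) hcq
    have hb1 := G.mem_delete.1 hb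
    rcases honly b (hP hb1.1) hcb with rfl | rfl
    · exact hb1.2.2 hadj'
    · exact hb1.2.1 rfl
  have hdel : ∀ u, G.delete S u ⊆ S := fun u x hx => (G.mem_delete.1 hx).1
  have hT'S : G.delete (G.delete S r) r' ⊆ S := fun x hx => hTS hx
  have hT'r' : ∀ {q}, q ∈ G.delete (G.delete S r) r' → q ∈ G.delete S r' := fun hq =>
    mem_delete_of_ne (hTS hq) (G.mem_delete.1 hq).2.1 (G.mem_delete.1 hq).2.2
  have hmemT' : ∀ {w}, w ∈ S → G.colour w = .left → ¬ G.Adj r w → ¬ G.Adj r' w →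
      w ∈ G.delete (G.delete S r) r' := fun hw hcw h1 h2 =>
    mem_delete_of_ne (mem_delete_of_ne hw (ne_of_colour hcw hcr) h1) (ne_of_colour hcw hcr') h2
  -- Otherwise `w₂` survives `r` and `r'`, and the last red vertex `q` survives `w₂`. Then `w₂`
  -- answers neither `r` nor `r'`, so `w₁` must answer `r'`; but `r` deletes `w₁`, since otherwise
  -- `w₂` would outlast `q`. So `r` has no answer.
  have claim₁ : ∃ a ∈ S, G.colour a = .right ∧ G.Adj a w₂ := by
    by_contra hno
    push Not at hno
    have hw₂T := hmemT' hw₂ hc₂ (hno r hr hcr) (hno r' hr'S hcr')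
    have hnot := not_zero_le_delete hT' hw₂T hc₂
    obtain ⟨q, hq, hcq⟩ := exists_red_of_not_zero_le hnot
    obtain ⟨hqT, -, hqw⟩ := G.mem_delete.1 hq
    obtain ⟨b, hb, hcb, hb0⟩ := hopt r' hr'S hcr'
    have hb1 := G.mem_delete.1 hb
    rcases honly b hb1.1 hcb with rfl | rfl
    · have hr_adj : G.Adj r b := by
        by_contra hnadj
        have hbT := hmemT' hw₁ hc₁ hnadj hb1.2.2
        obtain ⟨q', hq', hcq', hle⟩ := not_zero_le_iff.1 (not_zero_le_delete hT' hbT hcb)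
        obtain rfl := hthird hqT hcq (G.mem_delete.1 hq').1 hcq'
        refine not_le_zero_of_no_red (b := w₂) (fun u hu hcu => ?_)
          (mem_delete_of_ne (mem_delete_of_ne hw₂T hne.symm hadj) (ne_of_colour hc₂ hcq)
            (hno q' (hTS hqT) hcq)) hc₂ hle
        have hu1 := G.mem_delete.1 hu
        exact hu1.2.1 (hthird hqT hcq (G.mem_delete.1 hu1.1).1 hcu)
      obtain ⟨e, he, hce, he0⟩ := hopt r hr hcr
      have he1 := G.mem_delete.1 he
      rcases honly e he1.1 hce with rfl | rfl
      · exact he1.2.2 hr_adj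
      · exact hw₂_move (hdel r) (G.mem_delete.1 hqT).1 hcq hqw he0
    · exact hw₂_move (hdel r') (hT'r' hqT) hcq hqw hb0
  -- Otherwise `w₁` survives `r` and `r'`, and the last red vertex `q` survives `w₁`. If `w₂`
  -- survives too, `q` deletes it but also survives it, so neither blue vertex can be `c`. If not,
  -- `r` or `r'` deletes `w₂`, and the only answer `w₁` leaves `q` and no blue vertex.
  have claim₂ : ∃ a ∈ S, G.colour a = .right ∧ G.Adj a w₁ := by
    by_contra hno
    push Not at hno
    have hw₁T := hmemT' hw₁ hc₁ (hno r hr hcr) (hno r' hr'S hcr')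
    obtain ⟨q, hq, hcq, hle⟩ := not_zero_le_iff.1 (not_zero_le_delete hT' hw₁T hc₁)
    obtain ⟨hqT, -, hqw⟩ := G.mem_delete.1 hq
    by_cases hw₂T : w₂ ∈ G.delete (G.delete S r) r'
    · have hqw₂ : G.Adj q w₂ := by
        by_contra hnadj
        refine not_le_zero_of_no_red (b := w₂) (fun u hu hcu => ?_)
          (mem_delete_of_ne (mem_delete_of_ne hw₂T hne.symm hadj) (ne_of_colour hc₂ hcq)
            hnadj) hc₂ hle
        have hu1 := G.mem_delete.1 hu
        exact hu1.2.1 (hthird hqT hcq (G.mem_delete.1 hu1.1).1 hcu)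
      obtain ⟨q', hq', hcq'⟩ := exists_red_of_not_zero_le (not_zero_le_delete hT' hw₂T hc₂)
      obtain rfl := hthird hqT hcq (G.mem_delete.1 hq').1 hcq'
      rcases honly c hc hcc with rfl | rfl
      · refine not_le_zero_delete hc0 (mem_delete_of_ne (hTS hqT) (ne_of_colour hcc hcq).symm hqw)
          hcq (le_zero_of_no_blue fun b hb hcb => ?_)
        have hb1 := G.mem_delete.1 hb
        have hb2 := G.mem_delete.1 hb1.1
        rcases honly b hb2.1 hcb with rfl | rfl
        · exact hb2.2.1 rfl
        · exact hb1.2.2 hqw₂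
      · exact hw₂_move (Finset.Subset.refl S) (hTS hqT) hcq (G.mem_delete.1 hq').2.2 hc0
    · have hcontra : ∀ s ∈ S, G.colour s = .right → G.Adj s w₂ → q ∈ G.delete S s → False := by
        intro s hs hcs hsw hqs
        obtain ⟨b, hb, hcb, hb0⟩ := hopt s hs hcs
        have hb1 := G.mem_delete.1 hb
        rcases honly b hb1.1 hcb with rfl | rfl
        · refine not_zero_le_of_no_blue (r := q) (fun u hu hcu => ?_)
            (mem_delete_of_ne hqs (ne_of_colour hcb hcq).symm hqw) hcq hb0
          have hu1 := G.mem_delete.1 hu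
          have hu2 := G.mem_delete.1 hu1.1
          rcases honly u hu2.1 hcu with rfl | rfl
          · exact hu1.2.1 rfl
          · exact hu2.2.2 hsw
        · exact hb1.2.2 hsw
      by_cases h1 : G.Adj r w₂
      · exact hcontra r hr hcr h1 (G.mem_delete.1 hqT).1
      by_cases h2 : G.Adj r' w₂
      · exact hcontra r' hr'S hcr' h2 (hT'r' hqT)
      exact hw₂T (hmemT' hw₂ hc₂ h1 h2)
  obtain ⟨a, ha, hca, ha₂⟩ := claim₁
  obtain ⟨a', ha', hca', ha₁⟩ := claim₂
  exact ⟨hw₁, hw₂, ⟨a', ha', hca', ha₁, hboth a' ha' hca' ha₁⟩,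
    a, ha, hca, ha₂, fun h => hboth a ha hca h ha₂⟩

/-- A digraph with three blue vertices and at most four red vertices in which one blue vertex
deletes exactly the red vertices does not have Right options `↑` and `↑*`. -/
theorem false_of_three_blue {v r₁ r₂ : V} (hv : v ∈ S) (hcv : G.colour v = .left)
    (hred : ∀ q ∈ S, G.colour q = .right → G.Adj v q)
    (hblue : ∀ w ∈ S, G.colour w = .left → ¬ G.Adj v w)
    (hcardb : (G.moves S .left).card ≤ 3) (hcardr : (G.moves S .right).card ≤ 4)
    (h₁ : r₁ ∈ S) (hcr₁ : G.colour r₁ = .right) (h₂ : r₂ ∈ S) (hcr₂ : G.colour r₂ = .right)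
    (h12 : r₁ ≠ r₂)
    (up_le : dayTwo 8 ≤ G.gameOn (G.delete S r₁)) (le_up : G.gameOn (G.delete S r₁) ≤ dayTwo 8)
    (upStar_le : dayTwo 19 ≤ G.gameOn (G.delete S r₂))
    (le_upStar : G.gameOn (G.delete S r₂) ≤ dayTwo 19) : False := by
  classical
  have hdel : ∀ {u x}, x ∈ G.delete S u → x ∈ S := fun hx => (G.mem_delete.1 hx).1
  have hv₁ : v ∉ G.delete S r₁ := not_mem_of_up hcv (fun q hq => hred q (hdel hq))
    (fun w hw => hblue w (hdel hw)) up_le le_up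
  have hv₂ : v ∉ G.delete S r₂ := not_mem_of_upStar hcv (fun q hq => hred q (hdel hq))
    (fun w hw => hblue w (hdel hw)) upStar_le le_upStar
  have hcard₂ : (G.moves (G.delete S r₂) .left).card ≤ 2 := by
    have : (G.moves (G.delete S r₂) .left).card < (G.moves S .left).card :=
      Finset.card_lt_card ((Finset.ssubset_iff_of_subset (moves_delete_subset S r₂ _)).2
        ⟨v, (mem_moves _).2 ⟨hv, hcv⟩, fun h => hv₂ ((mem_moves _).1 h).1⟩)
    omega
  obtain ⟨w₁, hw₁, w₂, hw₂, hc₁, hc₂, hne, hadj, hadj', honly₂, hkill, hnot, hpos⟩ :=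
    exists_of_upStar hcard₂ upStar_le le_upStar
  have hvw₁ : v ≠ w₁ := fun h => hv₂ (h ▸ hw₁)
  have hvw₂ : v ≠ w₂ := fun h => hv₂ (h ▸ hw₂)
  have hblues : G.moves S .left = {v, w₁, w₂} := by
    refine (Finset.eq_of_subset_of_card_le (fun u hu => ?_) ?_).symm
    · simp only [Finset.mem_insert, Finset.mem_singleton] at hu
      rcases hu with rfl | rfl | rfl
      · exact (mem_moves _).2 ⟨hv, hcv⟩
      · exact (mem_moves _).2 ⟨hdel hw₁, hc₁⟩
      · exact (mem_moves _).2 ⟨hdel hw₂, hc₂⟩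
    · rwa [Finset.card_eq_three.2 ⟨v, w₁, w₂, hvw₁, hvw₂, hne, rfl⟩]
  have honly₁ : ∀ b ∈ G.delete S r₁, G.colour b = .left → b = w₁ ∨ b = w₂ := by
    intro b hb hcb
    have : b ∈ G.moves S .left := (mem_moves _).2 ⟨hdel hb, hcb⟩
    rw [hblues] at this
    simp only [Finset.mem_insert, Finset.mem_singleton] at this
    exact this.resolve_left fun h => hv₁ (h ▸ hb)
  have hcard₁ : (G.moves (G.delete S r₁) .right).card ≤ 3 := by
    have := card_moves_delete_lt h₁ hcr₁
    omega
  obtain ⟨hw₁', hw₂', ⟨a, ha, hca, haw₁, haw₂⟩, b, hb, hcb, hbw₂, hbw₁⟩ :=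
    exists_of_up hc₁ hc₂ hne hadj hadj' honly₁ hcard₁ up_le le_up
  have nadj₁ := (G.mem_delete.1 hw₁').2.2
  have nadj₁' := (G.mem_delete.1 hw₂').2.2
  have nadj₂ := (G.mem_delete.1 hw₁).2.2
  have nadj₂' := (G.mem_delete.1 hw₂).2.2
  -- `r₂` deletes neither `w₁` nor `w₂`, so it differs from `a` and `b`, and these four exhaust the
  -- red vertices.
  have hreds : ∀ q ∈ S, G.colour q = .right → q = r₁ ∨ q = r₂ ∨ q = a ∨ q = b := by
    intro q hq hcq
    have hab : a ≠ b := by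
      rintro rfl
      exact hbw₁ haw₁
    have ha₂ : r₂ ≠ a := by
      rintro rfl
      exact nadj₂ haw₁
    have hb₂ : r₂ ≠ b := by
      rintro rfl
      exact nadj₂' hbw₂
    have ha₁ := (G.mem_delete.1 ha).2.1.symm
    have hb₁ := (G.mem_delete.1 hb).2.1.symm
    have heq : G.moves S .right = {r₁, r₂, a, b} := by
      refine (Finset.eq_of_subset_of_card_le (fun u hu => ?_) ?_).symm
      · simp only [Finset.mem_insert, Finset.mem_singleton] at hu
        rcases hu with rfl | rfl | rfl | rfl
        · exact (mem_moves _).2 ⟨h₁, hcr₁⟩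
        · exact (mem_moves _).2 ⟨h₂, hcr₂⟩
        · exact (mem_moves _).2 ⟨hdel ha, hca⟩
        · exact (mem_moves _).2 ⟨hdel hb, hcb⟩
      · rw [Finset.card_insert_of_notMem (by simp [h12, ha₁, hb₁]),
          Finset.card_eq_three.2 ⟨r₂, a, b, ha₂, hb₂, hab, rfl⟩]
        exact hcardr
    have : q ∈ G.moves S .right := (mem_moves _).2 ⟨hq, hcq⟩
    rw [heq] at this
    simpa only [Finset.mem_insert, Finset.mem_singleton] using this
  have heq_b : ∀ {q}, q ∈ S → G.colour q = .right → G.Adj q w₂ → q = b := by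
    intro q hq hcq h
    rcases hreds q hq hcq with rfl | rfl | rfl | rfl
    · exact absurd h nadj₁'
    · exact absurd h nadj₂'
    · exact absurd h haw₂
    · rfl
  -- `w₂` deletes everything after the deletion of `r₂`
  have hw₂_zero : ∀ {P : Finset V}, P ⊆ G.delete S r₂ → dayTwo 0 ≤ G.gameOn (G.delete P w₂) :=
    fun {P} hP => zero_le_of_no_red fun q hq hcq =>
      (G.mem_delete.1 hq).2.2 (hkill q (hP (G.mem_delete.1 hq).1) hcq)
  -- Right's move from ↑* to `≤ 0` must delete `w₂`, which would otherwise clear all red vertices.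
  -- Only `b` does so.
  obtain ⟨p, hp, hcp, hT⟩ := exists_delete_le_zero_of_le_upStar le_upStar
  have hsub : ∀ {u}, G.delete (G.delete S r₂) u ⊆ G.delete S r₂ :=
    fun {u} x hx => (G.mem_delete.1 hx).1
  have hpw : G.Adj p w₂ := by
    by_contra hno
    exact not_zero_le_delete hT (mem_delete_of_ne hw₂ (ne_of_colour hc₂ hcp) hno) hc₂
      (hw₂_zero hsub)
  obtain rfl := heq_b (hdel hp) hcp hpw
  have hw₁T : w₁ ∈ G.delete (G.delete S r₂) p :=
    mem_delete_of_ne hw₁ (ne_of_colour hc₁ hcp) hbw₁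
  have honlyT : ∀ u ∈ G.delete (G.delete S r₂) p, G.colour u = .left → u = w₁ := by
    intro u hu hcu
    refine (honly₂ u (hsub hu) hcu).resolve_right ?_
    rintro rfl
    exact (G.mem_delete.1 hu).2.2 hpw
  -- A Right option of ↑* is not `≤ ↑*`. Left has no reply `≥ ↑*` here, as `w₁` is her last vertex,
  -- so the reason is that the position is `≥ 0`.
  have hT0 : dayTwo 0 ≤ G.gameOn (G.delete (G.delete S r₂) p) := by
    rcases (not_gameOn_le_dayTwo_iff (by decide)).1
      (((dayTwo_le_gameOn_iff (by decide)).1 upStar_le).2 p hp hcp) with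
        ⟨u, hu, hcu, hle⟩ | ⟨l, hl, hle⟩
    · refine absurd (hle.trans (le_zero_of_no_blue fun x hx hcx => ?_))
        (not_dayTwo_le_dayTwo (k := 19) (i := 0) (by decide))
      have hx1 := G.mem_delete.1 hx
      exact hx1.2.1 ((honlyT x hx1.1 hcx).trans (honlyT u hu hcu).symm)
    · obtain rfl : l = 0 := by simpa [rightIndices] using hl
      exact hle
  -- The position is now both `≤ 0` and `≥ 0` with `w₁` its only blue vertex, so some red `q`
  -- survives `w₁` and spares it. Only `r₁` qualifies.
  obtain ⟨q, hq, hcq⟩ := exists_red_of_not_zero_le (not_zero_le_delete hT hw₁T hc₁)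
  obtain ⟨hqT, -, hw₁q⟩ := G.mem_delete.1 hq
  obtain ⟨hq₂, hqp, hpq⟩ := G.mem_delete.1 hqT
  have hqw₁ : ¬ G.Adj q w₁ := by
    obtain ⟨u, hu, hcu⟩ := exists_blue_of_not_le_zero (not_le_zero_delete hT0 hqT hcq)
    exact honlyT u (G.mem_delete.1 hu).1 hcu ▸ (G.mem_delete.1 hu).2.2
  obtain rfl : q = r₁ := by
    rcases hreds q (hdel hq₂) hcq with h | h | h | h
    · exact h
    · exact absurd h (G.mem_delete.1 hq₂).2.1
    · exact absurd (h ▸ haw₁) hqw₁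
    · exact absurd h hqp
  -- After `r₂` and `w₁`, Right's winning move is again the red vertex that deletes `w₂`. It leaves
  -- `r₁` and no blue vertex, although `hpos` makes the result `≥ 0`.
  obtain ⟨s, hs, hcs, hs0⟩ := not_zero_le_iff.1 hnot
  have hsw : G.Adj s w₂ := by
    by_contra hno
    refine not_zero_le_delete hs0 (mem_delete_of_ne (mem_delete_of_ne hw₂ hne.symm hadj)
      (ne_of_colour hc₂ hcs) hno) hc₂ (hw₂_zero fun x hx => ?_)
    exact (G.mem_delete.1 (G.mem_delete.1 hx).1).1
  obtain rfl := heq_b (hdel (G.mem_delete.1 hs).1) hcs hsw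
  refine not_zero_le_of_no_blue (r := q) (fun x hx hcx => ?_)
    (mem_delete_of_ne (mem_delete_of_ne hq₂ (ne_of_colour hc₁ hcq).symm hw₁q) hqp hpq) hcq
    (hpos s hs hcs)
  have hx1 := G.mem_delete.1 hx
  have hx2 := G.mem_delete.1 hx1.1
  rcases honly₂ x hx2.1 hcx with rfl | rfl
  · exact hx2.2.1 rfl
  · exact hx1.2.2 hsw

/-! ### Assembling the lower bound and the theorem. -/

/-- The game `{2 | ↑, ↑*, ±1}` is not realized by a digraph with at most seven vertices. -/
theorem not_equal_extremal [Fintype V] (G : ColouredDigraph V) (hV : Fintype.card V ≤ 7) :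
    ¬ Equal G.game extremal := by
  rw [equal_iff]
  rintro ⟨hle, hge⟩
  unfold game at hle hge
  have hcard : (G.moves Finset.univ .left).card + (G.moves Finset.univ .right).card ≤ 7 := by
    classical
    rw [← Finset.card_union_of_disjoint]
    · exact (Finset.card_le_univ _).trans hV
    · exact Finset.disjoint_left.2 fun u hu hu' =>
        ne_left_of_eq_right ((mem_moves _).1 hu').2 ((mem_moves _).1 hu).2
  -- Right has a move below each of the three options; being irreversible, it is also above one of
  -- them, necessarily the same by the antichain property.
  have hoption : ∀ i ∈ [8, 19, 12], ∃ r, G.colour r = .right ∧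
      dayTwo i ≤ G.gameOn (G.delete Finset.univ r) ∧
        G.gameOn (G.delete Finset.univ r) ≤ dayTwo i := by
    intro i hi
    have hmem : dayTwo i ∈ extremal.rightOptions := by
      rw [extremal, mem_rightOptions_ofLists]
      simp only [List.mem_cons, List.not_mem_nil, or_false] at hi ⊢
      rcases hi with rfl | rfl | rfl <;> simp
    obtain ⟨r, hr, hc, hri⟩ := exists_delete_le_of_not_le hi hge ((le_iff.1 hle).2 _ hmem)
    rcases extremal_le_delete_red hge hr hc with ⟨b, hb, hcb, hrev⟩ | ⟨j, hj, hjr⟩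
    · exact absurd hrev (not_extremal_le_delete_delete hi hcard hr hc hri hb hcb)
    · obtain rfl := antichain_of_le hj hi (hjr.trans hri)
      exact ⟨r, hc, hjr, hri⟩
  obtain ⟨r₁, hc₁, up_le, le_up⟩ := hoption 8 (by decide)
  obtain ⟨r₂, hc₂, upStar_le, le_upStar⟩ := hoption 19 (by decide)
  obtain ⟨r₃, hc₃, pm_le, le_pm⟩ := hoption 12 (by decide)
  have h12 : r₁ ≠ r₂ := by
    rintro rfl
    exact not_dayTwo_le_dayTwo (k := 8) (i := 19) (by decide) (up_le.trans le_upStar)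
  have h13 : r₁ ≠ r₃ := by
    rintro rfl
    exact not_dayTwo_le_dayTwo (k := 8) (i := 12) (by decide) (up_le.trans le_pm)
  have h23 : r₂ ≠ r₃ := by
    rintro rfl
    exact not_dayTwo_le_dayTwo (k := 19) (i := 12) (by decide) (upStar_le.trans le_pm)
  have hblue := three_le_card_of_extremal_le hge
  by_cases hreds : ∀ r, G.colour r = .right → r = r₁ ∨ r = r₂ ∨ r = r₃
  · exact false_of_three_red (fun r _ => hreds r) (Finset.mem_univ r₂) hc₂ up_le le_up upStar_le
      le_upStar le_pm
  push Not at hreds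
  obtain ⟨r₄, hc₄, h41, h42, h43⟩ := hreds
  have hfour : 4 ≤ (G.moves Finset.univ .right).card := by
    classical
    have hsub : ({r₄, r₁, r₂, r₃} : Finset V) ⊆ G.moves Finset.univ .right := by
      intro u hu
      simp only [Finset.mem_insert, Finset.mem_singleton] at hu
      refine (mem_moves _).2 ⟨Finset.mem_univ u, ?_⟩
      rcases hu with rfl | rfl | rfl | rfl <;> assumption
    have := Finset.card_le_card hsub
    rwa [Finset.card_insert_of_notMem (by simp [h41, h42, h43]),
      Finset.card_eq_three.2 ⟨r₁, r₂, r₃, h12, h13, h23, rfl⟩] at this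
  -- There are now exactly three blue and four red vertices. A position `≥ 2` with at most two blue
  -- vertices has no red ones and needs both blue ones, so `v` deletes precisely the red vertices
  -- besides itself.
  obtain ⟨v, hv, hcv, hP⟩ := exists_delete_ge_two hge
  have hlt := card_moves_delete_lt hv hcv
  have hno := no_red_of_two_le hP (by omega)
  have htwo : 2 ≤ (G.moves (G.delete Finset.univ v) .left).card := by
    by_contra hlt2
    exact not_dayTwo_le_dayTwo (k := 5) (i := 2) (by decide)
      (hP.trans (le_one_of_card (by omega)))
  refine false_of_three_blue (S := Finset.univ) hv hcv (fun q _ hcq => ?_) (fun w _ hcw hvw => ?_)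
    (by omega) (by omega) (Finset.mem_univ r₁) hc₁ (Finset.mem_univ r₂) hc₂ h12 up_le le_up
    upStar_le le_upStar
  · by_contra hvq
    exact hno q (mem_delete_of_ne (Finset.mem_univ q) (ne_of_colour hcv hcq).symm hvq) hcq
  · classical
    have hsub : G.moves (G.delete Finset.univ v) .left ⊆
        ((G.moves Finset.univ .left).erase v).erase w := by
      intro u hu
      have hu1 := (mem_moves _).1 hu
      have hu2 := G.mem_delete.1 hu1.1
      refine Finset.mem_erase.2 ⟨?_, Finset.mem_erase.2 ⟨hu2.2.1, (mem_moves _).2 ⟨hu2.1, hu1.2⟩⟩⟩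
      rintro rfl
      exact hu2.2.2 hvw
    have hwv : w ≠ v := by
      rintro rfl
      exact G.loopless w hvw
    have := Finset.card_le_card hsub
    rw [Finset.card_erase_of_mem (Finset.mem_erase.2 ⟨hwv, (mem_moves _).2
      ⟨Finset.mem_univ w, hcw⟩⟩), Finset.card_erase_of_mem ((mem_moves _).2 ⟨hv, hcv⟩)] at this
    omega

end ColouredDigraph

namespace CGame

theorem exists_minVertices {X : CGame} {n : ℕ} (h : X.RealizableOn n) :
    ∃ k ≤ n, X.MinVertices k := by
  classical
  have hne : ∃ n, X.RealizableOn n := ⟨n, h⟩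
  exact ⟨Nat.find hne, Nat.find_min' hne h, Nat.find_spec hne, fun m hm => Nat.find_min' hne hm⟩

theorem realizableOn_eight {X : CGame} (hX : X.birthday ≤ 3) : X.RealizableOn 8 := by
  obtain ⟨c, -, hc⟩ := ColouredDigraph.exists_code_of_birthday_le_three hX
  exact ⟨Fin 8, inferInstance, ColouredDigraph.ofCode c, Fintype.card_fin 8, equal_iff.2 hc⟩

theorem minVertices_extremal : extremal.MinVertices 8 := by
  refine ⟨realizableOn_eight birthday_extremal.le, fun n hn => ?_⟩
  obtain ⟨V, _, G, hV, hG⟩ := hn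
  by_contra hlt
  exact ColouredDigraph.not_equal_extremal G (by omega) hG

end CGame

theorem theorem1 :
    (∀ X : CGame, X.birthday ≤ 3 →
      ∃ (V : Type) (_ : Fintype V) (G : ColouredDigraph V),
        Fintype.card V ≤ 8 ∧ CGame.Equal G.game X) ∧
    (∃ X : CGame, X.birthday = 3 ∧
      ∀ (V : Type) [Fintype V] (H : ColouredDigraph V),
        Fintype.card V ≤ 7 → ¬ CGame.Equal H.game X) ∧
    CGame.MaxMinVertices 3 8 ∧
    (CGame.valuesBornBy 3).ncard = 1474 := by
  refine ⟨fun X hX => ?_, ⟨CGame.extremal, CGame.birthday_extremal,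
    fun V _ H hV => H.not_equal_extremal hV⟩, ⟨fun X hX => ?_, ?_, ?_⟩,
    ColouredDigraph.ncard_valuesBornBy_three⟩
  · obtain ⟨V, i, G, hV, hG⟩ := CGame.realizableOn_eight hX
    exact ⟨V, i, G, hV.le, hG⟩
  · obtain ⟨k, -, hk⟩ := CGame.exists_minVertices (CGame.realizableOn_eight hX)
    exact ⟨k, hk⟩
  · exact ⟨CGame.extremal, CGame.birthday_extremal.le, CGame.minVertices_extremal⟩
  · rintro n ⟨X, hX, hn⟩
    exact hn.2 (CGame.realizableOn_eight hX)
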